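/- Notation. For a real matrix $A$, $\|A\|$ and $\|A\|_F$ are the spectral and the Frobenius norm, and $\|e_i^\top A\|$ is the Euclidean norm of the $i$-th row. For $M$ of rank $k\ge 1$, $\sigma_{\min}(M)=\sigma_k(M)$ is the smallest nonzero singular value and $\kappa(M)=\|M\|/\sigma_{\min}(M)$. A rank-$k$ matrix $M\in\mathbb{R}^{d_1\times d_2}$ with compact SVD $M=XSY^\top$ is $\mu$-incoherent if $\frac{d_1}{k}\max_i\|e_i^\top X\|^2\le\mu$ and $\frac{d_2}{k}\max_j\|e_j^\top Y\|^2\le\mu$. For $\Omega\subset[d_1]\times[d_2]$, $\mathcal P_\Omega(M)$ agrees with $M$ on $\Omega$ and is zero elsewhere. A top-$k$ SVD of $A$ is obtained from a singular value decomposition of $A$ by keeping the $k$ largest singular values (ties broken arbitrarily) and replacing the others by $0$. A random set $\Omega$ is called uniformly sampled if it is (a) uniformly distributed over the subsets of a fixed cardinality $m$, or (b) the set of values of $n$ independent uniform draws of a position, or (c) obtained by including every position independently with the same probability $p$. Statement. There is a universal constant $c_0>0$ such that the following hold. (1) Let $M\in\mathbb{R}^{d_1\times d_2}$ have rank $k\ge1$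 and be $\mu$-incoherent, let $d=\max\{d_1,d_2\}$, let $\Omega\subset[d_1]\times[d_2]$ be uniformly sampled and let $m=|\Omega|$. Then, with probability at least $1-\frac1{d^{10}}$: if $m\ge c_0\,\mu d k^2\kappa(M)^2\log d$, then every top-$k$ SVD $U_0V_0^\top$ (with $U_0\in\mathbb{R}^{d_1\times k}$, $V_0\in\mathbb{R}^{d_2\times k}$) of $\frac{d_1d_2}{m}\mathcal P_\Omega(M)$ satisfies $$\|M-U_0V_0^\top\|_F\le\tfrac1{20}\sigma_{\min}(M),\qquad \max_i\|e_i^\top U_0V_0^\top\|^2\le\frac{10\mu k}{d_1}\|M\|^2,\qquad \max_j\|e_j^\top V_0U_0^\top\|^2\le\frac{10\mu k}{d_2}\|M\|^2 .$$ (2) Let moreover $d_1=d_2=d$ and let $M$ be symmetric positive semidefinite. (2a) With probability at least $1-\frac1{d^{10}}$: if $m=|\Omega|\ge c_0\,\mu d k^2\kappa(M)^2\log d$, then for every top-$k$ SVD $U_0V_0^\top$ of $\frac{d^2}{m}\mathcal P_\Omega(M)$ whose factors $U_0,V_0\in\mathbb{R}^{d\times k}$ are balanced, i.e. $U_0^\top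 U_0=V_0^\top V_0$ (in particular if $U_0=V_0$), $$\|M-U_0V_0^\top\|_F\le\tfrac1{20}\sigma_{\min}(M),\qquad \max_j\|e_j^\top U_0\|^2\le\frac{10\mu k\,\kappa(M)}{d}\|M\|,\qquad \max_j\|e_j^\top V_0\|^2\le\frac{10\mu k\,\kappa(M)}{d}\|M\| .$$ (2b) If every sampled entry $M_{ij}$ is also used at the position $(j,i)$, i.e. $\Omega$ is replaced by $\hat\Omega=\Omega\cup\{(j,i):(i,j)\in\Omega\}$, then with probability at least $1-\frac1{d^{10}}$: if $m=|\hat\Omega|\ge c_0\,\mu d k^2\kappa(M)^2\log d$, then $\frac{d^2}{m}\mathcal P_{\hat\Omega}(M)$ has a top-$k$ SVD of the form $U_0U_0^\top$ with $U_0\in\mathbb{R}^{d\times k}$, and every such $U_0$ satisfies $$\|M-U_0U_0^\top\|_F\le\tfrac1{20}\sigma_{\min}(M),\qquad \max_j\|e_j^\top U_0\|^2\le\frac{10\mu k\,\kappa(M)}{d}\|M\| .$$ -/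

import Mathlib

open MeasureTheory ProbabilityTheory
open scoped Matrix

noncomputable section

namespace MatrixCompletion

/-- The Frobenius norm of a real matrix. -/
def frobNorm {m n : ℕ} (A : Matrix (Fin m) (Fin n) ℝ) : ℝ :=
  (Matrix.frobeniusNormedAddCommGroup : NormedAddCommGroup (Matrix (Fin m) (Fin n) ℝ)).norm A

/-- The spectral norm of a real matrix (operator norm for the Euclidean norms). -/
def specNorm {m n : ℕ} (A : Matrix (Fin m) (Fin n) ℝ) : ℝ :=
  (Matrix.instL2OpNormedAddCommGroup : NormedAddCommGroup (Matrix (Fin m) (Fin n) ℝ)).norm A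

/-- The Euclidean norm of the `i`-th row of a real matrix. -/
def rowNorm {m n : ℕ} (A : Matrix (Fin m) (Fin n) ℝ) (i : Fin m) : ℝ :=
  ‖(WithLp.toLp 2 (A i) : EuclideanSpace ℝ (Fin n))‖

/-- The smallest nonzero singular value of a matrix: for a matrix of rank `k ≥ 1` this is its
`k`-th largest singular value (Mathlib numbers the singular values from `0`). -/
def sigmaMin {m n : ℕ} (A : Matrix (Fin m) (Fin n) ℝ) : ℝ :=
  (Matrix.toEuclideanLin A).singularValues (A.rank - 1)

/-- The condition number: the ratio of the largest to the smallest nonzero singular value. -/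
def condNum {m n : ℕ} (A : Matrix (Fin m) (Fin n) ℝ) : ℝ :=
  specNorm A / sigmaMin A

/-- The coherence of a matrix `W` with `k` orthonormal columns,
`(d / k) * max_i ‖e_iᵀ W‖ ^ 2`. -/
def coherence {d k : ℕ} (W : Matrix (Fin d) (Fin k) ℝ) : ℝ :=
  (d : ℝ) / k * ⨆ i : Fin d, rowNorm W i ^ 2

/-- `M = X * diag s * Yᵀ` is a compact singular value decomposition with `k` positive singular
values, and the coherences of `X` and `Y` are at most `μ`. (The coherences depend only on the
column spaces of `X` and `Y`, hence only on `M`.) -/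
def IsIncoherent {d₁ d₂ : ℕ} (M : Matrix (Fin d₁) (Fin d₂) ℝ) (k : ℕ) (μ : ℝ) : Prop :=
  ∃ (X : Matrix (Fin d₁) (Fin k) ℝ) (s : Fin k → ℝ) (Y : Matrix (Fin d₂) (Fin k) ℝ),
    Xᵀ * X = 1 ∧ Yᵀ * Y = 1 ∧ (∀ i, 0 < s i) ∧ M = X * Matrix.diagonal s * Yᵀ ∧
      max (coherence X) (coherence Y) ≤ μ

/-- `B` is a top-`k` singular value decomposition of `A`: for some singular value decomposition
`A = X * diag s * Yᵀ` with the singular values in decreasing order, `B` is obtained by keeping the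
first `k` of them and replacing the others by zero. -/
def IsTopSVD {d₁ d₂ : ℕ} (k : ℕ) (A B : Matrix (Fin d₁) (Fin d₂) ℝ) : Prop :=
  ∃ (n : ℕ) (X : Matrix (Fin d₁) (Fin n) ℝ) (s : Fin n → ℝ) (Y : Matrix (Fin d₂) (Fin n) ℝ),
    Xᵀ * X = 1 ∧ Yᵀ * Y = 1 ∧ Antitone s ∧ (∀ i, 0 ≤ s i) ∧
      A = X * Matrix.diagonal s * Yᵀ ∧
      B = X * Matrix.diagonal (fun i : Fin n => if (i : ℕ) < k then s i else 0) * Yᵀ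

open Classical in
/-- The projection of `M` on the set `Ω` of coordinates. -/
def proj {d₁ d₂ : ℕ} (Ω : Set (Fin d₁ × Fin d₂)) (M : Matrix (Fin d₁) (Fin d₂) ℝ) :
    Matrix (Fin d₁) (Fin d₂) ℝ :=
  Matrix.of fun i j => if (i, j) ∈ Ω then M i j else 0

/-- The rescaled observation `(d₁ d₂ / m) P_Ω(M)` with `m = |Ω|`. -/
def rescaledObs {d₁ d₂ : ℕ} (Ω : Set (Fin d₁ × Fin d₂)) (M : Matrix (Fin d₁) (Fin d₂) ℝ) :
    Matrix (Fin d₁) (Fin d₂) ℝ :=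
  (((d₁ : ℝ) * d₂) / (Ω.ncard : ℝ)) • proj Ω M

/-- The laws of a uniformly sampled random set of elements of a finite type `ι`:
* the uniform law on the subsets of a given size `m`;
* the law of the set of values of `n` independent uniformly distributed elements;
* the law of the set that contains each element independently with a given probability `p`. -/
inductive IsUniformSampling {ι : Type} [Fintype ι] [MeasurableSpace ι] :
    Measure (Set ι) → Prop
  | subset (m : ℕ) (hm : m ≤ Fintype.card ι) :
      IsUniformSampling (uniformOn {Ω : Set ι | Ω.ncard = m})
  | draws (n : ℕ) :
      IsUniformSampling
        ((Measure.pi fun _ : Fin n => (uniformOn Set.univ : Measure ι)).map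
          fun ω : Fin n → ι => Set.range ω)
  | bernoulli (p : unitInterval) :
      IsUniformSampling (setBernoulli (Set.univ : Set ι) p)

/-- The positions of a symmetric matrix that are known once the positions in `Ω` are observed. -/
def symmClosure {d : ℕ} (Ω : Set (Fin d × Fin d)) : Set (Fin d × Fin d) :=
  {x | x ∈ Ω ∨ x.swap ∈ Ω}

end MatrixCompletion

end

noncomputable section

namespace MatrixCompletion

section LeaveOneOut

variable {E : Type*} [NormedAddCommGroup E] [InnerProductSpace ℝ E]

/-- `P` is an orthogonal projection that commutes with `T`, such that `T` is bounded below by `b`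
on the range of `P` and bounded above by `s` on its kernel. -/
structure SpectralGap (T P : E →ₗ[ℝ] E) (b s : ℝ) : Prop where
  symm : P.IsSymmetric
  idem : ∀ x, P (P x) = P x
  comm : ∀ x, T (P x) = P (T x)
  lower : ∀ x, b * ‖P x‖ ≤ ‖T (P x)‖
  upper : ∀ x, ‖T (x - P x)‖ ≤ s * ‖x - P x‖

namespace SpectralGap

variable {T T' P Q : E →ₗ[ℝ] E} {b s : ℝ}

lemma norm_sq_add (h : SpectralGap T P b s) (x : E) :
    ‖x‖ ^ 2 = ‖P x‖ ^ 2 + ‖x - P x‖ ^ 2 := by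
  have h0 : inner ℝ (P x) (x - P x) = 0 := by
    rw [h.symm, map_sub, h.idem, sub_self, inner_zero_right]
  have := norm_add_sq_real (P x) (x - P x)
  rw [h0] at this
  simpa using this

lemma norm_apply_le (h : SpectralGap T P b s) (x : E) : ‖P x‖ ≤ ‖x‖ := by
  have := h.norm_sq_add x
  exact le_of_abs_le (abs_le_of_sq_le_sq (by nlinarith [sq_nonneg ‖x - P x‖]) (norm_nonneg _))

lemma norm_sub_apply_le (h : SpectralGap T P b s) (x : E) : ‖x - P x‖ ≤ ‖x‖ := by
  have := h.norm_sq_add x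
  exact le_of_abs_le (abs_le_of_sq_le_sq (by nlinarith [sq_nonneg ‖P x‖]) (norm_nonneg _))

/-- A one-sided Davis–Kahan bound. -/
lemma norm_apply_sub_le [FiniteDimensional ℝ E] (hP : SpectralGap T P b s)
    (hQ : SpectralGap T' Q b s) (hs : 0 ≤ s) (hsb : s < b) {c : ℝ} (hc0 : 0 ≤ c)
    (hc : ∀ x, ‖Q (T' x) - Q (T x)‖ ≤ c * ‖x‖) (x : E) :
    (b - s) * ‖Q (x - P x)‖ ≤ c * ‖x‖ := by
  set Z : E →L[ℝ] E := LinearMap.toContinuousLinearMap (Q ∘ₗ (LinearMap.id - P)) with hZ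
  have hZx : ∀ x, Z x = Q (x - P x) := fun x => by simp [hZ]
  have hb : 0 < b := hs.trans_lt hsb
  have hK : ‖Z‖ ≤ (‖Z‖ * s + c) / b := by
    refine Z.opNorm_le_bound (by positivity) fun x => ?_
    rw [hZx, div_mul_eq_mul_div, le_div_iff₀ hb]
    set y := x - P x with hy
    have hPy : P y = 0 := by rw [hy, map_sub, hP.idem, sub_self]
    have hTy : Q (T y) = Z (T y) := by rw [hZx, ← hP.comm, hPy, map_zero, sub_zero]
    have hyx : ‖y‖ ≤ ‖x‖ := hP.norm_sub_apply_le x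
    have e1 := hQ.lower y
    have e2 : ‖T' (Q y)‖ ≤ ‖Z‖ * (s * ‖y‖) + c * ‖y‖ := by
      rw [hQ.comm]
      calc ‖Q (T' y)‖ = ‖Z (T y) + (Q (T' y) - Q (T y))‖ := by rw [← hTy]; congr 1; abel
        _ ≤ ‖Z (T y)‖ + ‖Q (T' y) - Q (T y)‖ := norm_add_le _ _
        _ ≤ ‖Z‖ * ‖T y‖ + c * ‖y‖ := add_le_add (Z.le_opNorm _) (hc y)
        _ ≤ _ := by have := hP.upper x; gcongr
    calc ‖Q y‖ * b ≤ (‖Z‖ * s + c) * ‖y‖ := by nlinarith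
      _ ≤ _ := by gcongr
  rw [le_div_iff₀ hb] at hK
  rw [← hZx]
  calc (b - s) * ‖Z x‖ ≤ (b - s) * (‖Z‖ * ‖x‖) :=
        mul_le_mul_of_nonneg_left (Z.le_opNorm x) (by linarith)
    _ = ((b - s) * ‖Z‖) * ‖x‖ := by ring
    _ ≤ c * ‖x‖ := mul_le_mul_of_nonneg_right (by linarith) (norm_nonneg _)

end SpectralGap

/-- Row bounds for a spectral truncation by the leave-one-out method. -/
theorem norm_apply_proj_le_of_leaveOneOut [FiniteDimensional ℝ E] {ι : Type*} [Finite ι]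
    (e : ι → E) (he : ∀ i, ‖e i‖ = 1) (T P : E →ₗ[ℝ] E) (T' Q : ι → E →ₗ[ℝ] E) (b f : ι → E)
    (r R : ι → ℝ) {σ S : ℝ} (hσ : 0 < σ) (hσS : σ ≤ S) (hR : ∀ i, 0 < R i)
    (hP : SpectralGap T P (3 / 4 * σ) (1 / 4 * σ))
    (hQ : ∀ i, SpectralGap (T' i) (Q i) (3 / 4 * σ) (1 / 4 * σ))
    (hTe : ∀ i, T (e i) = b i + r i • e i + f i) (hTe' : ∀ i, T' i (e i) = b i + r i • e i)
    (hdiff : ∀ i x, T x - T' i x = inner ℝ (f i) x • e i + inner ℝ (e i) x • f i)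
    (hf : ∀ i, ‖f i‖ ≤ 1 / 100 * σ) (hr : ∀ i, |r i| ≤ 1 / 100 * σ)
    (hb : ∀ i, ‖b i‖ ≤ 101 / 100 * (R i * S))
    (hg : ∀ i η τ, 0 ≤ η → 0 ≤ τ → (∀ j, ‖Q i (e j)‖ ≤ η * R j + τ) →
      ‖Q i (f i)‖ ≤ 1 / 100 * σ * (η * R i + τ)) (i : ι) :
    ‖T (P (e i))‖ ≤ 13 / 10 * (R i * S) := by
  have hS : 0 < S := hσ.trans_le hσS
  have hd : ∀ i (W : E →ₗ[ℝ] E) x, ‖W (T x - T' i x)‖ ≤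
      (1 / 100 * σ * ‖W (e i)‖ + ‖W (f i)‖) * ‖x‖ := fun i W x => by
    rw [hdiff, map_add, map_smul, map_smul]
    have h1 : ‖inner ℝ (f i) x • W (e i)‖ ≤ (1 / 100 * σ * ‖x‖) * ‖W (e i)‖ := by
      rw [norm_smul]
      refine mul_le_mul_of_nonneg_right ((norm_inner_le_norm _ _).trans ?_) (norm_nonneg _)
      exact mul_le_mul_of_nonneg_right (hf i) (norm_nonneg _)
    have h2 : ‖inner ℝ (e i) x • W (f i)‖ ≤ ‖x‖ * ‖W (f i)‖ := by
      rw [norm_smul]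
      refine mul_le_mul_of_nonneg_right ((norm_inner_le_norm _ _).trans ?_) (norm_nonneg _)
      rw [he, one_mul]
    refine (norm_add_le _ _).trans ?_
    nlinarith
  have hr' : ∀ i, ∀ W : E →ₗ[ℝ] E, ‖W (r i • e i)‖ ≤ 1 / 100 * σ * ‖W (e i)‖ := fun i W => by
    rw [map_smul, norm_smul]
    exact mul_le_mul_of_nonneg_right (hr i) (norm_nonneg _)
  -- rows of the leave-one-out projections
  have hq : ∀ i, σ * ‖Q i (e i)‖ ≤ 137 / 100 * (R i * S) := fun i => by
    have h1 := (hQ i).lower (e i)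
    rw [(hQ i).comm, hTe', map_add] at h1
    have h2 := norm_add_le (Q i (b i)) (Q i (r i • e i))
    have h3 := (hQ i).norm_apply_le (b i)
    have := hr' i (Q i)
    have := hb i
    have := mul_pos (hR i) hS
    nlinarith
  obtain ⟨η, hη0, hη, hηmax⟩ : ∃ η, 0 ≤ η ∧ (∀ j, ‖P (e j)‖ ≤ η * R j) ∧
      ∃ j, ‖P (e j)‖ = η * R j := by
    have : Nonempty ι := ⟨i⟩
    obtain ⟨j, hj⟩ := Finite.exists_max fun j => ‖P (e j)‖ / R j
    refine ⟨‖P (e j)‖ / R j, div_nonneg (norm_nonneg _) (hR j).le, fun l => ?_, j, ?_⟩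
    · rw [← div_le_iff₀ (hR l)]; exact hj l
    · rw [div_mul_cancel₀ _ (hR j).ne']
  have hgi : ∀ i, ‖Q i (f i)‖ ≤ 104 / 10000 * (η * σ * R i) + 3 / 10000 * (R i * S) := fun i => by
    set g := ‖Q i (f i)‖ with hgdef
    set c := 1 / 100 * σ * ‖Q i (e i)‖ + g with hc
    have hc0 : 0 ≤ c := by positivity
    have hτ : ∀ x, (3 / 4 * σ - 1 / 4 * σ) * ‖Q i (x - P x)‖ ≤ c * ‖x‖ :=
      hP.norm_apply_sub_le (hQ i) (by positivity) (by linarith) hc0 fun x => by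
        rw [norm_sub_rev, ← map_sub]; exact hd i (Q i) x
    have := hg i η (c / (1 / 2 * σ)) hη0 (by positivity) fun j => by
      have h1 : ‖Q i (e j)‖ ≤ ‖Q i (P (e j))‖ + ‖Q i (e j - P (e j))‖ := by
        refine le_trans (le_of_eq ?_) (norm_add_le _ _)
        rw [← map_add]; congr 2; abel
      have h2 := (hQ i).norm_apply_le (P (e j))
      have h3 : ‖Q i (e j - P (e j))‖ ≤ c / (1 / 2 * σ) := by
        rw [le_div_iff₀ (by positivity)]
        have := hτ (e j); rw [he] at this; linarith
      linarith [hη j]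
    have h4 : σ * (c / (1 / 2 * σ)) = 2 * c := by field_simp
    have h5 := hq i
    have : 1 / 100 * σ * (η * R i + c / (1 / 2 * σ)) = 1 / 100 * (η * σ * R i) + 1 / 100 * (2 * c) := by
      rw [← h4]; ring
    have := mul_pos (hR i) hS
    have : 0 ≤ η * σ * R i := mul_nonneg (mul_nonneg hη0 hσ.le) (hR i).le
    rw [hc] at *
    linarith
  have hh : ∀ i, ‖P (f i)‖ ≤ 103 / 100 * ‖Q i (f i)‖ + 21 / 100000 * (σ * ‖P (e i)‖) := fun i => by
    set c := 1 / 100 * σ * ‖P (e i)‖ + ‖P (f i)‖ with hc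
    have hc0 : 0 ≤ c := by positivity
    have hτ := (hQ i).norm_apply_sub_le hP (by positivity) (by linarith) hc0 (fun x => by
      rw [← map_sub]; exact hd i P x) (f i)
    have h1 : ‖P (f i)‖ ≤ ‖P (Q i (f i))‖ + ‖P (f i - Q i (f i))‖ := by
      refine le_trans (le_of_eq ?_) (norm_add_le _ _)
      rw [← map_add]; congr 2; abel
    have h2 := hP.norm_apply_le (Q i (f i))
    have h3 : (3 / 4 * σ - 1 / 4 * σ) * ‖P (f i - Q i (f i))‖ ≤ c * (1 / 100 * σ) :=
      hτ.trans (mul_le_mul_of_nonneg_left (hf i) hc0)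
    have h4 : ‖P (f i - Q i (f i))‖ ≤ 1 / 50 * c := by
      by_contra hcon
      push Not at hcon
      nlinarith
    have := norm_nonneg (Q i (f i))
    have : 0 ≤ σ * ‖P (e i)‖ := by positivity
    linarith
  have hTP : ∀ i, ‖T (P (e i))‖ ≤ 101 / 100 * (R i * S) + 1 / 100 * (σ * ‖P (e i)‖) + ‖P (f i)‖ :=
    fun i => by
      rw [hP.comm, hTe, map_add, map_add]
      refine (norm_add_le _ _).trans (add_le_add_left ((norm_add_le _ _).trans ?_) _)
      have := hP.norm_apply_le (b i)
      have := hr' i P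
      linarith [hb i]
  have hησ : η * σ ≤ 14 / 10 * S := by
    obtain ⟨j, hj⟩ := hηmax
    have h1 := hP.lower (e j)
    have h2 := hTP j
    have h3 := hh j
    have h4 := hgi j
    rw [hj] at h1 h2 h3
    have h5 : 0.72 * (η * σ * R j) ≤ 1.0108 * (R j * S) := by
      have := mul_pos (hR j) hS
      have : 0 ≤ η * σ * R j := mul_nonneg (mul_nonneg hη0 hσ.le) (hR j).le
      norm_num
      nlinarith
    by_contra hcon
    push Not at hcon
    have := mul_lt_mul_of_pos_left hcon (hR j)
    norm_num at h5
    nlinarith [mul_pos (hR j) hS]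
  have h2 := hTP i
  have h3 := hh i
  have h4 := hgi i
  have h5 : σ * ‖P (e i)‖ ≤ 14 / 10 * (R i * S) := by
    calc σ * ‖P (e i)‖ ≤ σ * (η * R i) := by gcongr; exact hη i
      _ = (η * σ) * R i := by ring
      _ ≤ 14 / 10 * S * R i := by have := (hR i).le; gcongr
      _ = _ := by ring
  have h6 : η * σ * R i ≤ 14 / 10 * (R i * S) := by
    calc (η * σ) * R i ≤ 14 / 10 * S * R i := by have := (hR i).le; gcongr
      _ = _ := by ring
  have := mul_pos (hR i) hS
  linarith

end LeaveOneOut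

section Bernoulli

set_option linter.unusedSectionVars false

variable {β : Type*} [Fintype β] [DecidableEq β]

/-- The probability of a Bernoulli outcome. -/
def bernWeight (p : ℝ) (b : Bool) : ℝ := if b then p else 1 - p

/-- The expectation of `f` over independent Bernoulli variables with parameter `p`. -/
def bernE (p : ℝ) (f : (β → Bool) → ℝ) : ℝ := ∑ ω, (∏ e, bernWeight p (ω e)) * f ω

/-- The centred and rescaled Bernoulli variable. -/
def bernXi (p : ℝ) (b : Bool) : ℝ := (if b then 1 else 0) / p - 1

lemma bernE_prod (p : ℝ) (h : β → Bool → ℝ) :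
    bernE p (fun ω => ∏ e, h e (ω e)) = ∏ e, (p * h e true + (1 - p) * h e false) := by
  have := Finset.prod_univ_sum (fun _ : β => (Finset.univ : Finset Bool))
    (fun e b => bernWeight p b * h e b)
  simp only [bernE, ← Finset.prod_mul_distrib]
  simp only [Fintype.piFinset_univ] at this
  rw [← this]
  simp [bernWeight]

lemma bernE_const (p c : ℝ) : bernE (β := β) p (fun _ => c) = c := by
  have h : bernE (β := β) p (fun _ => 1) = 1 := by
    have := bernE_prod (β := β) p (fun _ _ => 1)
    simpa using this
  simp only [bernE, ← Finset.sum_mul] at h ⊢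
  simp only [mul_one] at h
  rw [h, one_mul]

lemma bernE_add (p : ℝ) (f g : (β → Bool) → ℝ) :
    bernE p (fun ω => f ω + g ω) = bernE p f + bernE p g := by
  simp [bernE, mul_add, Finset.sum_add_distrib]

lemma bernE_sub (p : ℝ) (f g : (β → Bool) → ℝ) :
    bernE p (fun ω => f ω - g ω) = bernE p f - bernE p g := by
  simp [bernE, mul_sub, Finset.sum_sub_distrib]

lemma bernE_const_mul (p c : ℝ) (f : (β → Bool) → ℝ) :
    bernE p (fun ω => c * f ω) = c * bernE p f := by
  simp only [bernE, Finset.mul_sum]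
  exact Finset.sum_congr rfl fun _ _ => by ring

lemma bernE_mul_const (p c : ℝ) (f : (β → Bool) → ℝ) :
    bernE p (fun ω => f ω * c) = bernE p f * c := by
  simp only [mul_comm _ c, bernE_const_mul]

lemma bernE_sum {κ : Type*} (s : Finset κ) (p : ℝ) (f : κ → (β → Bool) → ℝ) :
    bernE p (fun ω => ∑ i ∈ s, f i ω) = ∑ i ∈ s, bernE p (f i) := by
  simp only [bernE, Finset.mul_sum]
  exact Finset.sum_comm

lemma bernWeight_prod_nonneg {p : ℝ} (h0 : 0 ≤ p) (h1 : p ≤ 1) (ω : β → Bool) :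
    0 ≤ ∏ e, bernWeight p (ω e) :=
  Finset.prod_nonneg fun e _ => by unfold bernWeight; split_ifs <;> linarith

lemma bernE_mono {p : ℝ} (h0 : 0 ≤ p) (h1 : p ≤ 1) {f g : (β → Bool) → ℝ}
    (h : ∀ ω, f ω ≤ g ω) : bernE p f ≤ bernE p g :=
  Finset.sum_le_sum fun ω _ => mul_le_mul_of_nonneg_left (h ω) (bernWeight_prod_nonneg h0 h1 ω)

/-- Swapping a set of coordinates between two independent copies. -/
lemma bernE_swap (p : ℝ) (I : β → Prop) [DecidablePred I] (F : (β → Bool) → (β → Bool) → ℝ) :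
    bernE p (fun ω => bernE p (fun ω' => F ω ω')) =
      bernE p (fun ω => bernE p (fun ω' =>
        F (fun e => if I e then ω' e else ω e) (fun e => if I e then ω e else ω' e))) := by
  simp only [bernE, Finset.mul_sum]
  rw [← Finset.sum_product', ← Finset.sum_product']
  refine Finset.sum_nbij' (fun x => (fun e => if I e then x.2 e else x.1 e,
    fun e => if I e then x.1 e else x.2 e)) (fun x => (fun e => if I e then x.2 e else x.1 e,
    fun e => if I e then x.1 e else x.2 e)) (by simp) (by simp) ?_ ?_ ?_
  · rintro ⟨a, b⟩ -
    ext e <;> by_cases h : I e <;> simp [h]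
  · rintro ⟨a, b⟩ -
    ext e <;> by_cases h : I e <;> simp [h]
  · rintro ⟨a, b⟩ -
    have h : (∏ e, bernWeight p (a e)) * ∏ e, bernWeight p (b e) =
        (∏ e, bernWeight p (if I e then b e else a e)) *
          ∏ e, bernWeight p (if I e then a e else b e) := by
      rw [← Finset.prod_mul_distrib, ← Finset.prod_mul_distrib]
      refine Finset.prod_congr rfl fun e _ => ?_
      split_ifs
      · ring
      · rfl
    simp only [← mul_assoc, h]
    congr 1
    congr 1 <;> ext e <;> by_cases h : I e <;> simp [h]

lemma bernE_resample (p : ℝ) (I : β → Prop) [DecidablePred I] (f : (β → Bool) → ℝ) :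
    bernE p f = bernE p (fun ω => bernE p (fun ω' => f (fun e => if I e then ω' e else ω e))) := by
  have := bernE_swap p I (fun ω _ => f ω)
  simpa only [bernE_const] using this

lemma bernE_apply (p : ℝ) (e : β) (g : Bool → ℝ) :
    bernE p (fun ω => g (ω e)) = p * g true + (1 - p) * g false := by
  have := bernE_prod p (fun e' b => if e' = e then g b else 1)
  simp only [Finset.prod_ite_eq', Finset.mem_univ, if_true] at this
  rw [this, Finset.prod_eq_single e]
  · simp
  · intro b _ hb; simp [hb]
  · simp

lemma bernXi_mean {p : ℝ} (hp : p ≠ 0) : p * bernXi p true + (1 - p) * bernXi p false = 0 := by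
  simp [bernXi]; field_simp; ring

lemma bernXi_var_le {p : ℝ} (hp : 0 < p) :
    p * bernXi p true ^ 2 + (1 - p) * bernXi p false ^ 2 ≤ 1 / p := by
  have : p * bernXi p true ^ 2 + (1 - p) * bernXi p false ^ 2 = 1 / p - 1 := by
    simp [bernXi]; field_simp; ring
  linarith

lemma abs_bernXi_le {p : ℝ} (hp : 0 < p) (h1 : p ≤ 1) (b : Bool) : |bernXi p b| ≤ 1 / p := by
  have : 1 ≤ 1 / p := by rw [le_div_iff₀ hp]; linarith
  cases b
  · simp only [bernXi]; norm_num; simpa using this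
  · simp only [bernXi, if_true]
    rw [abs_le]; constructor <;> linarith

open Classical in
/-- The probability of an event under independent Bernoulli variables. -/
def bernP (p : ℝ) (A : (β → Bool) → Prop) : ℝ := bernE p (fun ω => if A ω then 1 else 0)

lemma bernP_mono {p : ℝ} (h0 : 0 ≤ p) (h1 : p ≤ 1) {A B : (β → Bool) → Prop}
    (h : ∀ ω, A ω → B ω) : bernP p A ≤ bernP p B :=
  bernE_mono h0 h1 fun ω => by
    by_cases hA : A ω
    · simp [hA, h ω hA]
    · simp only [hA, if_false]; split_ifs <;> simp

lemma bernP_or_le {p : ℝ} (h0 : 0 ≤ p) (h1 : p ≤ 1) (A B : (β → Bool) → Prop) :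
    bernP p (fun ω => A ω ∨ B ω) ≤ bernP p A + bernP p B := by
  rw [bernP, bernP, bernP, ← bernE_add]
  refine bernE_mono h0 h1 fun ω => ?_
  by_cases hA : A ω <;> by_cases hB : B ω <;> simp [hA, hB]

open Classical in
lemma bernP_exists_le {κ : Type*} [Fintype κ] {p : ℝ} (h0 : 0 ≤ p) (h1 : p ≤ 1)
    (A : κ → (β → Bool) → Prop) :
    bernP p (fun ω => ∃ i, A i ω) ≤ ∑ i, bernP p (A i) := by
  simp only [bernP]
  rw [← bernE_sum]
  refine bernE_mono h0 h1 fun ω => ?_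
  split_ifs with h
  · obtain ⟨i, hi⟩ := h
    refine le_trans (by simp [hi]) (Finset.single_le_sum (f := fun i => if A i ω then (1:ℝ) else 0)
      (fun i _ => by split_ifs <;> simp) (Finset.mem_univ i))
  · exact Finset.sum_nonneg fun i _ => by split_ifs <;> simp

/-- If, for every fixed value of the coordinates outside `I`, an event has conditional
probability at most `c`, then it has probability at most `c`. -/
lemma bernP_le_of_resample {p c : ℝ} (h0 : 0 ≤ p) (h1 : p ≤ 1) (I : β → Prop) [DecidablePred I]
    (A : (β → Bool) → Prop)
    (h : ∀ ω : β → Bool, bernP p (fun ω' => A (fun e => if I e then ω' e else ω e)) ≤ c) :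
    bernP p A ≤ c := by
  rw [bernP, bernE_resample p I]
  calc _ ≤ bernE (β := β) p (fun _ => c) := bernE_mono h0 h1 h
    _ = c := bernE_const p c

/-- Markov's inequality. -/
lemma bernP_le_bernE {p : ℝ} (h0 : 0 ≤ p) (h1 : p ≤ 1) (A : (β → Bool) → Prop)
    (f : (β → Bool) → ℝ) (hf : ∀ ω, 0 ≤ f ω) (h : ∀ ω, A ω → 1 ≤ f ω) : bernP p A ≤ bernE p f :=
  bernE_mono h0 h1 fun ω => by split_ifs with hA; exacts [h ω hA, hf ω]

lemma Real.exp_le_one_add_add_sq {x : ℝ} (h : |x| ≤ 1) : Real.exp x ≤ 1 + x + x ^ 2 := by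
  have := Real.abs_exp_sub_one_sub_id_le h
  linarith [le_abs_self (Real.exp x - 1 - x)]

lemma bernE_exp_sum_le {p : ℝ} (hp : 0 < p) (h1 : p ≤ 1) (c : β → ℝ) (lam : ℝ)
    (hc : ∀ e, |lam * c e| ≤ p) :
    bernE p (fun ω => Real.exp (lam * ∑ e, bernXi p (ω e) * c e)) ≤
      Real.exp (lam ^ 2 * ((∑ e, c e ^ 2) / p)) := by
  have : (fun ω : β → Bool => Real.exp (lam * ∑ e, bernXi p (ω e) * c e)) =
      fun ω => ∏ e, Real.exp (bernXi p (ω e) * (lam * c e)) := by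
    ext ω
    rw [← Real.exp_sum, Finset.mul_sum]
    congr 1
    exact Finset.sum_congr rfl fun _ _ => by ring
  rw [this, bernE_prod p (fun e b => Real.exp (bernXi p b * (lam * c e))), Finset.sum_div,
    Finset.mul_sum, Real.exp_sum]
  refine Finset.prod_le_prod (fun e _ => ?_) fun e _ => ?_
  · have := Real.exp_pos (bernXi p true * (lam * c e))
    have := Real.exp_pos (bernXi p false * (lam * c e))
    have : 0 ≤ 1 - p := by linarith
    positivity
  · have hb : ∀ b, |bernXi p b * (lam * c e)| ≤ 1 := fun b => by
      rw [abs_mul]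
      calc _ ≤ 1 / p * p := mul_le_mul (abs_bernXi_le hp h1 b) (hc e) (abs_nonneg _) (by positivity)
        _ = 1 := by field_simp
    set y := lam * c e with hy
    have e1 := Real.exp_le_one_add_add_sq (hb true)
    have e2 := Real.exp_le_one_add_add_sq (hb false)
    have m := bernXi_mean hp.ne'
    have v := bernXi_var_le hp
    calc _ ≤ p * (1 + bernXi p true * y + (bernXi p true * y) ^ 2) +
          (1 - p) * (1 + bernXi p false * y + (bernXi p false * y) ^ 2) := by
            have : 0 ≤ 1 - p := by linarith
            gcongr
      _ = 1 + (p * bernXi p true + (1 - p) * bernXi p false) * y +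
          (p * bernXi p true ^ 2 + (1 - p) * bernXi p false ^ 2) * y ^ 2 := by ring
      _ ≤ 1 + 0 * y + 1 / p * y ^ 2 := by rw [m]; gcongr
      _ = lam ^ 2 * (c e ^ 2 / p) + 1 := by rw [hy]; ring
      _ ≤ _ := Real.add_one_le_exp _

/-- Bernstein's inequality for a weighted sum of centred Bernoulli variables. -/
lemma bernP_abs_sum_gt_le {p : ℝ} (hp : 0 < p) (h1 : p ≤ 1) (c : β → ℝ) {L t : ℝ} (hL : 0 ≤ L)
    (ht : 0 < t) (hV : L * ((∑ e, c e ^ 2) / p) ≤ t ^ 2) (hB : ∀ e, L * |c e| ≤ t * p) :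
    bernP p (fun ω => 2 * t < |∑ e, bernXi p (ω e) * c e|) ≤ 2 * Real.exp (-L) := by
  set lam := L / t with hlam
  have hlam0 : 0 ≤ lam := by positivity
  have hc : ∀ e, |lam * c e| ≤ p := fun e => by
    rw [abs_mul, abs_of_nonneg hlam0, hlam, div_mul_eq_mul_div, div_le_iff₀ ht]
    linarith [hB e]
  have hlt : lam * t = L := by rw [hlam]; field_simp
  have hV' : lam ^ 2 * ((∑ e, c e ^ 2) / p) ≤ L := by
    calc _ = L / t ^ 2 * (L * ((∑ e, c e ^ 2) / p)) := by rw [hlam]; ring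
      _ ≤ L / t ^ 2 * t ^ 2 := by gcongr
      _ = L := by field_simp
  have b1 := bernE_exp_sum_le hp h1 c lam hc
  have b2 := bernE_exp_sum_le hp h1 c (-lam) (by simpa using hc)
  have key : ∀ z : ℝ, 2 * t < |z| →
      1 ≤ Real.exp (-(2 * L)) * (Real.exp (lam * z) + Real.exp (-lam * z)) := fun z hz => by
    have : Real.exp (2 * L) ≤ Real.exp (lam * z) + Real.exp (-lam * z) := by
      rcases lt_abs.1 hz with h | h
      · have : Real.exp (2 * L) ≤ Real.exp (lam * z) :=
          Real.exp_le_exp.2 (by nlinarith)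
        linarith [Real.exp_pos (-lam * z)]
      · have : Real.exp (2 * L) ≤ Real.exp (-lam * z) :=
          Real.exp_le_exp.2 (by nlinarith)
        linarith [Real.exp_pos (lam * z)]
    rw [Real.exp_neg, ← div_eq_inv_mul, le_div_iff₀ (Real.exp_pos _), one_mul]
    exact this
  refine (bernP_le_bernE hp.le h1 _ (fun ω => Real.exp (-(2 * L)) *
    (Real.exp (lam * ∑ e, bernXi p (ω e) * c e) + Real.exp (-lam * ∑ e, bernXi p (ω e) * c e)))
    (fun ω => by positivity) (fun ω h => key _ h)).trans ?_
  rw [bernE_const_mul, bernE_add]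
  calc _ ≤ Real.exp (-(2 * L)) * (Real.exp L + Real.exp L) := by
        gcongr
        · exact b1.trans (Real.exp_le_exp.2 hV')
        · exact b2.trans (Real.exp_le_exp.2 (by simpa using hV'))
    _ = 2 * Real.exp (-L) := by
        rw [← two_mul, mul_left_comm, ← Real.exp_add]; ring_nf

end Bernoulli

section TraceMoment

set_option linter.unusedSectionVars false

lemma mul_pow_sub_pow_le (x y : ℝ) (k : ℕ) :
    (x - y) * (x ^ (2 * k + 1) - y ^ (2 * k + 1)) ≤
      (2 * k + 1 : ℝ) / 2 * ((x - y) ^ 2 * (x ^ (2 * k) + y ^ (2 * k))) := by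
  have key : ∀ i j : ℕ, i + j = 2 * k →
      x ^ i * y ^ j + x ^ j * y ^ i ≤ x ^ (2 * k) + y ^ (2 * k) := fun i j hij => by
    have h1 : x ^ i * y ^ j ≤ |x| ^ i * |y| ^ j := by
      rw [← abs_pow, ← abs_pow, ← abs_mul]; exact le_abs_self _
    have h2 : x ^ j * y ^ i ≤ |x| ^ j * |y| ^ i := by
      rw [← abs_pow, ← abs_pow, ← abs_mul]; exact le_abs_self _
    have h3 : 0 ≤ (|x| ^ i - |y| ^ i) * (|x| ^ j - |y| ^ j) := by
      rcases le_total |x| |y| with h | h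
      · exact mul_nonneg_of_nonpos_of_nonpos
          (sub_nonpos.2 (by gcongr)) (sub_nonpos.2 (by gcongr))
      · exact mul_nonneg (sub_nonneg.2 (by gcongr)) (sub_nonneg.2 (by gcongr))
    have h4 : |x| ^ i * |x| ^ j = x ^ (2 * k) := by
      rw [← pow_add, hij, pow_mul, sq_abs, ← pow_mul]
    have h5 : |y| ^ i * |y| ^ j = y ^ (2 * k) := by
      rw [← pow_add, hij, pow_mul, sq_abs, ← pow_mul]
    nlinarith
  set s := ∑ i ∈ Finset.range (2 * k + 1), x ^ i * y ^ (2 * k + 1 - 1 - i) with hs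
  have hg : s * (x - y) = x ^ (2 * k + 1) - y ^ (2 * k + 1) := Commute.geom_sum₂_mul (.all x y) _
  have hs' : s = ∑ i ∈ Finset.range (2 * k + 1), x ^ (2 * k - i) * y ^ i := by
    rw [hs, ← Finset.sum_range_reflect]
    refine Finset.sum_congr rfl fun i hi => ?_
    rw [Finset.mem_range] at hi
    congr 2; omega
  have h2s : 2 * s ≤ (2 * k + 1) * (x ^ (2 * k) + y ^ (2 * k)) := by
    calc 2 * s = ∑ i ∈ Finset.range (2 * k + 1),
          (x ^ i * y ^ (2 * k - i) + x ^ (2 * k - i) * y ^ i) := by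
            rw [Finset.sum_add_distrib, ← hs', two_mul, hs]; rfl
      _ ≤ ∑ i ∈ Finset.range (2 * k + 1), (x ^ (2 * k) + y ^ (2 * k)) := by
            refine Finset.sum_le_sum fun i hi => key i (2 * k - i) ?_
            rw [Finset.mem_range] at hi; omega
      _ = _ := by
            rw [Finset.sum_const, Finset.card_range, nsmul_eq_mul]; push_cast; rfl
  rw [← hg]
  nlinarith [sq_nonneg (x - y)]

lemma amgm_pow {a b : ℝ} (ha : 0 ≤ a) (hb : 0 ≤ b) (k : ℕ) :
    (k + 1) * (a * b ^ k) ≤ a ^ (k + 1) + k * b ^ (k + 1) := by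
  induction k with
  | zero => simp
  | succ k ih =>
    have h : 0 ≤ (a - b) * (a ^ (k + 1) - b ^ (k + 1)) := by
      rcases le_total a b with h | h
      · exact mul_nonneg_of_nonpos_of_nonpos (by linarith) (sub_nonpos.2 (by gcongr))
      · exact mul_nonneg (by linarith) (sub_nonneg.2 (by gcongr))
    have := mul_le_mul_of_nonneg_right ih hb
    push_cast
    ring_nf at this h ⊢
    nlinarith

variable {V : Type*} [Fintype V] [DecidableEq V]

lemma isHermitian_pow_apply {X : Matrix V V ℝ} (hX : X.IsHermitian) (n : ℕ) (i j : V) :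
    (X ^ n) i j = ∑ l, hX.eigenvalues l ^ n *
      ((hX.eigenvectorUnitary : Matrix V V ℝ) i l * (hX.eigenvectorUnitary : Matrix V V ℝ) j l) := by
  set U := (hX.eigenvectorUnitary : Matrix V V ℝ) with hU
  have hUU : star U * U = 1 := Unitary.coe_star_mul_self hX.eigenvectorUnitary
  have hs : X = U * Matrix.diagonal hX.eigenvalues * star U := by
    conv_lhs => rw [hX.spectral_theorem]
    simp [Unitary.conjStarAlgAut_apply, hU]
  have hp : X ^ n = U * Matrix.diagonal (fun l => hX.eigenvalues l ^ n) * star U := by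
    have : ∀ n : ℕ, (U * Matrix.diagonal hX.eigenvalues * star U) ^ n =
        U * Matrix.diagonal (fun l => hX.eigenvalues l ^ n) * star U := fun n => by
      induction n with
      | zero =>
        simp only [pow_zero, Matrix.diagonal_one, mul_one]
        exact (Unitary.coe_mul_star_self hX.eigenvectorUnitary).symm
      | succ n ih =>
        rw [pow_succ, ih]
        calc _ = U * Matrix.diagonal (fun l => hX.eigenvalues l ^ n) * (star U * U) *
              Matrix.diagonal hX.eigenvalues * star U := by simp only [mul_assoc]
          _ = _ := by
            rw [hUU, mul_one, mul_assoc U, Matrix.diagonal_mul_diagonal]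
            simp only [pow_succ]
    rw [← this, ← hs]
  rw [hp, Matrix.mul_apply]
  refine Finset.sum_congr rfl fun l _ => ?_
  rw [Matrix.mul_diagonal, Matrix.star_apply]
  simp; ring

lemma eigenvectorUnitary_row_sq_sum {X : Matrix V V ℝ} (hX : X.IsHermitian) (i : V) :
    ∑ l, (hX.eigenvectorUnitary : Matrix V V ℝ) i l ^ 2 = 1 := by
  have := isHermitian_pow_apply hX 0 i i
  simp only [pow_zero, Matrix.one_apply_eq, one_mul] at this
  rw [this]
  exact Finset.sum_congr rfl fun _ _ => sq _

lemma trace_pow_mul_pow {X Y : Matrix V V ℝ} (hX : X.IsHermitian) (hY : Y.IsHermitian) :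
    ∃ w : V → V → ℝ, (∀ l m, 0 ≤ w l m) ∧ ∀ a b : ℕ, (X ^ a * Y ^ b).trace =
      ∑ l, ∑ m, hX.eigenvalues l ^ a * hY.eigenvalues m ^ b * w l m := by
  refine ⟨fun l m => (∑ i, (hX.eigenvectorUnitary : Matrix V V ℝ) i l *
    (hY.eigenvectorUnitary : Matrix V V ℝ) i m) ^ 2, fun _ _ => sq_nonneg _, fun a b => ?_⟩
  have hXp := isHermitian_pow_apply hX a
  have hYp := isHermitian_pow_apply hY b
  generalize (hX.eigenvectorUnitary : Matrix V V ℝ) = U at hXp ⊢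
  generalize (hY.eigenvectorUnitary : Matrix V V ℝ) = W at hYp ⊢
  simp only [Matrix.trace, Matrix.diag, Matrix.mul_apply, hXp, hYp, sq, Finset.sum_mul,
    Finset.mul_sum]
  have : ∀ f : V → V → V → V → ℝ, ∑ i, ∑ j, ∑ l, ∑ m, f i j l m = ∑ l, ∑ m, ∑ i, ∑ j, f i j l m := by
    intro f
    calc _ = ∑ i, ∑ l, ∑ j, ∑ m, f i j l m := by
          refine Finset.sum_congr rfl fun i _ => Finset.sum_comm
      _ = ∑ l, ∑ i, ∑ j, ∑ m, f i j l m := Finset.sum_comm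
      _ = ∑ l, ∑ i, ∑ m, ∑ j, f i j l m := by
          refine Finset.sum_congr rfl fun i _ => Finset.sum_congr rfl fun j _ => Finset.sum_comm
      _ = _ := by
          refine Finset.sum_congr rfl fun i _ => Finset.sum_comm
  have h4 : ∀ i j, ∑ m, ∑ l, hX.eigenvalues l ^ a * (U i l * U j l) *
      (hY.eigenvalues m ^ b * (W j m * W i m)) = ∑ l, ∑ m, hX.eigenvalues l ^ a * (U i l * U j l) *
      (hY.eigenvalues m ^ b * (W j m * W i m)) := fun i j => Finset.sum_comm
  simp only [h4]
  rw [this]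
  refine Finset.sum_congr rfl fun _ _ => Finset.sum_congr rfl fun _ _ =>
    Finset.sum_congr rfl fun _ _ => Finset.sum_congr rfl fun _ _ => ?_
  ring

/-- The mean value trace inequality for odd powers. -/
lemma trace_sub_mul_pow_sub_pow_le {X Y : Matrix V V ℝ} (hX : X.IsHermitian) (hY : Y.IsHermitian)
    (k : ℕ) :
    ((X - Y) * (X ^ (2 * k + 1) - Y ^ (2 * k + 1))).trace ≤
      (2 * k + 1 : ℝ) / 2 * ((X - Y) * (X - Y) * (X ^ (2 * k) + Y ^ (2 * k))).trace := by
  obtain ⟨w, hw, ht⟩ := trace_pow_mul_pow hX hY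
  have e1 : ((X - Y) * (X ^ (2 * k + 1) - Y ^ (2 * k + 1))).trace =
      (X ^ (2 * k + 2) * Y ^ 0).trace - (X ^ 1 * Y ^ (2 * k + 1)).trace
        - (X ^ (2 * k + 1) * Y ^ 1).trace + (X ^ 0 * Y ^ (2 * k + 2)).trace := by
    have a1 : X * X ^ (2 * k + 1) = X ^ (2 * k + 2) := (pow_succ' X _).symm
    have a2 : Y * Y ^ (2 * k + 1) = Y ^ (2 * k + 2) := (pow_succ' Y _).symm
    rw [sub_mul, mul_sub, mul_sub, a1, a2]
    simp only [Matrix.trace_sub, pow_zero, mul_one, one_mul, pow_one]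
    rw [Matrix.trace_mul_comm Y]; ring
  have e2 : ((X - Y) * (X - Y) * (X ^ (2 * k) + Y ^ (2 * k))).trace =
      (X ^ (2 * k + 2) * Y ^ 0).trace - 2 * (X ^ (2 * k + 1) * Y ^ 1).trace
      + (X ^ (2 * k) * Y ^ 2).trace + (X ^ 2 * Y ^ (2 * k)).trace
      - 2 * (X ^ 1 * Y ^ (2 * k + 1)).trace + (X ^ 0 * Y ^ (2 * k + 2)).trace := by
    have b1 : (X * X * X ^ (2 * k)) = X ^ (2 * k + 2) := by rw [← sq, ← pow_add, add_comm]
    have b2 : (X * Y * X ^ (2 * k)).trace = (X ^ (2 * k + 1) * Y).trace := by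
      rw [Matrix.trace_mul_comm, ← mul_assoc, ← pow_succ]
    have b3 : (Y * X * X ^ (2 * k)).trace = (X ^ (2 * k + 1) * Y).trace := by
      rw [mul_assoc, ← pow_succ', Matrix.trace_mul_comm]
    have b4 : (Y * Y * X ^ (2 * k)).trace = (X ^ (2 * k) * Y ^ 2).trace := by
      rw [Matrix.trace_mul_comm, sq]
    have b5 : (X * X * Y ^ (2 * k)) = X ^ 2 * Y ^ (2 * k) := by rw [sq]
    have b6 : (X * Y * Y ^ (2 * k)) = X * Y ^ (2 * k + 1) := by rw [mul_assoc, ← pow_succ']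
    have b7 : (Y * X * Y ^ (2 * k)).trace = (X * Y ^ (2 * k + 1)).trace := by
      rw [mul_assoc, Matrix.trace_mul_comm, mul_assoc, ← pow_succ]
    have b8 : (Y * Y * Y ^ (2 * k)) = Y ^ (2 * k + 2) := by rw [← sq, ← pow_add, add_comm]
    simp only [sub_mul, mul_sub, mul_add, Matrix.trace_sub, Matrix.trace_add, pow_zero, mul_one,
      one_mul, pow_one]
    rw [b1, b2, b3, b4, b5, b6, b7, b8]; ring
  rw [e1, e2]
  simp only [ht, Finset.mul_sum, ← Finset.sum_sub_distrib, ← Finset.sum_add_distrib]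
  refine Finset.sum_le_sum fun l _ => Finset.sum_le_sum fun m _ => ?_
  have := mul_le_mul_of_nonneg_right
    (mul_pow_sub_pow_le (hX.eigenvalues l) (hY.eigenvalues m) k) (hw l m)
  refine le_of_eq_of_le ?_ (this.trans_eq ?_) <;> ring

variable {β : Type*} [Fintype β] [DecidableEq β]

/-- A linear combination of matrices with centred Bernoulli coefficients. -/
def bernSum (p : ℝ) (A : β → Matrix V V ℝ) (ω : β → Bool) : Matrix V V ℝ :=
  ∑ e, bernXi p (ω e) • A e

lemma bernSum_isHermitian {p : ℝ} {A : β → Matrix V V ℝ} (hA : ∀ e, (A e).IsHermitian)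
    (ω : β → Bool) : (bernSum p A ω).IsHermitian := by
  unfold bernSum Matrix.IsHermitian
  rw [Matrix.conjTranspose_sum]
  exact Finset.sum_congr rfl fun e _ => by rw [Matrix.conjTranspose_smul, (hA e).eq]; simp

lemma bernSum_sub_swap (p : ℝ) (A : β → Matrix V V ℝ) (ω ω' : β → Bool) (e : β) :
    bernSum p A ω - bernSum p A (fun e' => if e' = e then ω' e' else ω e') =
      (bernXi p (ω e) - bernXi p (ω' e)) • A e := by
  unfold bernSum
  rw [← Finset.sum_sub_distrib, Finset.sum_eq_single e]
  · simp [sub_smul]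
  · intro b _ hb; simp [hb]
  · simp

lemma bernE_exchangeable (p : ℝ) (hp : 0 < p) (h1 : p ≤ 1) (A : β → Matrix V V ℝ)
    (hA : ∀ e, (A e).IsHermitian) (D : β → V → ℝ) (hD : ∀ e, A e * A e = Matrix.diagonal (D e))
    (k : ℕ) (e : β) :
    bernE p (fun ω => bernXi p (ω e) * (A e * bernSum p A ω ^ (2 * k + 1)).trace) ≤
      (2 * k + 1) * bernE p (fun ω => (bernXi p (ω e) ^ 2 + 1 / p) / 2 *
        (Matrix.diagonal (D e) * bernSum p A ω ^ (2 * k)).trace) := by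
  set G : (β → Bool) → ℝ := fun ω => (A e * bernSum p A ω ^ (2 * k + 1)).trace with hG
  set H : (β → Bool) → ℝ := fun ω => (Matrix.diagonal (D e) * bernSum p A ω ^ (2 * k)).trace with hH
  set sw : (β → Bool) → (β → Bool) → β → Bool :=
    fun ω ω' => fun e' => if e' = e then ω' e' else ω e' with hsw
  have hH0 : ∀ ω, 0 ≤ H ω := fun ω => by
    have hh := bernSum_isHermitian (p := p) hA ω
    simp only [hH, Matrix.trace, Matrix.diag, Matrix.diagonal_mul]
    refine Finset.sum_nonneg fun i _ => mul_nonneg ?_ ?_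
    · have : D e i = (A e * A e) i i := by rw [hD]; simp
      rw [this, Matrix.mul_apply]
      refine Finset.sum_nonneg fun j _ => ?_
      have := congrFun (congrFun (hA e) i) j
      simp only [Matrix.conjTranspose_apply, star_trivial] at this
      rw [this]; exact mul_self_nonneg _
    · rw [isHermitian_pow_apply hh]
      refine Finset.sum_nonneg fun l _ => mul_nonneg ?_ (mul_self_nonneg _)
      rw [pow_mul]; positivity
  have mean : bernE (β := β) p (fun ω => bernXi p (ω e)) = 0 := by
    rw [bernE_apply]; exact bernXi_mean hp.ne'
  have var : bernE (β := β) p (fun ω => bernXi p (ω e) ^ 2) ≤ 1 / p := by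
    rw [bernE_apply p e (fun b => bernXi p b ^ 2)]; exact bernXi_var_le hp
  have t1 : bernE p (fun ω => bernE p (fun ω' => bernXi p (ω' e) * G ω)) = 0 := by
    simp only [bernE_mul_const, mean, zero_mul, bernE_const]
  have t2 : bernE p (fun ω => bernE p (fun ω' => bernXi p (ω e) * G (sw ω ω'))) = 0 := by
    rw [← t1, bernE_swap p (fun e' => e' = e) (fun ω ω' => bernXi p (ω' e) * G ω)]
    simp [hsw]
  have t3 : bernE p (fun ω => bernE p (fun ω' => bernXi p (ω' e) * G (sw ω ω'))) =
      bernE p (fun ω => bernXi p (ω e) * G ω) := by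
    have := bernE_swap p (fun e' => e' = e) (fun ω _ => bernXi p (ω e) * G ω)
    simp only [bernE_const] at this
    rw [this]; simp [hsw]
  have t4 : bernE p (fun ω => bernE p (fun ω' =>
      (bernXi p (ω e) - bernXi p (ω' e)) * (G ω - G (sw ω ω')))) =
      2 * bernE p (fun ω => bernXi p (ω e) * G ω) := by
    have : ∀ ω ω' : β → Bool, (bernXi p (ω e) - bernXi p (ω' e)) * (G ω - G (sw ω ω')) =
        bernXi p (ω e) * G ω - bernXi p (ω e) * G (sw ω ω') - bernXi p (ω' e) * G ω +
          bernXi p (ω' e) * G (sw ω ω') := fun _ _ => by ring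
    simp only [this, bernE_add, bernE_sub, t1, t2, t3, bernE_const]; ring
  have t5 : bernE p (fun ω => bernE p (fun ω' =>
      (bernXi p (ω e) - bernXi p (ω' e)) ^ 2 * H (sw ω ω'))) =
      bernE p (fun ω => bernE p (fun ω' =>
      (bernXi p (ω e) - bernXi p (ω' e)) ^ 2 * H ω)) := by
    rw [bernE_swap p (fun e' => e' = e) (fun ω ω' => (bernXi p (ω e) - bernXi p (ω' e)) ^ 2 * H ω)]
    simp only [hsw, if_true]
    congr 1; ext ω; congr 1; ext ω'; ring
  have t6 : bernE p (fun ω => bernE p (fun ω' =>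
      (bernXi p (ω e) - bernXi p (ω' e)) ^ 2 * H ω)) ≤
      2 * bernE p (fun ω => (bernXi p (ω e) ^ 2 + 1 / p) / 2 * H ω) := by
    rw [← bernE_const_mul]
    refine bernE_mono hp.le h1 fun ω => ?_
    rw [bernE_mul_const]
    have : ∀ ω' : β → Bool, (bernXi p (ω e) - bernXi p (ω' e)) ^ 2 =
      bernXi p (ω e) ^ 2 - 2 * bernXi p (ω e) * bernXi p (ω' e) + bernXi p (ω' e) ^ 2 :=
        fun _ => by ring
    simp only [this, bernE_add, bernE_sub, bernE_const_mul, mean, bernE_const]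
    have := mul_le_mul_of_nonneg_right var (hH0 ω)
    nlinarith
  have t7 : ∀ ω ω' : β → Bool, (bernXi p (ω e) - bernXi p (ω' e)) * (G ω - G (sw ω ω')) ≤
      (2 * k + 1 : ℝ) / 2 * ((bernXi p (ω e) - bernXi p (ω' e)) ^ 2 * H ω +
        (bernXi p (ω e) - bernXi p (ω' e)) ^ 2 * H (sw ω ω')) := fun ω ω' => by
    have := trace_sub_mul_pow_sub_pow_le (bernSum_isHermitian (p := p) hA ω)
      (bernSum_isHermitian (p := p) hA (sw ω ω')) k
    rw [hsw, bernSum_sub_swap] at this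
    simp only [smul_mul_assoc, mul_smul_comm, smul_smul, Matrix.trace_smul, hD, mul_sub, mul_add,
      Matrix.trace_sub, Matrix.trace_add, smul_eq_mul] at this
    simp only [hG, hH, hsw]
    linarith
  have t8 := bernE_mono hp.le h1 fun ω => bernE_mono hp.le h1 fun ω' => t7 ω ω'
  rw [t4] at t8
  simp only [bernE_const_mul, bernE_add, t5] at t8
  have : (0 : ℝ) ≤ 2 * k + 1 := by positivity
  nlinarith [mul_le_mul_of_nonneg_left t6 this]

/-- The random variance proxy of a Bernoulli combination of matrices with diagonal squares. -/
def varProxy (p : ℝ) (D : β → V → ℝ) (ω : β → Bool) (i : V) : ℝ :=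
  ∑ e, (bernXi p (ω e) ^ 2 + 1 / p) / 2 * D e i

lemma bernE_trace_pow_le (p : ℝ) (hp : 0 < p) (h1 : p ≤ 1) (A : β → Matrix V V ℝ)
    (hA : ∀ e, (A e).IsHermitian) (D : β → V → ℝ) (hD : ∀ e, A e * A e = Matrix.diagonal (D e))
    (hD0 : ∀ e i, 0 ≤ D e i) (k : ℕ) :
    bernE p (fun ω => (bernSum p A ω ^ (2 * (k + 1))).trace) ≤
      (2 * k + 1) ^ (k + 1) * bernE p (fun ω => ∑ i, varProxy p D ω i ^ (k + 1)) := by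
  have s1 : bernE p (fun ω => (bernSum p A ω ^ (2 * (k + 1))).trace) ≤
      (2 * k + 1) * bernE p (fun ω => ∑ i, varProxy p D ω i * (bernSum p A ω ^ (2 * k)) i i) := by
    have : ∀ ω, (bernSum p A ω ^ (2 * (k + 1))).trace =
        ∑ e, bernXi p (ω e) * (A e * bernSum p A ω ^ (2 * k + 1)).trace := fun ω => by
      rw [show 2 * (k + 1) = (2 * k + 1) + 1 by ring, pow_succ']
      conv_lhs => enter [1, 1]; rw [bernSum]
      simp [Finset.sum_mul, Matrix.trace_sum, Matrix.trace_smul]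
    simp only [this]
    rw [bernE_sum]
    refine (Finset.sum_le_sum fun e _ => bernE_exchangeable p hp h1 A hA D hD k e).trans_eq ?_
    rw [← Finset.mul_sum, ← bernE_sum]
    congr 2; ext ω
    simp only [Matrix.trace, Matrix.diag, Matrix.diagonal_mul, varProxy, Finset.mul_sum,
      Finset.sum_mul]
    rw [Finset.sum_comm]
    exact Finset.sum_congr rfl fun _ _ => Finset.sum_congr rfl fun _ _ => by ring
  have hΔ : ∀ ω i, 0 ≤ varProxy p D ω i := fun ω i =>
    Finset.sum_nonneg fun e _ => mul_nonneg (by positivity) (hD0 e i)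
  have s2 : ∀ ω, (k + 1) * ((2 * k + 1) *
      ∑ i, varProxy p D ω i * (bernSum p A ω ^ (2 * k)) i i) ≤
      (2 * k + 1) ^ (k + 1) * ∑ i, varProxy p D ω i ^ (k + 1) +
        k * (bernSum p A ω ^ (2 * (k + 1))).trace := fun ω => by
    have hh := bernSum_isHermitian (p := p) hA ω
    simp only [Matrix.trace, Matrix.diag, Finset.mul_sum]
    rw [← Finset.sum_add_distrib]
    refine Finset.sum_le_sum fun i _ => ?_
    rw [isHermitian_pow_apply hh, isHermitian_pow_apply hh]
    have h1 := eigenvectorUnitary_row_sq_sum hh i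
    generalize (hh.eigenvectorUnitary : Matrix V V ℝ) = U at h1 ⊢
    calc _ = ∑ l, (k + 1) * (((2 * k + 1) * varProxy p D ω i) * (hh.eigenvalues l ^ 2) ^ k) *
          U i l ^ 2 := by
          simp only [Finset.mul_sum]
          refine Finset.sum_congr rfl fun l _ => ?_
          rw [pow_mul]; ring
      _ ≤ ∑ l, (((2 * k + 1) * varProxy p D ω i) ^ (k + 1) +
          k * (hh.eigenvalues l ^ 2) ^ (k + 1)) *
          U i l ^ 2 := by
          refine Finset.sum_le_sum fun l _ => mul_le_mul_of_nonneg_right ?_ (sq_nonneg _)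
          exact amgm_pow (mul_nonneg (by positivity) (hΔ ω i)) (sq_nonneg _) k
      _ = _ := by
          have : ∀ l, (((2 * k + 1) * varProxy p D ω i) ^ (k + 1) +
              k * (hh.eigenvalues l ^ 2) ^ (k + 1)) * U i l ^ 2 =
              ((2 * k + 1) * varProxy p D ω i) ^ (k + 1) * U i l ^ 2 +
              k * (hh.eigenvalues l ^ 2) ^ (k + 1) * U i l ^ 2 := fun l => add_mul _ _ _
          simp only [this]
          rw [Finset.sum_add_distrib, ← Finset.mul_sum, h1, mul_one, mul_pow, Finset.mul_sum]
          congr 1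
          refine Finset.sum_congr rfl fun l _ => ?_
          rw [pow_mul]; ring
  have s3 := bernE_mono hp.le h1 s2
  simp only [bernE_add, bernE_const_mul] at s3
  have : (0 : ℝ) ≤ k + 1 := by positivity
  nlinarith [mul_le_mul_of_nonneg_left s1 this]

lemma bernE_varProxy_pow_le {p : ℝ} (hp : 0 < p) (h1 : p ≤ 1) (D : β → V → ℝ)
    (hD0 : ∀ e i, 0 ≤ D e i) {v : ℝ} (hv : 0 < v) {q : ℕ} (hq : 0 < q)
    (hsum : ∀ i, (∑ e, D e i) / p ≤ v) (hB : ∀ e i, q * D e i ≤ v * p ^ 2) (i : V) :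
    bernE p (fun ω => varProxy p D ω i ^ q) ≤ (v * Real.exp (1 / 2)) ^ q := by
  have hq' : (0 : ℝ) < q := by exact_mod_cast hq
  set lam : ℝ := q / v with hlam
  have hl : 0 < lam := by positivity
  have hΔ : ∀ ω, 0 ≤ varProxy p D ω i := fun ω =>
    Finset.sum_nonneg fun e _ => mul_nonneg (by positivity) (hD0 e i)
  have pt : ∀ y : ℝ, 0 ≤ y → y ^ q ≤ (v * Real.exp (-1)) ^ q * Real.exp (lam * y) := fun y hy => by
    have : y ≤ v * Real.exp (-1) * Real.exp (y / v) := by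
      have := Real.add_one_le_exp (y / v - 1)
      rw [mul_assoc, ← Real.exp_add, add_comm (-1 : ℝ), ← sub_eq_add_neg]
      calc y = v * (y / v - 1 + 1) := by field_simp; ring
        _ ≤ _ := by gcongr
    calc y ^ q ≤ (v * Real.exp (-1) * Real.exp (y / v)) ^ q := by gcongr
      _ = _ := by
        rw [mul_pow, ← Real.exp_nat_mul (y / v)]
        congr 2; rw [hlam]; field_simp
  have hsmall : ∀ e b, lam * (bernXi p b ^ 2 * D e i) ≤ 1 := fun e b => by
    have hx : bernXi p b ^ 2 ≤ (1 / p) ^ 2 := by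
      rw [← sq_abs]
      have := abs_bernXi_le hp h1 b
      gcongr
    calc lam * (bernXi p b ^ 2 * D e i) ≤ lam * ((1 / p) ^ 2 * D e i) := by
          have := hD0 e i; gcongr
      _ = (q * D e i) / (v * p ^ 2) := by rw [hlam]; field_simp
      _ ≤ 1 := by rw [div_le_one (by positivity)]; exact hB e i
  have mgf : bernE p (fun ω => Real.exp (lam * varProxy p D ω i)) ≤ Real.exp (3 / 2 * q) := by
    have e1 : (fun ω : β → Bool => Real.exp (lam * varProxy p D ω i)) = fun ω =>
        ∏ e, (Real.exp (lam * (1 / p / 2 * D e i)) *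
          Real.exp (lam * (bernXi p (ω e) ^ 2 * D e i) / 2)) := by
      ext ω
      simp only [← Real.exp_add]
      rw [← Real.exp_sum, varProxy, Finset.mul_sum]
      congr 1
      exact Finset.sum_congr rfl fun _ _ => by ring
    rw [e1, bernE_prod p (fun e b => Real.exp (lam * (1 / p / 2 * D e i)) *
          Real.exp (lam * (bernXi p b ^ 2 * D e i) / 2))]
    calc _ ≤ ∏ e, Real.exp (3 / 2 * lam * (D e i / p)) := by
          refine Finset.prod_le_prod (fun e _ => ?_) fun e _ => ?_
          · have : 0 ≤ 1 - p := by linarith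
            positivity
          · have hb : ∀ b, Real.exp (lam * (bernXi p b ^ 2 * D e i) / 2) ≤
                1 + lam * (bernXi p b ^ 2 * D e i) := fun b => by
              have h0 : 0 ≤ lam * (bernXi p b ^ 2 * D e i) := by
                have := hD0 e i; positivity
              have h2 := hsmall e b
              have := Real.exp_le_one_add_add_sq
                (x := lam * (bernXi p b ^ 2 * D e i) / 2) (by rw [abs_of_nonneg] <;> linarith)
              nlinarith
            have hv2 := bernXi_var_le hp
            have h1p : 0 ≤ 1 - p := by linarith
            have hd := hD0 e i
            calc _ = Real.exp (lam * (1 / p / 2 * D e i)) *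
                  (p * Real.exp (lam * (bernXi p true ^ 2 * D e i) / 2) +
                  (1 - p) * Real.exp (lam * (bernXi p false ^ 2 * D e i) / 2)) := by ring
              _ ≤ Real.exp (lam * (1 / p / 2 * D e i)) *
                  (p * (1 + lam * (bernXi p true ^ 2 * D e i)) +
                  (1 - p) * (1 + lam * (bernXi p false ^ 2 * D e i))) := by
                  gcongr
                  · exact hb true
                  · exact hb false
              _ = Real.exp (lam * (1 / p / 2 * D e i)) *
                  (lam * ((p * bernXi p true ^ 2 + (1 - p) * bernXi p false ^ 2) * D e i) + 1) := by
                  ring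
              _ ≤ Real.exp (lam * (1 / p / 2 * D e i)) * Real.exp (lam * (1 / p * D e i)) := by
                  gcongr
                  refine le_trans ?_ (Real.add_one_le_exp _)
                  gcongr
              _ = _ := by rw [← Real.exp_add]; congr 1; ring
      _ = Real.exp (3 / 2 * lam * ((∑ e, D e i) / p)) := by
          rw [← Real.exp_sum, ← Finset.mul_sum, Finset.sum_div]
      _ ≤ _ := by
          rw [Real.exp_le_exp]
          calc 3 / 2 * lam * ((∑ e, D e i) / p) ≤ 3 / 2 * lam * v := by
                have := hsum i; gcongr
            _ = _ := by rw [hlam]; field_simp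
  calc _ ≤ bernE p (fun ω => (v * Real.exp (-1)) ^ q * Real.exp (lam * varProxy p D ω i)) :=
        bernE_mono hp.le h1 fun ω => pt _ (hΔ ω)
    _ ≤ (v * Real.exp (-1)) ^ q * Real.exp (3 / 2 * q) := by
        rw [bernE_const_mul]; gcongr
    _ = _ := by
        rw [mul_comm (3 / 2 : ℝ), Real.exp_nat_mul, ← mul_pow, mul_assoc, ← Real.exp_add]; norm_num

lemma norm_toEuclideanLin_le_of_trace_pow_le {X : Matrix V V ℝ} (hX : X.IsHermitian) {t : ℝ}
    (ht : 0 ≤ t) {q : ℕ} (hq : q ≠ 0) (h : (X ^ (2 * q)).trace ≤ (t ^ 2) ^ q)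
    (x : EuclideanSpace ℝ V) : ‖Matrix.toEuclideanLin X x‖ ≤ t * ‖x‖ := by
  have hl : ∀ l, hX.eigenvalues l ^ 2 ≤ t ^ 2 := fun l => by
    have h1 : (hX.eigenvalues l ^ 2) ^ q ≤ (t ^ 2) ^ q := by
      refine le_trans ?_ h
      have : (X ^ (2 * q)).trace = ∑ l, (hX.eigenvalues l ^ 2) ^ q := by
        simp only [Matrix.trace, Matrix.diag, isHermitian_pow_apply hX]
        rw [Finset.sum_comm]
        refine Finset.sum_congr rfl fun l _ => ?_
        have hc := congrFun (congrFun (Unitary.coe_star_mul_self hX.eigenvectorUnitary) l) l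
        simp only [Matrix.mul_apply, Matrix.star_apply, star_trivial, Matrix.one_apply_eq] at hc
        rw [← Finset.mul_sum, hc, mul_one, pow_mul]
      rw [this]
      exact Finset.single_le_sum (f := fun l => (hX.eigenvalues l ^ 2) ^ q)
        (fun l _ => by positivity) (Finset.mem_univ l)
    exact (pow_le_pow_iff_left₀ (sq_nonneg _) (sq_nonneg _) hq).1 h1
  have hin : ∀ l, inner ℝ (hX.eigenvectorBasis l) (Matrix.toEuclideanLin X x) =
      hX.eigenvalues l * inner ℝ (hX.eigenvectorBasis l) x := fun l => by
    have hsym := (Matrix.isSymmetric_toEuclideanLin_iff.2 hX) (hX.eigenvectorBasis l) x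
    rw [← hsym]
    have : Matrix.toEuclideanLin X (hX.eigenvectorBasis l) =
        hX.eigenvalues l • hX.eigenvectorBasis l := by
      have := hX.mulVec_eigenvectorBasis l
      ext j
      have := congrFun this j
      simpa [Matrix.toLpLin_apply] using this
    rw [this, inner_smul_left]; simp
  have hsq : ‖Matrix.toEuclideanLin X x‖ ^ 2 ≤ (t * ‖x‖) ^ 2 := by
    rw [← hX.eigenvectorBasis.sum_sq_norm_inner_right, mul_pow,
      ← hX.eigenvectorBasis.sum_sq_norm_inner_right x, Finset.mul_sum]
    refine Finset.sum_le_sum fun l _ => ?_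
    rw [hin, norm_mul, mul_pow, Real.norm_eq_abs, sq_abs]
    exact mul_le_mul_of_nonneg_right (hl l) (sq_nonneg _)
  exact le_of_abs_le (abs_le_of_sq_le_sq hsq (by positivity))

/-- A matrix Bernstein inequality for Bernoulli combinations of matrices with diagonal squares. -/
lemma bernP_opNorm_gt_le {p : ℝ} (hp : 0 < p) (h1 : p ≤ 1) (A : β → Matrix V V ℝ)
    (hA : ∀ e, (A e).IsHermitian) (D : β → V → ℝ) (hD : ∀ e, A e * A e = Matrix.diagonal (D e))
    (hD0 : ∀ e i, 0 ≤ D e i) {v : ℝ} (hv : 0 < v) {q : ℕ} (hq : 0 < q)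
    (hsum : ∀ i, (∑ e, D e i) / p ≤ v) (hB : ∀ e i, q * D e i ≤ v * p ^ 2) {t : ℝ} (ht : 0 < t)
    (htv : 2 * q * v * Real.exp (3 / 2) ≤ t ^ 2) :
    bernP p (fun ω => ¬ ∀ x, ‖Matrix.toEuclideanLin (bernSum p A ω) x‖ ≤ t * ‖x‖) ≤
      Fintype.card V * Real.exp (-q) := by
  have hpos : ∀ ω, 0 ≤ (bernSum p A ω ^ (2 * q)).trace := fun ω => by
    simp only [Matrix.trace, Matrix.diag, isHermitian_pow_apply (bernSum_isHermitian (p := p) hA ω)]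
    refine Finset.sum_nonneg fun i _ => Finset.sum_nonneg fun l _ => mul_nonneg ?_ (mul_self_nonneg _)
    rw [pow_mul]; positivity
  refine (bernP_le_bernE hp.le h1 _
    (fun ω => (1 / (t ^ 2) ^ q) * (bernSum p A ω ^ (2 * q)).trace)
    (fun ω => mul_nonneg (by positivity) (hpos ω)) fun ω hω => ?_).trans ?_
  · by_contra hlt
    push Not at hlt
    rw [one_div, inv_mul_lt_iff₀ (by positivity), mul_one] at hlt
    exact hω (norm_toEuclideanLin_le_of_trace_pow_le (bernSum_isHermitian hA ω) ht.le hq.ne' hlt.le)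
  · obtain ⟨k, rfl⟩ : ∃ k, q = k + 1 := ⟨q - 1, by omega⟩
    rw [bernE_const_mul]
    have m := bernE_trace_pow_le p hp h1 A hA D hD hD0 k
    have b : bernE p (fun ω => ∑ i, varProxy p D ω i ^ (k + 1)) ≤
        Fintype.card V * (v * Real.exp (1 / 2)) ^ (k + 1) := by
      rw [bernE_sum]
      refine (Finset.sum_le_sum fun i _ =>
        bernE_varProxy_pow_le hp h1 D hD0 hv hq hsum hB i).trans_eq ?_
      simp
    calc _ ≤ 1 / (t ^ 2) ^ (k + 1) * ((2 * k + 1) ^ (k + 1) *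
          (Fintype.card V * (v * Real.exp (1 / 2)) ^ (k + 1))) := by
          gcongr; exact m.trans (by gcongr)
      _ = Fintype.card V * ((2 * k + 1) * v * Real.exp (1 / 2) / t ^ 2) ^ (k + 1) := by
          rw [div_pow, mul_pow, mul_pow, mul_pow]; ring
      _ ≤ Fintype.card V * (Real.exp (-1)) ^ (k + 1) := by
          gcongr
          rw [div_le_iff₀ (by positivity)]
          calc (2 * k + 1) * v * Real.exp (1 / 2) ≤ 2 * (k + 1) * v * Real.exp (1 / 2) := by
                gcongr; linarith
            _ = Real.exp (-1) * (2 * (k + 1) * v * Real.exp (3 / 2)) := by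
                rw [mul_left_comm, ← Real.exp_add]; norm_num
            _ ≤ _ := by
                push_cast at htv
                gcongr
      _ = _ := by rw [← Real.exp_nat_mul]; simp
end TraceMoment

section Action

variable {m n l : Type*} [Fintype m] [Fintype n] [Fintype l] [DecidableEq m] [DecidableEq n]
  [DecidableEq l]

set_option linter.unusedSectionVars false

/-- The action of a real matrix on Euclidean vectors. -/
abbrev act (A : Matrix m n ℝ) : EuclideanSpace ℝ n →ₗ[ℝ] EuclideanSpace ℝ m :=
  Matrix.toEuclideanLin A

lemma act_apply (A : Matrix m n ℝ) (x : EuclideanSpace ℝ n) (i : m) :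
    act A x i = ∑ j, A i j * x j := by
  simp [act, Matrix.toLpLin_apply, Matrix.mulVec, dotProduct]

lemma act_mul (A : Matrix m n ℝ) (B : Matrix n l ℝ) (x : EuclideanSpace ℝ l) :
    act (A * B) x = act A (act B x) := by
  rw [act, Matrix.toLpLin_mul 2 2 2]; rfl

lemma act_add (A B : Matrix m n ℝ) (x : EuclideanSpace ℝ n) :
    act (A + B) x = act A x + act B x := by simp [act]

lemma act_sub (A B : Matrix m n ℝ) (x : EuclideanSpace ℝ n) :
    act (A - B) x = act A x - act B x := by simp [act]

lemma act_smul (c : ℝ) (A : Matrix m n ℝ) (x : EuclideanSpace ℝ n) :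
    act (c • A) x = c • act A x := by simp [act]

lemma act_one (x : EuclideanSpace ℝ n) : act (1 : Matrix n n ℝ) x = x := by
  simp [act]

lemma inner_act (A : Matrix m n ℝ) (x : EuclideanSpace ℝ n) (y : EuclideanSpace ℝ m) :
    inner ℝ (act A x) y = inner ℝ x (act Aᵀ y) := by
  simp only [PiLp.inner_apply, act_apply, RCLike.inner_apply, conj_trivial, Finset.mul_sum,
    Finset.sum_mul, Matrix.transpose_apply]
  rw [Finset.sum_comm]
  exact Finset.sum_congr rfl fun _ _ => Finset.sum_congr rfl fun _ _ => by ring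

lemma act_single (A : Matrix m n ℝ) (j : n) (i : m) :
    act A (EuclideanSpace.single j 1) i = A i j := by
  simp [act_apply]

lemma act_isSymmetric {A : Matrix n n ℝ} (hA : Aᵀ = A) : (act A).IsSymmetric := fun x y => by
  rw [inner_act, hA]

end Action

section SpectralApprox

set_option linter.unusedSectionVars false

variable {V : Type*} [Fintype V] [DecidableEq V]

/-- The orthogonal projection on the span of some members of an orthonormal family. -/
def projSpan (w : V → EuclideanSpace ℝ V) (J : Finset V) :
    EuclideanSpace ℝ V →ₗ[ℝ] EuclideanSpace ℝ V where
  toFun x := ∑ l ∈ J, (inner ℝ (w l) x : ℝ) • w l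
  map_add' x y := by simp [inner_add_right, add_smul, Finset.sum_add_distrib]
  map_smul' c x := by simp [inner_smul_right, mul_smul, Finset.smul_sum]

lemma projSpan_apply (w : V → EuclideanSpace ℝ V) (J : Finset V) (x : EuclideanSpace ℝ V) :
    projSpan w J x = ∑ l ∈ J, (inner ℝ (w l) x : ℝ) • w l := rfl

/-- A symmetric matrix close to a symmetric matrix of rank at most `r` with a spectral gap has
a spectral gap, and its spectral projection has rank at most `r`. -/
lemma exists_projSpan_spectralGap {r : ℕ} {M T : Matrix V V ℝ} (hT : Tᵀ = T)
    {Pr : EuclideanSpace ℝ V →ₗ[ℝ] EuclideanSpace ℝ V} {σ : ℝ} (hσ : 0 < σ)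
    (hM : SpectralGap (act M) Pr σ 0) {κ : Type*} [Fintype κ] (hκ : Fintype.card κ = r)
    (φ : EuclideanSpace ℝ V →ₗ[ℝ] (κ → ℝ)) (hφ : ∀ x, φ x = 0 → act M x = 0)
    (hTM : ∀ x, ‖act T x - act M x‖ ≤ 1 / 50 * σ * ‖x‖) :
    ∃ (w : V → EuclideanSpace ℝ V) (J : Finset V), Orthonormal ℝ w ∧ J.card ≤ r ∧
      SpectralGap (act T) (projSpan w J) (3 / 4 * σ) (1 / 4 * σ) := by
  have hH : T.IsHermitian := by rw [Matrix.IsHermitian, Matrix.conjTranspose_eq_transpose_of_trivial, hT]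
  set u := hH.eigenvectorBasis with hu
  set lam := hH.eigenvalues with hlam
  have hTu : ∀ l, act T (u l) = lam l • u l := fun l => by
    ext j
    have := congrFun (hH.mulVec_eigenvectorBasis l) j
    simpa [Matrix.toLpLin_apply] using this
  have hin : ∀ l x, inner ℝ (u l) (act T x) = lam l * inner ℝ (u l) x := fun l x => by
    rw [← act_isSymmetric hT, hTu, inner_smul_left]; simp
  have horth : ∀ l m, inner ℝ (u l) (u m) = if l = m then (1 : ℝ) else 0 :=
    orthonormal_iff_ite.1 u.orthonormal
  have hgap : ∀ l, |lam l| ≤ 1 / 4 * σ ∨ 3 / 4 * σ ≤ |lam l| := fun l => by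
    by_contra! hcon
    have h1 := hTM (u l)
    rw [hTu, u.orthonormal.1 l, mul_one] at h1
    set x := u l with hx
    have hx1 : ‖x‖ = 1 := u.orthonormal.1 l
    set y := lam l • x - act M x with hy
    have hsq := hM.norm_sq_add y
    have hPy : Pr y = lam l • Pr x - act M (Pr x) := by rw [hy, map_sub, map_smul, hM.comm]
    have hMx : act M (x - Pr x) = 0 := by
      have := hM.upper x
      rw [zero_mul] at this
      exact norm_le_zero_iff.1 this
    have hQy : y - Pr y = lam l • (x - Pr x) := by
      rw [hPy, hy, smul_sub]
      have : act M x = act M (Pr x) := by rw [map_sub] at hMx; exact sub_eq_zero.1 hMx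
      rw [this]; abel
    have a1 : σ / 4 * ‖Pr x‖ ≤ ‖Pr y‖ := by
      rw [hPy]
      have := norm_sub_norm_le (act M (Pr x)) (lam l • Pr x)
      rw [norm_sub_rev, norm_smul, Real.norm_eq_abs] at this
      nlinarith [hM.lower x, norm_nonneg (Pr x)]
    have a2 : σ / 4 * ‖x - Pr x‖ ≤ ‖y - Pr y‖ := by
      rw [hQy, norm_smul, Real.norm_eq_abs]
      nlinarith [norm_nonneg (x - Pr x)]
    have hs := hM.norm_sq_add x
    rw [hx1] at hs
    have b1 : (σ / 4 * ‖Pr x‖) ^ 2 ≤ ‖Pr y‖ ^ 2 := by gcongr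
    have b2 : (σ / 4 * ‖x - Pr x‖) ^ 2 ≤ ‖y - Pr y‖ ^ 2 := by gcongr
    have b3 : ‖y‖ ^ 2 ≤ (1 / 50 * σ) ^ 2 := by gcongr
    nlinarith
  set J : Finset V := Finset.univ.filter fun l => 3 / 4 * σ ≤ |lam l| with hJ
  have hPin : ∀ l x, inner ℝ (u l) (projSpan u J x) = if l ∈ J then inner ℝ (u l) x else 0 :=
    fun l x => by
      rw [projSpan_apply, inner_sum]
      simp [inner_smul_right, horth]
  have hext : ∀ x y, (∀ l, inner ℝ (u l) x = inner ℝ (u l) y) → x = y := fun x y h => by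
    rw [← u.sum_repr' x, ← u.sum_repr' y]
    exact Finset.sum_congr rfl fun l _ => by rw [h]
  refine ⟨u, J, u.orthonormal, ?_, ⟨fun x y => ?_, fun x => ?_, fun x => ?_, fun x => ?_,
    fun x => ?_⟩⟩
  · by_contra! hcard
    set ψ : (J → ℝ) →ₗ[ℝ] EuclideanSpace ℝ V := Fintype.linearCombination ℝ (fun l : J => u l)
      with hψ
    have hker := LinearMap.ker_ne_bot_of_finrank_lt (f := φ ∘ₗ ψ) (by simpa [hκ] using hcard)
    obtain ⟨c, hc, hc0⟩ := (Submodule.ne_bot_iff _).1 hker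
    have hz := hφ (ψ c) (by simpa using hc)
    have hψc : ψ c = ∑ l : J, c l • u l := by simp [hψ, Fintype.linearCombination_apply]
    have hne : ψ c ≠ 0 := fun h => by
      have hli : LinearIndependent ℝ (fun l : J => u l) :=
        u.orthonormal.linearIndependent.comp _ Subtype.val_injective
      refine hc0 (funext fun l => ?_)
      exact Fintype.linearIndependent_iff.1 hli c (hψc ▸ h) l
    have h1 := hTM (ψ c)
    rw [hz, sub_zero] at h1
    have h2 : (3 / 4 * σ * ‖ψ c‖) ^ 2 ≤ ‖act T (ψ c)‖ ^ 2 := by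
      rw [mul_pow, ← u.sum_sq_norm_inner_right (ψ c), ← u.sum_sq_norm_inner_right (act T (ψ c)),
        Finset.mul_sum]
      refine Finset.sum_le_sum fun l _ => ?_
      rw [hin, norm_mul, mul_pow ‖lam l‖]
      by_cases hl : l ∈ J
      · have : 3 / 4 * σ ≤ |lam l| := (Finset.mem_filter.1 hl).2
        rw [Real.norm_eq_abs (lam l)]
        gcongr
      · have : inner ℝ (u l) (ψ c) = (0 : ℝ) := by
          rw [hψc, inner_sum]
          refine Finset.sum_eq_zero fun m _ => ?_
          rw [inner_smul_right, horth, if_neg, mul_zero]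
          rintro rfl; exact hl m.2
        simp [this]
    have h3 : 0 < ‖ψ c‖ := norm_pos_iff.2 hne
    have h4 : 3 / 4 * σ * ‖ψ c‖ ≤ ‖act T (ψ c)‖ :=
      le_of_abs_le (abs_le_of_sq_le_sq (by simpa using h2) (norm_nonneg _)) |>.trans le_rfl
    nlinarith [mul_pos hσ h3]
  · simp only [projSpan_apply, sum_inner, inner_sum, inner_smul_left, inner_smul_right]
    refine Finset.sum_congr rfl fun l _ => ?_
    rw [real_inner_comm x (u l)]
    simp [mul_comm]
  · refine hext _ _ fun l => ?_
    rw [hPin, hPin]; split_ifs <;> rfl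
  · refine hext _ _ fun l => ?_
    rw [hin, hPin, hPin, hin]; split_ifs <;> simp
  · refine le_of_abs_le (abs_le_of_sq_le_sq ?_ (norm_nonneg _))
    rw [mul_pow, ← u.sum_sq_norm_inner_right (projSpan u J x),
      ← u.sum_sq_norm_inner_right (act T (projSpan u J x)), Finset.mul_sum]
    refine Finset.sum_le_sum fun l _ => ?_
    rw [hin, norm_mul, mul_pow ‖lam l‖, hPin]
    split_ifs with hl
    · have : 3 / 4 * σ ≤ |lam l| := (Finset.mem_filter.1 hl).2
      rw [Real.norm_eq_abs (lam l)]
      gcongr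
    · simp
  · refine le_of_abs_le (abs_le_of_sq_le_sq ?_ (by positivity))
    rw [mul_pow, ← u.sum_sq_norm_inner_right (x - projSpan u J x),
      ← u.sum_sq_norm_inner_right (act T (x - projSpan u J x)), Finset.mul_sum]
    refine Finset.sum_le_sum fun l _ => ?_
    rw [hin, norm_mul, mul_pow ‖lam l‖, inner_sub_right, hPin]
    split_ifs with hl
    · simp
    · have : |lam l| ≤ 1 / 4 * σ := (hgap l).resolve_right fun h => hl (by simp [hJ, h])
      rw [Real.norm_eq_abs (lam l)]
      gcongr

end SpectralApprox

section RandomGraphMatrix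

variable {V β : Type*} [Fintype V] [DecidableEq V] [Fintype β] [DecidableEq β]

set_option linter.unusedSectionVars false

/-- The symmetric matrix with the weight `a e` on the edge `e` from `u e` to `v e`. -/
def edgeMat (u v : β → V) (a : β → ℝ) (e : β) : Matrix V V ℝ :=
  a e • (Matrix.single (u e) (v e) 1 + Matrix.single (v e) (u e) 1)

/-- The edge matrix, with the edges at the vertex `i` removed. -/
def offMat (u v : β → V) (a : β → ℝ) (i : V) (e : β) : Matrix V V ℝ :=
  if u e = i ∨ v e = i then 0 else edgeMat u v a e

/-- The endpoint of an edge at `i` that is not `i`. -/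
def otherEnd (u v : β → V) (i : V) (e : β) : V := if u e = i then v e else u e

/-- The row of the random matrix at the vertex `i`. -/
def rowVec (p : ℝ) (u v : β → V) (a : β → ℝ) (i : V) (ω : β → Bool) : EuclideanSpace ℝ V :=
  ∑ e, if u e = i ∨ v e = i then
    (bernXi p (ω e) * a e) • EuclideanSpace.single (otherEnd u v i e) (1 : ℝ) else 0

variable {u v : β → V} {a : β → ℝ}

lemma edgeMat_transpose (e : β) : (edgeMat u v a e)ᵀ = edgeMat u v a e := by
  simp [edgeMat, add_comm]

lemma bernSum_transpose (p : ℝ) {A : β → Matrix V V ℝ} (hA : ∀ e, (A e)ᵀ = A e) (ω : β → Bool) :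
    (bernSum p A ω)ᵀ = bernSum p A ω := by
  simp [bernSum, Matrix.transpose_sum, hA]

lemma offMat_transpose (i : V) (e : β) : (offMat u v a i e)ᵀ = offMat u v a i e := by
  unfold offMat; split_ifs
  · simp
  · exact edgeMat_transpose e

lemma edgeMat_mul_self (huv : ∀ e, u e ≠ v e) (e : β) : edgeMat u v a e * edgeMat u v a e =
    Matrix.diagonal fun i => if u e = i ∨ v e = i then a e ^ 2 else 0 := by
  have h := huv e
  ext i j
  simp only [edgeMat, smul_mul_assoc, mul_smul_comm, add_mul, mul_add, Matrix.smul_apply,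
    Matrix.add_apply, smul_eq_mul]
  rw [Matrix.single_mul_single_of_ne (h := h.symm), Matrix.single_mul_single_of_ne (h := h),
    Matrix.single_mul_single_same, Matrix.single_mul_single_same]
  simp only [Matrix.diagonal_apply, Matrix.single_apply, Matrix.zero_apply]
  by_cases h1 : u e = i
  · subst h1
    by_cases h2 : u e = j
    · simp [h2, sq]; intro h3; exact absurd (h3 ▸ h2) h
    · simp [h2, h.symm]
  · by_cases h3 : v e = i
    · subst h3
      by_cases h2 : v e = j
      · simp [h2, sq]; intro h3; exact absurd (h3.trans h2.symm) h
      · simp [h2, h1]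
    · simp [h1, h3]

lemma act_edgeMat (e : β) (x : EuclideanSpace ℝ V) : act (edgeMat u v a e) x =
    (a e * x (v e)) • EuclideanSpace.single (u e) (1 : ℝ) +
      (a e * x (u e)) • EuclideanSpace.single (v e) (1 : ℝ) := by
  ext i
  rw [act_apply]
  simp only [edgeMat, Matrix.smul_apply, Matrix.add_apply, Matrix.single_apply, smul_eq_mul,
    PiLp.add_apply, PiLp.smul_apply, PiLp.single_apply, mul_add, add_mul,
    Finset.sum_add_distrib]
  congr 1
  · by_cases h : u e = i
    · simp [h]
    · simp [h, Ne.symm h]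
  · by_cases h : v e = i
    · simp [h]
    · simp [h, Ne.symm h]

lemma act_bernSum (p : ℝ) (A : β → Matrix V V ℝ) (ω : β → Bool) (x : EuclideanSpace ℝ V) :
    act (bernSum p A ω) x = ∑ e, bernXi p (ω e) • act (A e) x := by
  simp [act, bernSum]

lemma inner_rowVec (p : ℝ) (i : V) (ω : β → Bool) (x : EuclideanSpace ℝ V) :
    inner ℝ (rowVec p u v a i ω) x =
      ∑ e, bernXi p (ω e) * (if u e = i ∨ v e = i then a e * x (otherEnd u v i e) else 0) := by
  rw [rowVec, sum_inner]
  refine Finset.sum_congr rfl fun e _ => ?_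
  split_ifs
  · rw [inner_smul_left, EuclideanSpace.inner_single_left]; simp; ring
  · simp

lemma act_bernSum_sub_offMat (huv : ∀ e, u e ≠ v e) (p : ℝ) (i : V) (ω : β → Bool)
    (x : EuclideanSpace ℝ V) :
    act (bernSum p (edgeMat u v a) ω) x - act (bernSum p (offMat u v a i) ω) x =
      (inner ℝ (rowVec p u v a i ω) x : ℝ) • EuclideanSpace.single i (1 : ℝ) +
      (inner ℝ (EuclideanSpace.single i (1 : ℝ)) x : ℝ) • rowVec p u v a i ω := by
  rw [inner_rowVec, act_bernSum, act_bernSum, ← Finset.sum_sub_distrib, rowVec, Finset.smul_sum,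
    Finset.sum_smul, ← Finset.sum_add_distrib]
  refine Finset.sum_congr rfl fun e _ => ?_
  have h := huv e
  rw [offMat, EuclideanSpace.inner_single_left]
  by_cases h1 : u e = i
  · subst h1
    simp only [true_or, if_true, otherEnd, act_edgeMat]
    simp [smul_smul, smul_add]; ring_nf
  · by_cases h2 : v e = i
    · subst h2
      simp only [or_true, if_true, otherEnd, act_edgeMat, h1, if_false]
      simp [smul_smul, smul_add]; rw [add_comm]; ring_nf
    · simp [h1, h2]

lemma otherEnd_ne (huv : ∀ e, u e ≠ v e) (i : V) (e : β) :
    otherEnd u v i e ≠ i := by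
  unfold otherEnd
  split_ifs with h1
  · exact h1 ▸ (huv e).symm
  · exact h1

lemma inner_rowVec_single (huv : ∀ e, u e ≠ v e) (p : ℝ) (i : V) (ω : β → Bool) :
    inner ℝ (rowVec p u v a i ω) (EuclideanSpace.single i (1 : ℝ)) = (0 : ℝ) := by
  rw [inner_rowVec]
  refine Finset.sum_eq_zero fun e _ => ?_
  split_ifs with h
  · simp [otherEnd_ne huv i e]
  · simp

lemma act_offMat_single (p : ℝ) (i : V) (ω : β → Bool) :
    act (bernSum p (offMat u v a i) ω) (EuclideanSpace.single i (1 : ℝ)) = 0 := by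
  rw [act_bernSum]
  refine Finset.sum_eq_zero fun e _ => ?_
  rw [offMat]
  split_ifs with h
  · simp
  · push Not at h
    rw [act_edgeMat]; simp [h.1, h.2]

lemma act_edgeMat_single (huv : ∀ e, u e ≠ v e) (p : ℝ) (i : V) (ω : β → Bool) :
    act (bernSum p (edgeMat u v a) ω) (EuclideanSpace.single i (1 : ℝ)) = rowVec p u v a i ω := by
  have := act_bernSum_sub_offMat (a := a) huv p i ω (EuclideanSpace.single i (1 : ℝ))
  rw [inner_rowVec_single huv, act_offMat_single] at this
  simpa using this

/-- Bernstein's inequality for all admissible deviation levels at once. -/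
lemma bernP_exists_level_le {p : ℝ} (hp : 0 < p) (h1 : p ≤ 1) (c : β → ℝ) {L : ℝ} (hL : 0 ≤ L) :
    bernP p (fun ω => ∃ t : ℝ, 0 < t ∧ L * ((∑ e, c e ^ 2) / p) ≤ t ^ 2 ∧
      (∀ e, L * |c e| ≤ t * p) ∧ 2 * t < |∑ e, bernXi p (ω e) * c e|) ≤ 2 * Real.exp (-L) := by
  set A : (β → Bool) → Prop := fun ω => ∃ t : ℝ, 0 < t ∧ L * ((∑ e, c e ^ 2) / p) ≤ t ^ 2 ∧
      (∀ e, L * |c e| ≤ t * p) ∧ 2 * t < |∑ e, bernXi p (ω e) * c e| with hA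
  by_cases hne : ∃ ω, A ω
  · have : Nonempty {ω // A ω} := let ⟨ω, h⟩ := hne; ⟨⟨ω, h⟩⟩
    choose t ht using fun ω : {ω // A ω} => ω.2
    obtain ⟨ω₀, h₀⟩ := Finite.exists_min t
    refine (bernP_mono hp.le h1 fun ω hω => ?_).trans
      (bernP_abs_sum_gt_le hp h1 c hL (ht ω₀).1 (ht ω₀).2.1 (ht ω₀).2.2.1)
    have := h₀ ⟨ω, hω⟩
    have h2 := (ht ⟨ω, hω⟩).2.2.2
    simp only at h2
    linarith
  · refine le_trans (bernP_mono hp.le h1 (B := fun _ => False) fun ω hω => hne ⟨ω, hω⟩) ?_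
    simp only [bernP, if_false, bernE_const]
    positivity

/-- The data of a spectral projection of rank at most `r` for a matrix with a spectral gap. -/
def IsSpectralChoice (r : ℕ) (σ : ℝ) (T : Matrix V V ℝ)
    (x : (V → EuclideanSpace ℝ V) × Finset V) : Prop :=
  Orthonormal ℝ x.1 ∧ x.2.card ≤ r ∧
    SpectralGap (act T) (projSpan x.1 x.2) (3 / 4 * σ) (1 / 4 * σ)

open Classical in
/-- A spectral projection, chosen as a function of the matrix. -/
def spectralChoice (r : ℕ) (σ : ℝ) (T : Matrix V V ℝ) :
    (V → EuclideanSpace ℝ V) × Finset V :=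
  if h : ∃ x, IsSpectralChoice r σ T x then h.choose else (fun _ => 0, ∅)

lemma spectralChoice_spec {r : ℕ} {σ : ℝ} {T : Matrix V V ℝ}
    (h : ∃ x, IsSpectralChoice r σ T x) : IsSpectralChoice r σ T (spectralChoice r σ T) := by
  rw [spectralChoice, dif_pos h]; exact h.choose_spec

/-- The row of the noise at `i` deviates along one of the directions `w l` more than Bernstein's
inequality predicts. -/
def RowDeviates (p L : ℝ) (u v : β → V) (a : β → ℝ) (i : V) (w : V → EuclideanSpace ℝ V)
    (ω : β → Bool) : Prop :=
  ∃ l, ∃ t : ℝ, 0 < t ∧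
    L * ((∑ e, (if u e = i ∨ v e = i then a e * w l (otherEnd u v i e) else 0) ^ 2) / p) ≤ t ^ 2 ∧
    (∀ e, L * |if u e = i ∨ v e = i then a e * w l (otherEnd u v i e) else 0| ≤ t * p) ∧
    2 * t < |inner ℝ (rowVec p u v a i ω) (w l)|

lemma bernP_rowDeviates_le {p : ℝ} (hp : 0 < p) (h1 : p ≤ 1) {L : ℝ} (hL : 0 ≤ L) (i : V)
    (W : Matrix V V ℝ → V → EuclideanSpace ℝ V) (M₀ : Matrix V V ℝ) :
    bernP p (fun ω => RowDeviates p L u v a i (W (M₀ + bernSum p (offMat u v a i) ω)) ω) ≤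
      Fintype.card V * (2 * Real.exp (-L)) := by
  refine bernP_le_of_resample hp.le h1 (fun e => u e = i ∨ v e = i) _ fun ω => ?_
  have hoff : ∀ ω' : β → Bool, bernSum p (offMat u v a i)
      (fun e => if u e = i ∨ v e = i then ω' e else ω e) = bernSum p (offMat u v a i) ω :=
    fun ω' => by
      refine Finset.sum_congr rfl fun e _ => ?_
      unfold offMat
      by_cases h : u e = i ∨ v e = i
      · simp [h]
      · simp only [if_neg h]
  have hrow : ∀ (ω' : β → Bool) x, inner ℝ (rowVec p u v a i
      (fun e => if u e = i ∨ v e = i then ω' e else ω e)) x =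
      (inner ℝ (rowVec p u v a i ω') x : ℝ) := fun ω' x => by
    rw [inner_rowVec, inner_rowVec]
    refine Finset.sum_congr rfl fun e _ => ?_
    split_ifs <;> simp
  simp only [RowDeviates, hoff, hrow]
  refine (bernP_exists_le hp.le h1 _).trans ?_
  refine (Finset.sum_le_sum fun l _ => ?_).trans_eq
    (by rw [Finset.sum_const, Finset.card_univ, nsmul_eq_mul])
  simp only [inner_rowVec]
  exact bernP_exists_level_le hp h1 _ hL

/-- The bound on the projected noise row when it does not deviate. -/
lemma norm_projSpan_rowVec_le {p : ℝ} (hp : 0 < p) {L : ℝ} (hL : 1 ≤ L) {r : ℕ}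
    (hr : 1 ≤ r) {R : V → ℝ} (hR : ∀ i, 0 < R i) {σ S : ℝ} (hσ : 0 < σ) (hσS : σ ≤ S)
    (ha1 : ∀ i, (∑ e, if u e = i ∨ v e = i then a e ^ 2 else 0) ≤ 2 * (R i * S) ^ 2)
    (ha2 : ∀ e, a e ^ 2 ≤ 2 * (R (u e) * R (v e) * S) ^ 2)
    (hRp : ∀ i, R i ^ 2 * L * r * S ^ 2 ≤ 1 / 10 ^ 7 * σ ^ 2 * p)
    {w : V → EuclideanSpace ℝ V} (hw : Orthonormal ℝ w) {J : Finset V} (hJ : J.card ≤ r) {i : V}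
    {ω : β → Bool} (hdev : ¬ RowDeviates p L u v a i w ω) {η τ : ℝ} (hη : 0 ≤ η) (hτ : 0 ≤ τ)
    (hQ : ∀ j, ‖projSpan w J (EuclideanSpace.single j 1)‖ ≤ η * R j + τ) :
    ‖projSpan w J (rowVec p u v a i ω)‖ ≤ 1 / 100 * σ * (η * R i + τ) := by
  have hS : 0 < S := hσ.trans_le hσS
  have hr' : (1 : ℝ) ≤ r := by exact_mod_cast hr
  set G := η * R i + τ with hG
  have hG0 : 0 ≤ G := add_nonneg (mul_nonneg hη (hR i).le) hτ
  have hnorm : ∀ x, ‖projSpan w J x‖ ^ 2 = ∑ l ∈ J, (inner ℝ (w l) x : ℝ) ^ 2 := fun x => by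
    rw [← real_inner_self_eq_norm_sq, projSpan_apply, hw.inner_sum]
    exact Finset.sum_congr rfl fun l _ => by simp [sq]
  have hnorm1 : ∀ j, ‖projSpan w J (EuclideanSpace.single j 1)‖ ^ 2 = ∑ l ∈ J, (w l j) ^ 2 :=
    fun j => by
      rw [hnorm]
      exact Finset.sum_congr rfl fun l _ => by rw [EuclideanSpace.inner_single_right]; simp
  rcases hG0.eq_or_lt with hG1 | hG1
  · -- no vertex is seen by the projection
    have hη0 : η = 0 := by
      have := mul_nonneg hη (hR i).le
      have h0 : η * R i = 0 := by linarith
      exact (mul_eq_zero.1 h0).resolve_right (hR i).ne'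
    have hτ0 : τ = 0 := by rw [hη0] at hG; linarith
    have hz : ∀ j, projSpan w J (EuclideanSpace.single j (1 : ℝ)) = 0 := fun j => by
      have := hQ j
      rw [hη0, hτ0] at this
      exact norm_le_zero_iff.1 (by simpa using this)
    have : projSpan w J (rowVec p u v a i ω) = 0 := by
      rw [rowVec, map_sum]
      refine Finset.sum_eq_zero fun e _ => ?_
      split_ifs
      · rw [map_smul, hz, smul_zero]
      · simp
    rw [this, norm_zero]; positivity
  · set B := 2 / 10 ^ 7 / r * σ * G with hB
    have hB0 : 0 < B := by positivity
    set Vl : V → ℝ := fun l =>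
      L * ((∑ e, (if u e = i ∨ v e = i then a e * w l (otherEnd u v i e) else 0) ^ 2) / p) with hVl
    have hVl0 : ∀ l, 0 ≤ Vl l := fun l => by
      have := Finset.sum_nonneg fun e (_ : e ∈ Finset.univ) =>
        sq_nonneg (if u e = i ∨ v e = i then a e * w l (otherEnd u v i e) else 0)
      have : 0 ≤ L := by linarith
      positivity
    have hedge : ∀ e, (u e = i ∨ v e = i) →
        L * (|a e| * (η * R (otherEnd u v i e) + τ)) ≤ B * p := fun e he => by
      set j := otherEnd u v i e with hj
      have hae : |a e| ≤ 3 / 2 * (R i * R j * S) := by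
        have hab : a e ^ 2 ≤ 2 * (R i * R j * S) ^ 2 := by
          have := ha2 e
          rcases he with h | h
          · rw [hj, otherEnd, if_pos h, ← h]; exact this
          · by_cases h' : u e = i
            · rw [hj, otherEnd, if_pos h', ← h']; exact this
            · rw [hj, otherEnd, if_neg h', ← h, mul_comm (R (v e))]; exact this
        have h0 : 0 < R i * R j * S := mul_pos (mul_pos (hR i) (hR j)) hS
        exact abs_le_of_sq_le_sq (by nlinarith) (by positivity)
      set X := 1 / 10 ^ 7 * σ ^ 2 * p / (r * S) with hX
      have hx : ∀ i, L * R i ^ 2 * S ≤ X := fun i => by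
        rw [hX, le_div_iff₀ (by positivity)]
        linarith [hRp i]
      have hx2 : L * (R i * R j) * S ≤ X := by
        have : R i * R j ≤ (R i ^ 2 + R j ^ 2) / 2 := by nlinarith [sq_nonneg (R i - R j)]
        have : L * (R i * R j) * S ≤ L * ((R i ^ 2 + R j ^ 2) / 2) * S := by gcongr
        linarith [hx i, hx j]
      have hX2 : X ≤ 1 / 10 ^ 7 * σ * p / r := by
        rw [hX, div_le_div_iff₀ (by positivity) (by positivity)]
        have : 0 ≤ 1 / 10 ^ 7 * σ * p * r := by positivity
        nlinarith
      have hRj := (hR j).le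
      have hRi := (hR i).le
      calc L * (|a e| * (η * R j + τ)) ≤ L * (3 / 2 * (R i * R j * S) * (η * R j + τ)) := by gcongr
        _ = 3 / 2 * (η * R i * (L * R j ^ 2 * S) + τ * (L * (R i * R j) * S)) := by ring
        _ ≤ 3 / 2 * (η * R i * X + τ * X) := by
            have := hx j
            gcongr
        _ = 3 / 2 * G * X := by rw [hG]; ring
        _ ≤ 2 * G * (1 / 10 ^ 7 * σ * p / r) := by gcongr; norm_num
        _ = B * p := by rw [hB]; ring
    have hl : ∀ l ∈ J, (inner ℝ (w l) (rowVec p u v a i ω) : ℝ) ^ 2 ≤ 4 * (Vl l + B ^ 2) := by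
      intro l hlJ
      by_contra! hcon
      refine hdev ⟨l, √(Vl l + B ^ 2), ?_, ?_, fun e => ?_, ?_⟩
      · have := hVl0 l; positivity
      · rw [Real.sq_sqrt (by have := hVl0 l; positivity)]
        have : 0 ≤ B ^ 2 := sq_nonneg B
        linarith
      · have hBt : B ≤ √(Vl l + B ^ 2) := Real.le_sqrt_of_sq_le (by linarith [hVl0 l])
        refine le_trans ?_ (mul_le_mul_of_nonneg_right hBt hp.le)
        split_ifs with he
        · refine le_trans ?_ (hedge e he)
          rw [abs_mul]
          have : |w l (otherEnd u v i e)| ≤ η * R (otherEnd u v i e) + τ := by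
            refine le_trans ?_ (hQ _)
            refine abs_le_of_sq_le_sq ?_ (norm_nonneg _)
            rw [hnorm1]
            exact Finset.single_le_sum (f := fun l => w l (otherEnd u v i e) ^ 2)
              (fun l _ => sq_nonneg _) hlJ
          gcongr
        · simp; positivity
      · rw [real_inner_comm]
        have h4 : √(4 * (Vl l + B ^ 2)) < |inner ℝ (w l) (rowVec p u v a i ω)| := by
          rw [Real.sqrt_lt' (by
            by_contra! h0
            have h00 := abs_eq_zero.1 (le_antisymm h0 (abs_nonneg _))
            rw [h00] at hcon
            have := hVl0 l
            nlinarith [sq_nonneg B])]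
          rwa [sq_abs]
        rwa [Real.sqrt_mul (by norm_num), show (4 : ℝ) = 2 ^ 2 by norm_num,
          Real.sqrt_sq (by norm_num)] at h4
    have hsumV : ∑ l ∈ J, Vl l ≤ 4 / 10 ^ 7 * σ ^ 2 * G ^ 2 := by
      have e1 : ∑ l ∈ J, Vl l = L / p * ∑ e, (if u e = i ∨ v e = i then a e ^ 2 else 0) *
          ∑ l ∈ J, w l (otherEnd u v i e) ^ 2 := by
        simp only [hVl, ← Finset.mul_sum, ← Finset.sum_div]
        rw [Finset.sum_comm, mul_div_assoc', mul_comm (L / p), mul_div_assoc', mul_comm L]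
        congr 2
        refine Finset.sum_congr rfl fun e _ => ?_
        split_ifs
        · rw [Finset.mul_sum]; exact Finset.sum_congr rfl fun _ _ => by ring
        · simp
      set Y := 1 / 10 ^ 7 * σ ^ 2 * p / (L * S ^ 2) with hY
      have hYR : ∀ j, R j ^ 2 ≤ Y := fun j => by
        rw [hY, le_div_iff₀ (by positivity)]
        have := hRp j
        have h0 : 0 ≤ R j ^ 2 * L * S ^ 2 := by positivity
        nlinarith
      have e2 : ∀ e, ∑ l ∈ J, w l (otherEnd u v i e) ^ 2 ≤ 2 * η ^ 2 * Y + 2 * τ ^ 2 := fun e => by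
        rw [← hnorm1]
        set j := otherEnd u v i e
        have h1 : ‖projSpan w J (EuclideanSpace.single j 1)‖ ^ 2 ≤ (η * R j + τ) ^ 2 := by
          have := hQ j; gcongr
        have h2 : η ^ 2 * R j ^ 2 ≤ η ^ 2 * Y := by have := hYR j; gcongr
        nlinarith [sq_nonneg (η * R j - τ)]
      rw [e1]
      have hL0 : 0 < L := by linarith
      calc _ ≤ L / p * ∑ e, (if u e = i ∨ v e = i then a e ^ 2 else 0) *
            (2 * η ^ 2 * Y + 2 * τ ^ 2) := by
            gcongr with e
            exact e2 e
        _ ≤ L / p * (2 * (R i * S) ^ 2 * (2 * η ^ 2 * Y + 2 * τ ^ 2)) := by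
            rw [← Finset.sum_mul]
            have : 0 ≤ Y := (sq_nonneg (R i)).trans (hYR i)
            have := ha1 i
            gcongr
        _ = 4 * (η * R i) ^ 2 * (L / p * S ^ 2 * Y) + 4 * τ ^ 2 * (R i ^ 2 * (L / p * S ^ 2)) := by
            ring
        _ ≤ 4 * (η * R i) ^ 2 * (L / p * S ^ 2 * Y) + 4 * τ ^ 2 * (Y * (L / p * S ^ 2)) := by
            have := hYR i
            gcongr
        _ = 4 / 10 ^ 7 * σ ^ 2 * ((η * R i) ^ 2 + τ ^ 2) := by
            have : L / p * S ^ 2 * Y = 1 / 10 ^ 7 * σ ^ 2 := by rw [hY]; field_simp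
            rw [mul_comm Y, this]; ring
        _ ≤ _ := by
            gcongr
            rw [hG]
            have : 0 ≤ η * R i * τ := mul_nonneg (mul_nonneg hη (hR i).le) hτ
            nlinarith
    have hfin : ‖projSpan w J (rowVec p u v a i ω)‖ ^ 2 ≤ (1 / 100 * σ * G) ^ 2 := by
      rw [hnorm]
      refine (Finset.sum_le_sum hl).trans ?_
      rw [← Finset.mul_sum, Finset.sum_add_distrib, Finset.sum_const, nsmul_eq_mul]
      have hJr : (J.card : ℝ) * B ^ 2 ≤ 4 / 10 ^ 14 * (σ ^ 2 * G ^ 2) := by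
        have : (J.card : ℝ) ≤ r := by exact_mod_cast hJ
        calc (J.card : ℝ) * B ^ 2 ≤ r * B ^ 2 := by gcongr
          _ = 4 / 10 ^ 14 * (σ ^ 2 * G ^ 2) / r := by rw [hB]; field_simp; norm_num
          _ ≤ _ := div_le_self (by positivity) hr'
      have : 0 ≤ σ ^ 2 * G ^ 2 := by positivity
      nlinarith
    exact le_of_abs_le (abs_le_of_sq_le_sq hfin (by positivity))

end RandomGraphMatrix

section NoisySpectralTruncation

variable {V β : Type*} [Fintype V] [DecidableEq V] [Fintype β] [DecidableEq β]
variable {u v : β → V} {a : β → ℝ}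

lemma bernP_edge_opNorm_gt_le {p : ℝ} (hp : 0 < p) (h1 : p ≤ 1)
    (huv : ∀ e, u e ≠ v e) {L : ℝ} (hL : 1 ≤ L) {r : ℕ} (hr : 1 ≤ r) {R : V → ℝ} {σ S : ℝ}
    (hσ : 0 < σ) (hσS : σ ≤ S)
    (ha1 : ∀ i, (∑ e, if u e = i ∨ v e = i then a e ^ 2 else 0) ≤ 2 * (R i * S) ^ 2)
    (ha2 : ∀ e, a e ^ 2 ≤ 2 * (R (u e) * R (v e) * S) ^ 2)
    (hRp : ∀ i, R i ^ 2 * L * r * S ^ 2 ≤ 1 / 10 ^ 7 * σ ^ 2 * p) :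
    bernP p (fun ω => ¬ ∀ x, ‖act (bernSum p (edgeMat u v a) ω) x‖ ≤ σ / (200 * √r) * ‖x‖) ≤
      Fintype.card V * Real.exp (-L) := by
  have hS : 0 < S := hσ.trans_le hσS
  have hL0 : 0 < L := by linarith
  have hr' : (1 : ℝ) ≤ r := by exact_mod_cast hr
  have hr0 : (0 : ℝ) < r := by linarith
  set q := ⌈L⌉₊ with hq
  have hqL : L ≤ q := Nat.le_ceil L
  have hq2 : (q : ℝ) ≤ 2 * L := by
    have := Nat.ceil_lt_add_one hL0.le
    linarith
  set vv := 2 / 10 ^ 7 * σ ^ 2 / (r * L) with hvv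
  have hvv0 : 0 < vv := by positivity
  set D : β → V → ℝ := fun e i => if u e = i ∨ v e = i then a e ^ 2 else 0 with hD
  have hD0 : ∀ e i, 0 ≤ D e i := fun e i => by simp only [hD]; split_ifs <;> positivity
  have hsum : ∀ i, (∑ e, D e i) / p ≤ vv := fun i => by
    rw [hvv, div_le_div_iff₀ hp (by positivity)]
    have := mul_le_mul_of_nonneg_right (ha1 i) (by positivity : 0 ≤ r * L)
    have := hRp i
    simp only [hD]
    nlinarith
  have hB : ∀ e i, q * D e i ≤ vv * p ^ 2 := fun e i => by
    have hD1 : D e i ≤ 2 * (R (u e) * R (v e) * S) ^ 2 := by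
      simp only [hD]; split_ifs
      · exact ha2 e
      · positivity
    set X := 1 / 10 ^ 7 * σ ^ 2 * p / (L * r * S ^ 2) with hX
    have hRX : ∀ j, R j ^ 2 ≤ X := fun j => by
      rw [hX, le_div_iff₀ (by positivity)]; linarith [hRp j]
    have hX1 : L * X ≤ 1 / 10 ^ 7 * p := by
      have : L * X = 1 / 10 ^ 7 * p * (σ ^ 2 / (r * S ^ 2)) := by rw [hX]; field_simp
      rw [this]
      refine mul_le_of_le_one_right (by positivity) ((div_le_one (by positivity)).2 ?_)
      have : σ ^ 2 ≤ S ^ 2 := by gcongr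
      nlinarith [sq_nonneg S]
    have hX0 : 0 ≤ X := by positivity
    have hXS : X * S ^ 2 = vv * p / 2 := by rw [hX, hvv]; field_simp
    calc q * D e i ≤ 2 * L * (2 * (R (u e) * R (v e) * S) ^ 2) := by
          have := hD0 e i
          gcongr
      _ = 4 * (R (u e) ^ 2 * S ^ 2 * (L * R (v e) ^ 2)) := by ring
      _ ≤ 4 * (X * S ^ 2 * (L * X)) := by
          have := hRX (u e); have := hRX (v e); gcongr
      _ ≤ 4 * (X * S ^ 2 * (1 / 10 ^ 7 * p)) := by gcongr
      _ ≤ vv * p ^ 2 := by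
          rw [hXS]
          have : 0 ≤ vv * p ^ 2 := by positivity
          nlinarith
  refine (bernP_opNorm_gt_le hp h1 (edgeMat u v a) (fun e => ?_) D
    (fun e => edgeMat_mul_self huv e) hD0 hvv0 (q := q) (by
      have : (0 : ℝ) < q := hL0.trans_le hqL
      exact_mod_cast this) hsum hB (t := σ / (200 * √r)) (by positivity) ?_).trans ?_
  · rw [Matrix.IsHermitian, Matrix.conjTranspose_eq_transpose_of_trivial, edgeMat_transpose]
  · have he : Real.exp (3 / 2) ≤ 9 := by
      have h := Real.exp_one_lt_d9
      calc Real.exp (3 / 2) ≤ Real.exp 2 := Real.exp_le_exp.2 (by norm_num)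
        _ = Real.exp 1 * Real.exp 1 := by rw [← Real.exp_add]; norm_num
        _ ≤ 3 * 3 := by gcongr <;> linarith
        _ = 9 := by norm_num
    rw [div_pow, mul_pow, Real.sq_sqrt hr0.le]
    calc 2 * q * vv * Real.exp (3 / 2) ≤ 2 * (2 * L) * vv * 9 := by gcongr
      _ = 72 / 10 ^ 7 * (σ ^ 2 / r) := by rw [hvv]; field_simp; norm_num
      _ ≤ 1 / 40000 * (σ ^ 2 / r) :=
          mul_le_mul_of_nonneg_right (by norm_num) (by positivity)
      _ = σ ^ 2 / (200 ^ 2 * r) := by field_simp; norm_num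
  · gcongr

/-- With high probability the noisy matrix `M₀ + E` is close to `M` and each of its spectral
truncations has incoherent rows. -/
theorem bernP_not_incoherent_truncation_le {p : ℝ} (hp : 0 < p) (h1 : p ≤ 1)
    (huv : ∀ e, u e ≠ v e) {L : ℝ} (hL : 1 ≤ L) {r : ℕ} (hr : 1 ≤ r) {R : V → ℝ}
    (hR : ∀ i, 0 < R i) {σ S : ℝ} (hσ : 0 < σ) (hσS : σ ≤ S)
    (ha1 : ∀ i, (∑ e, if u e = i ∨ v e = i then a e ^ 2 else 0) ≤ 2 * (R i * S) ^ 2)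
    (ha2 : ∀ e, a e ^ 2 ≤ 2 * (R (u e) * R (v e) * S) ^ 2)
    (hRp : ∀ i, R i ^ 2 * L * r * S ^ 2 ≤ 1 / 10 ^ 7 * σ ^ 2 * p)
    {M₀ M : Matrix V V ℝ} (hM₀ : M₀ᵀ = M₀) {Pr : EuclideanSpace ℝ V →ₗ[ℝ] EuclideanSpace ℝ V}
    (hM : SpectralGap (act M) Pr σ 0) {κ : Type*} [Fintype κ] (hκ : Fintype.card κ = r)
    (φ : EuclideanSpace ℝ V →ₗ[ℝ] (κ → ℝ)) (hφ : ∀ x, φ x = 0 → act M x = 0)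
    (hM₀M : ∀ x, ‖act M₀ x - act M x‖ ≤ σ / (200 * √r) * ‖x‖)
    {b : V → EuclideanSpace ℝ V} {c : V → ℝ}
    (hM₀e : ∀ i, act M₀ (EuclideanSpace.single i 1) = b i + c i • EuclideanSpace.single i (1 : ℝ))
    (hb : ∀ i, ‖b i‖ ≤ 101 / 100 * (R i * S)) (hc : ∀ i, |c i| ≤ 1 / 100 * σ) :
    bernP p (fun ω => ¬ ((∀ x, ‖act (M₀ + bernSum p (edgeMat u v a) ω) x - act M x‖ ≤
        σ / (100 * √r) * ‖x‖) ∧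
      ∀ P, SpectralGap (act (M₀ + bernSum p (edgeMat u v a) ω)) P (3 / 4 * σ) (1 / 4 * σ) →
        ∀ i, ‖act (M₀ + bernSum p (edgeMat u v a) ω) (P (EuclideanSpace.single i 1))‖ ≤
          13 / 10 * (R i * S))) ≤
      3 * (Fintype.card V : ℝ) ^ 2 * Real.exp (-L) := by
  have hr' : (1 : ℝ) ≤ r := by exact_mod_cast hr
  have hsr : 1 ≤ √(r : ℝ) := by rw [Real.one_le_sqrt]; exact hr'
  have hL0 : 0 ≤ L := by linarith
  set E := fun ω => bernSum p (edgeMat u v a) ω with hE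
  set T' : V → (β → Bool) → Matrix V V ℝ := fun i ω => M₀ + bernSum p (offMat u v a i) ω with hT'
  set B₁ : (β → Bool) → Prop := fun ω => ¬ ∀ x, ‖act (E ω) x‖ ≤ σ / (200 * √r) * ‖x‖ with hB₁
  set B₂ : V → (β → Bool) → Prop := fun i ω =>
    RowDeviates p L u v a i ((fun T => (spectralChoice r σ T).1) (T' i ω)) ω with hB₂
  have p1 : bernP p B₁ ≤ Fintype.card V * Real.exp (-L) :=
    bernP_edge_opNorm_gt_le hp h1 huv hL hr hσ hσS ha1 ha2 hRp
  have p2 : ∀ i, bernP p (B₂ i) ≤ Fintype.card V * (2 * Real.exp (-L)) := fun i =>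
    bernP_rowDeviates_le hp h1 hL0 i (fun T => (spectralChoice r σ T).1) M₀
  have p3 : bernP p (fun ω => B₁ ω ∨ ∃ i, B₂ i ω) ≤
      3 * (Fintype.card V : ℝ) ^ 2 * Real.exp (-L) := by
    refine (bernP_or_le hp.le h1 _ _).trans ?_
    have h2 : bernP p (fun ω => ∃ i, B₂ i ω) ≤
        Fintype.card V * (Fintype.card V * (2 * Real.exp (-L))) :=
      (bernP_exists_le hp.le h1 _).trans ((Finset.sum_le_sum fun i _ => p2 i).trans_eq
        (by rw [Finset.sum_const, Finset.card_univ, nsmul_eq_mul]))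
    have hcard : (Fintype.card V : ℝ) ≤ (Fintype.card V : ℝ) ^ 2 := by
      exact_mod_cast Nat.le_self_pow (by norm_num) _
    have := mul_le_mul_of_nonneg_right hcard (Real.exp_pos (-L)).le
    linarith
  refine le_trans (bernP_mono hp.le h1 fun ω hω => ?_) p3
  by_contra hcon
  push Not at hcon
  obtain ⟨hnB₁, hnB₂⟩ := hcon
  have hδ : σ / (200 * √r) ≤ 1 / 200 * σ := by
    rw [div_le_iff₀ (by positivity)]; nlinarith
  apply hω
  have hTM : ∀ x, ‖act (M₀ + E ω) x - act M x‖ ≤ σ / (100 * √r) * ‖x‖ := fun x => by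
    calc ‖act (M₀ + E ω) x - act M x‖ = ‖(act M₀ x - act M x) + act (E ω) x‖ := by
          rw [act_add]; congr 1; abel
      _ ≤ σ / (200 * √r) * ‖x‖ + σ / (200 * √r) * ‖x‖ :=
          (norm_add_le _ _).trans (add_le_add (hM₀M x) (hnB₁ x))
      _ = _ := by field_simp; ring
  refine ⟨hTM, fun P hP i => ?_⟩
  have hf : ∀ i, ‖rowVec p u v a i ω‖ ≤ 1 / 200 * σ := fun i => by
    rw [← act_edgeMat_single huv p i ω]
    refine (hnB₁ _).trans ?_
    simpa using hδ
  have hspec : ∀ i, IsSpectralChoice r σ (T' i ω) (spectralChoice r σ (T' i ω)) := fun i => by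
    apply spectralChoice_spec
    have hT't : (T' i ω)ᵀ = T' i ω := by
      simp only [hT', Matrix.transpose_add, hM₀, bernSum_transpose p (offMat_transpose i) ω]
    obtain ⟨w, J, h⟩ := exists_projSpan_spectralGap hT't hσ hM hκ φ hφ fun x => by
      have hsub := act_bernSum_sub_offMat (a := a) huv p i ω x
      have e1 : act (T' i ω) x - act M x = (act M₀ x - act M x) + act (E ω) x -
          ((inner ℝ (rowVec p u v a i ω) x : ℝ) • EuclideanSpace.single i (1 : ℝ) +
          (inner ℝ (EuclideanSpace.single i (1 : ℝ)) x : ℝ) • rowVec p u v a i ω) := by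
        rw [← hsub]; simp only [hT', act_add, hE]; abel
      rw [e1]
      have n1 : ‖(inner ℝ (rowVec p u v a i ω) x : ℝ) • EuclideanSpace.single i (1 : ℝ)‖ ≤
          1 / 200 * σ * ‖x‖ := by
        rw [norm_smul, PiLp.norm_single, norm_one, mul_one]
        refine (norm_inner_le_norm _ _).trans ?_
        have := hf i
        gcongr
      have n2 : ‖(inner ℝ (EuclideanSpace.single i (1 : ℝ)) x : ℝ) • rowVec p u v a i ω‖ ≤
          ‖x‖ * (1 / 200 * σ) := by
        rw [norm_smul]
        have h3 := norm_inner_le_norm (𝕜 := ℝ) (EuclideanSpace.single i (1 : ℝ)) x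
        rw [PiLp.norm_single, norm_one, one_mul] at h3
        exact mul_le_mul h3 (hf i) (norm_nonneg _) (norm_nonneg _)
      have n3 := hM₀M x
      have n4 := hnB₁ x
      have n5 := mul_le_mul_of_nonneg_right hδ (norm_nonneg x)
      refine (norm_sub_le _ _).trans ?_
      refine (add_le_add (norm_add_le _ _) (norm_add_le _ _)).trans ?_
      linarith
    exact ⟨(w, J), h⟩
  refine norm_apply_proj_le_of_leaveOneOut (fun i => EuclideanSpace.single i (1 : ℝ))
    (fun i => by simp) (act (M₀ + E ω)) P (fun i => act (T' i ω))
    (fun i => projSpan (spectralChoice r σ (T' i ω)).1 (spectralChoice r σ (T' i ω)).2)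
    b (fun i => rowVec p u v a i ω) c R hσ hσS hR hP (fun i => (hspec i).2.2) (fun i => ?_)
    (fun i => ?_) (fun i x => ?_) (fun i => by linarith [hf i]) hc hb ?_ i
  · rw [act_add, hM₀e, hE, act_edgeMat_single huv]
  · simp only [hT']
    rw [act_add, hM₀e, act_offMat_single, add_zero]
  · rw [← act_bernSum_sub_offMat huv p i ω x]
    simp only [hT', act_add, hE]; abel
  · intro i η τ hη hτ hQ
    exact norm_projSpan_rowVec_le hp hL hr hR hσ hσS ha1 ha2 hRp (hspec i).1 (hspec i).2.1
      (hnB₂ i) hη hτ hQ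

end NoisySpectralTruncation

section BinomialMode

lemma choose_mul_pow_le_succ {N k n : ℕ} (hkN : k ≤ N) (hn : n < k) :
    N.choose n * (k ^ n * (N - k) ^ (N - n)) ≤
      N.choose (n + 1) * (k ^ (n + 1) * (N - k) ^ (N - (n + 1))) := by
  have h1 := Nat.choose_succ_right_eq N n
  obtain ⟨j, hj⟩ : ∃ j, N - n = j + 1 := ⟨N - n - 1, by omega⟩
  have hj' : N - (n + 1) = j := by omega
  rw [hj] at h1 ⊢
  rw [hj']
  obtain ⟨l, hl⟩ : ∃ l, N = k + l := ⟨N - k, by omega⟩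
  have hlk : N - k = l := by omega
  rw [hlk]
  have h2 : l * (n + 1) ≤ (j + 1) * k := by
    have : j + 1 = k + l - n := by omega
    obtain ⟨i, hi⟩ : ∃ i, k = n + 1 + i := ⟨k - n - 1, by omega⟩
    have : j + 1 = 1 + i + l := by omega
    rw [this, hi]; nlinarith
  refine Nat.le_of_mul_le_mul_right ?_ (Nat.succ_pos n)
  calc _ = N.choose n * (k ^ n * l ^ j) * (l * (n + 1)) := by rw [pow_succ l, Nat.succ_eq_add_one]; ring
    _ ≤ N.choose n * (k ^ n * l ^ j) * ((j + 1) * k) := by gcongr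
    _ = (N.choose n * (j + 1)) * (k ^ (n + 1) * l ^ j) := by ring
    _ = _ := by rw [← h1]; simp only [Nat.succ_eq_add_one]; ring

lemma choose_mul_pow_succ_le {N k n : ℕ} (hkN : k ≤ N) (hn : k ≤ n) (hnN : n < N) :
    N.choose (n + 1) * (k ^ (n + 1) * (N - k) ^ (N - (n + 1))) ≤
      N.choose n * (k ^ n * (N - k) ^ (N - n)) := by
  have h1 := Nat.choose_succ_right_eq N n
  obtain ⟨j, hj⟩ : ∃ j, N - n = j + 1 := ⟨N - n - 1, by omega⟩
  have hj' : N - (n + 1) = j := by omega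
  rw [hj] at h1 ⊢
  rw [hj']
  obtain ⟨l, hl⟩ : ∃ l, N = k + l := ⟨N - k, by omega⟩
  have hlk : N - k = l := by omega
  rw [hlk]
  have h2 : (j + 1) * k ≤ l * (n + 1) := by
    have h3 : j + 1 ≤ l := by omega
    have h4 : k ≤ n + 1 := by omega
    gcongr
  refine Nat.le_of_mul_le_mul_right ?_ (Nat.succ_pos n)
  calc _ = (N.choose (n + 1) * (n + 1)) * (k ^ (n + 1) * l ^ j) := by
        simp only [Nat.succ_eq_add_one]; ring
    _ = N.choose n * (k ^ n * l ^ j) * ((j + 1) * k) := by rw [h1]; ring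
    _ ≤ N.choose n * (k ^ n * l ^ j) * (l * (n + 1)) := by gcongr
    _ = _ := by rw [pow_succ l]; simp only [Nat.succ_eq_add_one]; ring

lemma choose_mul_pow_le_mode {N k : ℕ} (hkN : k ≤ N) {n : ℕ} (hn : n ≤ N) :
    N.choose n * (k ^ n * (N - k) ^ (N - n)) ≤ N.choose k * (k ^ k * (N - k) ^ (N - k)) := by
  rcases le_total n k with h | h
  · induction h using Nat.decreasingInduction with
    | self => exact le_rfl
    | of_succ m hm ih => exact (choose_mul_pow_le_succ hkN hm).trans (ih (by omega))
  · induction n, h using Nat.le_induction with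
    | base => exact le_rfl
    | succ m hm ih => exact (choose_mul_pow_succ_le hkN hm (by omega)).trans (ih (by omega))

lemma one_le_mul_choose_mul_pow {N k : ℕ} (hN : 0 < N) (hkN : k ≤ N) :
    1 ≤ (N + 1 : ℝ) * (N.choose k * ((k / N : ℝ) ^ k * (1 - k / N : ℝ) ^ (N - k))) := by
  have hN' : (0 : ℝ) < N := by exact_mod_cast hN
  have h1 : N ^ N ≤ (N + 1) * (N.choose k * (k ^ k * (N - k) ^ (N - k))) := by
    have := add_pow k (N - k) N
    rw [Nat.add_sub_cancel' hkN] at this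
    calc N ^ N = ∑ m ∈ Finset.range (N + 1), k ^ m * (N - k) ^ (N - m) * N.choose m := this
      _ ≤ ∑ m ∈ Finset.range (N + 1), N.choose k * (k ^ k * (N - k) ^ (N - k)) := by
          refine Finset.sum_le_sum fun m hm => ?_
          rw [mul_comm]
          exact choose_mul_pow_le_mode hkN (by rw [Finset.mem_range] at hm; omega)
      _ = _ := by simp
  have h2 : (N : ℝ) ^ N ≤ (N + 1) * (N.choose k * (k ^ k * ((N : ℝ) - k) ^ (N - k))) := by
    have : ((N ^ N : ℕ) : ℝ) ≤ ((N + 1) * (N.choose k * (k ^ k * (N - k) ^ (N - k))) : ℕ) := by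
      exact_mod_cast h1
    push_cast [Nat.cast_sub hkN] at this
    exact this
  have h3 : (k / N : ℝ) ^ k * (1 - k / N : ℝ) ^ (N - k) =
      (k ^ k * ((N : ℝ) - k) ^ (N - k)) / N ^ N := by
    rw [one_sub_div hN'.ne', div_pow, div_pow, div_mul_div_comm, ← pow_add,
      Nat.add_sub_cancel' hkN]
  rw [h3, mul_div_assoc', mul_div_assoc', le_div_iff₀ (by positivity), one_mul]
  exact h2

end BinomialMode

section Sampling

set_option linter.unusedSectionVars false

variable {β : Type*} [Fintype β] [DecidableEq β]

/-- The number of successes. -/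
def successes (ω : β → Bool) : ℕ := (Finset.univ.filter fun e => ω e = true).card

lemma successes_le (ω : β → Bool) : successes ω ≤ Fintype.card β := Finset.card_le_univ _

lemma prod_bernWeight (p : ℝ) (ω : β → Bool) : ∏ e, bernWeight p (ω e) =
    p ^ successes ω * (1 - p) ^ (Fintype.card β - successes ω) := by
  unfold bernWeight successes
  rw [Finset.prod_ite, Finset.prod_const, Finset.prod_const, ← Finset.card_univ,
    ← Finset.card_sdiff_of_subset (Finset.subset_univ _)]
  congr 3
  ext e; simp

lemma card_successes_eq (k : ℕ) :
    (Finset.univ.filter fun ω : β → Bool => successes ω = k).card = (Fintype.card β).choose k := by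
  rw [← Finset.card_univ, ← Finset.card_powersetCard]
  refine Finset.card_nbij' (fun ω => Finset.univ.filter fun e => ω e = true)
    (fun s e => decide (e ∈ s)) ?_ ?_ ?_ ?_
  · intro ω hω
    rw [Finset.mem_coe, Finset.mem_filter] at hω
    simpa [Finset.mem_powersetCard, successes] using hω.2
  · intro s hs
    rw [Finset.mem_coe, Finset.mem_powersetCard] at hs
    rw [Finset.mem_coe, Finset.mem_filter]
    simpa [successes] using hs.2
  · intro ω _; ext e; simp
  · intro s _; ext e; simp

lemma bernP_successes_and (p : ℝ) (k : ℕ) (A : (β → Bool) → Prop) [DecidablePred A] :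
    bernP p (fun ω => successes ω = k ∧ A ω) =
      (Finset.univ.filter fun ω => successes ω = k ∧ A ω).card *
        (p ^ k * (1 - p) ^ (Fintype.card β - k)) := by
  rw [bernP, bernE]
  simp only [mul_ite, mul_one, mul_zero]
  rw [← Finset.sum_filter, Finset.sum_congr (g := fun _ => p ^ k * (1 - p) ^ (Fintype.card β - k))
    rfl fun ω hω => by rw [prod_bernWeight, (Finset.mem_filter.1 hω).2.1],
    Finset.sum_const, nsmul_eq_mul]

/-- The proportion of bad configurations among those with `k` successes is controlled by the
probability in the Bernoulli model. -/
lemma card_bad_le (hβ : 0 < Fintype.card β) {k : ℕ} (hk : k ≤ Fintype.card β)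
    (A : (β → Bool) → Prop) [DecidablePred A] {ε : ℝ}
    (hε : bernP ((k : ℝ) / Fintype.card β) (fun ω => successes ω = k ∧ A ω) ≤ ε) :
    ((Finset.univ.filter fun ω : β → Bool => successes ω = k ∧ A ω).card : ℝ) ≤
      (Fintype.card β + 1) * ε * (Finset.univ.filter fun ω : β → Bool => successes ω = k).card := by
  have hm := one_le_mul_choose_mul_pow hβ hk
  rw [bernP_successes_and] at hε
  rw [card_successes_eq]
  set w := ((k : ℝ) / Fintype.card β) ^ k * (1 - (k : ℝ) / Fintype.card β) ^ (Fintype.card β - k)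
    with hw
  have hN' : (0 : ℝ) < Fintype.card β := by exact_mod_cast hβ
  have hk' : (k : ℝ) ≤ Fintype.card β := by exact_mod_cast hk
  have hw0 : 0 ≤ w := by
    have : 0 ≤ 1 - (k : ℝ) / Fintype.card β := by
      rw [sub_nonneg, div_le_one hN']; exact hk'
    positivity
  set x := ((Finset.univ.filter fun ω : β → Bool => successes ω = k ∧ A ω).card : ℝ)
  set C := ((Fintype.card β).choose k : ℝ)
  calc x ≤ x * ((Fintype.card β + 1) * (C * w)) := le_mul_of_one_le_right (by positivity) hm
    _ = (Fintype.card β + 1) * C * (x * w) := by ring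
    _ ≤ (Fintype.card β + 1) * C * ε := by gcongr
    _ = _ := by ring

lemma exists_perm_of_successes_eq {ω₁ ω₂ : β → Bool} (h : successes ω₁ = successes ω₂) :
    ∃ τ : Equiv.Perm β, ∀ e, ω₂ (τ e) = ω₁ e := by
  have hc : Fintype.card {e // ω₁ e = true} = Fintype.card {e // ω₂ e = true} := by
    simpa [Fintype.card_subtype, successes] using h
  let f := Fintype.equivOfCardEq hc
  refine ⟨f.extendSubtype, fun e => ?_⟩
  by_cases he : ω₁ e = true
  · rw [he]; exact f.extendSubtype_mem e he
  · have := f.extendSubtype_not_mem e he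
    simp only [Bool.not_eq_true] at this he
    rw [this, he]

open Classical in
/-- Passage from an exchangeable random configuration to independent Bernoulli variables. -/
theorem sum_bad_le {X κ : Type*} [Fintype X] (g : X → ℝ) (hg : ∀ x, 0 ≤ g x) (hg1 : ∑ x, g x = 1)
    (c : X → κ) (pat : X → β → Bool)
    (hinv : ∀ τ : Equiv.Perm β, ∃ s : Equiv.Perm X, ∀ x, g (s x) = g x ∧ c (s x) = c x ∧
      ∀ e, pat (s x) (τ e) = pat x e)
    (hβ : 0 < Fintype.card β) (Bad : κ → (β → Bool) → Prop) {ε : ℝ}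
    (hε : ∀ i k, k ≤ Fintype.card β →
      bernP ((k : ℝ) / Fintype.card β) (fun ω => successes ω = k ∧ Bad i ω) ≤ ε) :
    ∑ x ∈ Finset.univ.filter (fun x => Bad (c x) (pat x)), g x ≤ (Fintype.card β + 1) * ε := by
  set m : κ → (β → Bool) → ℝ := fun i ω =>
    ∑ x ∈ Finset.univ.filter (fun x => c x = i ∧ pat x = ω), g x with hm
  have hm0 : ∀ i ω, 0 ≤ m i ω := fun i ω => Finset.sum_nonneg fun x _ => hg x
  have hmeq : ∀ i ω₁ ω₂, successes ω₁ = successes ω₂ → m i ω₁ = m i ω₂ := fun i ω₁ ω₂ h => by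
    obtain ⟨τ, hτ⟩ := exists_perm_of_successes_eq h
    obtain ⟨s, hs⟩ := hinv τ
    refine Finset.sum_equiv s (fun x => ?_) fun x _ => ((hs x).1).symm
    simp only [Finset.mem_filter, Finset.mem_univ, true_and, (hs x).2.1]
    refine and_congr_right fun _ => ⟨fun hx => ?_, fun hx => ?_⟩
    · ext e
      obtain ⟨e', rfl⟩ := τ.surjective e
      rw [(hs x).2.2, hx, hτ]
    · ext e
      rw [← (hs x).2.2, hx, hτ]
  have key : ∀ i, ∑ ω ∈ Finset.univ.filter (fun ω => Bad i ω), m i ω ≤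
      (Fintype.card β + 1) * ε * ∑ ω, m i ω := fun i => by
    have hmaps : ∀ s : Finset (β → Bool), ∀ ω ∈ s, successes ω ∈ Finset.range (Fintype.card β + 1) :=
      fun s ω _ => Finset.mem_range.2 (Nat.lt_succ_of_le (successes_le ω))
    rw [← Finset.sum_fiberwise_of_maps_to (hmaps _), ← Finset.sum_fiberwise_of_maps_to (hmaps _),
      Finset.mul_sum]
    refine Finset.sum_le_sum fun k hk => ?_
    have hk' : k ≤ Fintype.card β := by rw [Finset.mem_range] at hk; omega
    obtain ⟨s, -, hs⟩ := Finset.exists_subset_card_eq (s := (Finset.univ : Finset β)) hk'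
    set ω₀ : β → Bool := fun e => decide (e ∈ s) with hω₀
    have hω₀s : successes ω₀ = k := by simp [hω₀, successes, hs]
    have e1 : ∀ ω ∈ (Finset.univ.filter (fun ω => Bad i ω)).filter (fun ω => successes ω = k),
        m i ω = m i ω₀ := fun ω hω => hmeq _ _ _ (by rw [hω₀s, (Finset.mem_filter.1 hω).2])
    have e2 : ∀ ω ∈ Finset.univ.filter (fun ω : β → Bool => successes ω = k),
        m i ω = m i ω₀ := fun ω hω => hmeq _ _ _ (by rw [hω₀s, (Finset.mem_filter.1 hω).2])
    rw [Finset.sum_congr rfl e1, Finset.sum_congr rfl e2, Finset.sum_const, Finset.sum_const,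
      nsmul_eq_mul, nsmul_eq_mul, ← mul_assoc]
    refine mul_le_mul_of_nonneg_right ?_ (hm0 _ _)
    refine le_trans (le_of_eq ?_) (card_bad_le hβ hk' (Bad i) (hε i k hk'))
    rw [Finset.filter_filter]
    congr 3
    ext ω; exact and_comm
  have tot : ∀ A : κ → (β → Bool) → Prop, ∑ x ∈ Finset.univ.filter (fun x => A (c x) (pat x)), g x =
      ∑ i ∈ Finset.univ.image c, ∑ ω ∈ Finset.univ.filter (fun ω => A i ω), m i ω := fun A => by
    rw [← Finset.sum_fiberwise_of_maps_to (g := c) (t := Finset.univ.image c) (by simp)]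
    refine Finset.sum_congr rfl fun i _ => ?_
    rw [← Finset.sum_fiberwise_of_maps_to (g := pat) (t := Finset.univ.filter (fun ω => A i ω))]
    · refine Finset.sum_congr rfl fun ω hω => ?_
      rw [Finset.filter_filter, Finset.filter_filter, hm]
      refine Finset.sum_congr ?_ fun _ _ => rfl
      ext x
      simp only [Finset.mem_filter, Finset.mem_univ, true_and] at hω ⊢
      constructor
      · exact fun h => ⟨h.2.1, h.2.2⟩
      · rintro ⟨rfl, rfl⟩; exact ⟨hω, rfl, rfl⟩
    · intro x hx
      simp only [Finset.mem_filter, Finset.mem_univ, true_and] at hx ⊢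
      rw [← hx.2]; exact hx.1
  have t1 := tot (fun _ _ => True)
  simp only [Finset.filter_true] at t1
  rw [tot Bad]
  calc _ ≤ ∑ i ∈ Finset.univ.image c, (Fintype.card β + 1) * ε * ∑ ω, m i ω :=
        Finset.sum_le_sum fun i _ => key i
    _ = _ := by rw [← Finset.mul_sum, ← t1, hg1, mul_one]

variable {ι : Type} [Fintype ι] [Nonempty ι] [MeasurableSpace ι] [MeasurableSingletonClass ι]

lemma IsUniformSampling.isProbabilityMeasure {P : Measure (Set ι)} (hP : IsUniformSampling P) :
    IsProbabilityMeasure P := by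
  cases hP with
  | subset m hm =>
    refine isProbabilityMeasure_uniformOn (Set.toFinite _) ?_
    obtain ⟨s, -, hs⟩ := Finset.exists_subset_card_eq (s := (Finset.univ : Finset ι)) hm
    exact ⟨s, by simpa using hs⟩
  | draws n =>
    have : IsProbabilityMeasure (uniformOn Set.univ : Measure ι) :=
      isProbabilityMeasure_uniformOn Set.finite_univ Set.univ_nonempty
    exact Measure.isProbabilityMeasure_map (Measurable.of_discrete).aemeasurable
  | bernoulli p => infer_instance

lemma IsUniformSampling.real_singleton_image {P : Measure (Set ι)} (hP : IsUniformSampling P)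
    (s : Equiv.Perm ι) (Ω : Set ι) : P.real {s '' Ω} = P.real {Ω} := by
  cases hP with
  | subset m hm =>
    have : (s '' Ω).ncard = Ω.ncard := Set.ncard_image_of_injective _ s.injective
    simp only [Measure.real, uniformOn, cond_apply (Set.toFinite _).measurableSet]
    congr 2
    by_cases h : Ω.ncard = m
    · rw [Set.inter_eq_self_of_subset_right, Set.inter_eq_self_of_subset_right,
        Measure.count_singleton, Measure.count_singleton]
      · simpa using h
      · simpa [this] using h
    · rw [Set.inter_singleton_eq_empty.2, Set.inter_singleton_eq_empty.2]
      · simpa using h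
      · simpa [this] using h
  | draws n =>
    have hprob : IsProbabilityMeasure (uniformOn Set.univ : Measure ι) :=
      isProbabilityMeasure_uniformOn Set.finite_univ Set.univ_nonempty
    set μ : Measure ι := uniformOn Set.univ with hμ
    have hpt : MeasurePreserving s μ μ := by
      refine ⟨Measurable.of_discrete, ?_⟩
      refine Measure.ext_of_singleton fun x => ?_
      rw [Measure.map_apply Measurable.of_discrete (measurableSet_singleton _), hμ,
        uniformOn_univ, uniformOn_univ]
      congr 1
      rw [← Equiv.image_symm_eq_preimage, Set.image_singleton, Measure.count_singleton,
        Measure.count_singleton]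
    have hpi : MeasurePreserving (fun (ω : Fin n → ι) i => s (ω i)) (Measure.pi fun _ => μ)
      (Measure.pi fun _ => μ) := measurePreserving_pi _ _ fun _ => hpt
    have hms : ∀ A : Set (Set ι), MeasurableSet A := fun A => (Set.toFinite A).measurableSet
    simp only [Measure.real]
    congr 1
    rw [Measure.map_apply Measurable.of_discrete (hms _), Measure.map_apply Measurable.of_discrete
      (hms _)]
    rw [← hpi.measure_preimage (Set.toFinite _).measurableSet.nullMeasurableSet]
    congr 1
    ext ω
    simp only [Set.mem_preimage, Set.mem_singleton_iff]
    rw [show (fun i => s (ω i)) = s ∘ ω from rfl, Set.range_comp]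
    exact s.injective.image_injective.eq_iff
  | bernoulli p =>
    rw [setBernoulli_real_singleton p (Set.subset_univ _) Set.finite_univ,
      setBernoulli_real_singleton p (Set.subset_univ _) Set.finite_univ]
    have : (s '' Ω).ncard = Ω.ncard := Set.ncard_image_of_injective _ s.injective
    rw [this, Set.ncard_sdiff (Set.subset_univ _), Set.ncard_sdiff (Set.subset_univ _), this]

open Classical in
/-- Good events for a uniformly sampled set have large probability if the bad events have small
probability in the Bernoulli model. -/
theorem IsUniformSampling.le_real_of_bernP {P : Measure (Set ι)} (hP : IsUniformSampling P)
    {κ : Type*} (c : Set ι → κ) (pat : Set ι → β → Bool)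
    (hinv : ∀ τ : Equiv.Perm β, ∃ s : Equiv.Perm ι, ∀ Ω, c (s '' Ω) = c Ω ∧
      ∀ e, pat (s '' Ω) (τ e) = pat Ω e)
    (hβ : 0 < Fintype.card β) (Bad : κ → (β → Bool) → Prop) {ε : ℝ}
    (hε : ∀ i k, k ≤ Fintype.card β →
      bernP ((k : ℝ) / Fintype.card β) (fun ω => successes ω = k ∧ Bad i ω) ≤ ε)
    (Good : Set (Set ι)) (hGood : ∀ Ω, ¬ Bad (c Ω) (pat Ω) → Ω ∈ Good) :
    1 - (Fintype.card β + 1) * ε ≤ P.real Good := by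
  have := hP.isProbabilityMeasure
  have hsum : ∀ A : Set (Set ι), ∑ Ω ∈ Finset.univ.filter (· ∈ A), P.real {Ω} = P.real A := fun A => by
    rw [sum_measureReal_singleton]; congr 1; ext; simp
  have h1 : ∑ Ω, P.real {Ω} = 1 := by
    rw [← probReal_univ (μ := P), ← hsum]; simp
  have hb := sum_bad_le (fun Ω => P.real {Ω}) (fun _ => measureReal_nonneg) h1 c pat (fun τ => by
    obtain ⟨s, hs⟩ := hinv τ
    exact ⟨Equiv.Set.congr s, fun Ω => ⟨hP.real_singleton_image s Ω, hs Ω⟩⟩) hβ Bad hε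
  have hle : P.real Goodᶜ ≤ (Fintype.card β + 1) * ε := by
    rw [← hsum]
    refine le_trans (Finset.sum_le_sum_of_subset_of_nonneg (fun Ω hΩ => ?_)
      fun _ _ _ => measureReal_nonneg) hb
    simp only [Finset.mem_filter, Finset.mem_univ, true_and, Set.mem_compl_iff] at hΩ ⊢
    by_contra h
    exact hΩ (hGood Ω h)
  rw [probReal_compl_eq_one_sub (Set.toFinite _).measurableSet] at hle
  linarith

end Sampling

section Norms

set_option linter.unusedSectionVars false

variable {m n l : Type*} [Fintype m] [Fintype n] [Fintype l] [DecidableEq m] [DecidableEq n]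
  [DecidableEq l]

lemma norm_act_of_orthonormal {X : Matrix m n ℝ} (hX : Xᵀ * X = 1) (c : EuclideanSpace ℝ n) :
    ‖act X c‖ = ‖c‖ := by
  have h : ‖act X c‖ ^ 2 = ‖c‖ ^ 2 := by
    rw [← real_inner_self_eq_norm_sq, inner_act, ← act_mul, hX, act_one, real_inner_self_eq_norm_sq]
  exact (sq_eq_sq₀ (norm_nonneg _) (norm_nonneg _)).1 h

lemma norm_act_transpose_le {A : Matrix m n ℝ} {c : ℝ} (hc : 0 ≤ c)
    (h : ∀ x, ‖act A x‖ ≤ c * ‖x‖) (y : EuclideanSpace ℝ m) : ‖act Aᵀ y‖ ≤ c * ‖y‖ := by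
  rcases (norm_nonneg (act Aᵀ y)).eq_or_lt with h0 | h0
  · rw [← h0]; positivity
  have h1 : ‖act Aᵀ y‖ ^ 2 ≤ (c * ‖y‖) * ‖act Aᵀ y‖ := by
    rw [← real_inner_self_eq_norm_sq, inner_act, Matrix.transpose_transpose]
    calc inner ℝ y (act A (act Aᵀ y)) ≤ ‖y‖ * ‖act A (act Aᵀ y)‖ := real_inner_le_norm _ _
      _ ≤ ‖y‖ * (c * ‖act Aᵀ y‖) := by gcongr; exact h _
      _ = _ := by ring
  rw [sq] at h1
  exact le_of_mul_le_mul_right h1 h0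

lemma norm_act_transpose_of_orthonormal_le {X : Matrix m n ℝ} (hX : Xᵀ * X = 1)
    (y : EuclideanSpace ℝ m) : ‖act Xᵀ y‖ ≤ ‖y‖ := by
  simpa using norm_act_transpose_le (A := X) zero_le_one
    (fun x => by rw [norm_act_of_orthonormal hX, one_mul]) y

lemma norm_act_diagonal_le {s : n → ℝ} {c : ℝ} (x : EuclideanSpace ℝ n)
    (h : ∀ i, x i ≠ 0 → |s i| ≤ c) (hc : 0 ≤ c) : ‖act (Matrix.diagonal s) x‖ ≤ c * ‖x‖ := by
  refine le_of_abs_le (abs_le_of_sq_le_sq ?_ (by positivity))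
  rw [mul_pow, EuclideanSpace.norm_sq_eq, EuclideanSpace.norm_sq_eq, Finset.mul_sum]
  refine Finset.sum_le_sum fun i _ => ?_
  have : act (Matrix.diagonal s) x i = s i * x i := by simp [act_apply, Matrix.diagonal_apply]
  rw [this, norm_mul, mul_pow, Real.norm_eq_abs (s i)]
  by_cases hx : x i = 0
  · simp [hx]
  · have := h i hx
    gcongr

lemma le_norm_act_diagonal {s : n → ℝ} {c : ℝ} (x : EuclideanSpace ℝ n)
    (h : ∀ i, x i ≠ 0 → c ≤ |s i|) (hc : 0 ≤ c) : c * ‖x‖ ≤ ‖act (Matrix.diagonal s) x‖ := by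
  refine le_of_abs_le (abs_le_of_sq_le_sq ?_ (by positivity))
  rw [mul_pow, EuclideanSpace.norm_sq_eq, EuclideanSpace.norm_sq_eq, Finset.mul_sum]
  refine Finset.sum_le_sum fun i _ => ?_
  have : act (Matrix.diagonal s) x i = s i * x i := by simp [act_apply, Matrix.diagonal_apply]
  rw [this, norm_mul, mul_pow, Real.norm_eq_abs (s i)]
  by_cases hx : x i = 0
  · simp [hx]
  · have := h i hx
    gcongr

lemma norm_act_le_specNorm {a b : ℕ} (A : Matrix (Fin a) (Fin b) ℝ)
    (x : EuclideanSpace ℝ (Fin b)) : ‖act A x‖ ≤ specNorm A * ‖x‖ :=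
  Matrix.l2_opNorm_mulVec A x

lemma specNorm_nonneg {a b : ℕ} (A : Matrix (Fin a) (Fin b) ℝ) : 0 ≤ specNorm A :=
  letI : NormedAddCommGroup (Matrix (Fin a) (Fin b) ℝ) := Matrix.instL2OpNormedAddCommGroup
  norm_nonneg A

lemma rowNorm_eq {a b : ℕ} (A : Matrix (Fin a) (Fin b) ℝ) (i : Fin a) :
    rowNorm A i = ‖act Aᵀ (EuclideanSpace.single i 1)‖ := by
  unfold rowNorm
  congr 1
  ext j
  rw [act_single]; rfl

lemma rowNorm_sq {a b : ℕ} (A : Matrix (Fin a) (Fin b) ℝ) (i : Fin a) :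
    rowNorm A i ^ 2 = ∑ j, A i j ^ 2 := by
  rw [rowNorm, EuclideanSpace.norm_sq_eq]; simp

lemma frobNorm_sq {a b : ℕ} (A : Matrix (Fin a) (Fin b) ℝ) :
    frobNorm A ^ 2 = (Aᵀ * A).trace := by
  have h : frobNorm A = (∑ i, ∑ j, ‖A i j‖ ^ (2 : ℝ)) ^ (1 / 2 : ℝ) := Matrix.frobenius_norm_def A
  have h0 : 0 ≤ ∑ i, ∑ j, ‖A i j‖ ^ (2 : ℝ) :=
    Finset.sum_nonneg fun i _ => Finset.sum_nonneg fun j _ => by positivity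
  rw [h, ← Real.rpow_natCast, ← Real.rpow_mul h0]
  simp only [Matrix.trace, Matrix.diag, Matrix.mul_apply, Matrix.transpose_apply]
  rw [Finset.sum_comm]
  norm_num [sq]

lemma frobNorm_le_of_rank {a b r : ℕ} {A : Matrix (Fin a) (Fin b) ℝ} (hr : A.rank ≤ r) {c : ℝ}
    (hc : 0 ≤ c) (h : ∀ x, ‖act A x‖ ≤ c * ‖x‖) : frobNorm A ≤ √r * c := by
  have hH : (Aᵀ * A).IsHermitian := by
    rw [Matrix.IsHermitian, Matrix.conjTranspose_eq_transpose_of_trivial, Matrix.transpose_mul,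
      Matrix.transpose_transpose]
  have hev : ∀ l, hH.eigenvalues l ≤ c ^ 2 := fun l => by
    have h1 : act (Aᵀ * A) (hH.eigenvectorBasis l) = hH.eigenvalues l • hH.eigenvectorBasis l := by
      ext j
      have := congrFun (hH.mulVec_eigenvectorBasis l) j
      simpa [Matrix.toLpLin_apply] using this
    have hn : ‖hH.eigenvectorBasis l‖ = 1 := hH.eigenvectorBasis.orthonormal.1 l
    have h2 : ‖act A (hH.eigenvectorBasis l)‖ ^ 2 = hH.eigenvalues l := by
      rw [← real_inner_self_eq_norm_sq, inner_act, ← act_mul, h1, inner_smul_right,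
        real_inner_self_eq_norm_sq, hn]; ring
    rw [← h2]
    have := h (hH.eigenvectorBasis l)
    rw [hn, mul_one] at this
    gcongr
  have hsq : frobNorm A ^ 2 ≤ (√r * c) ^ 2 := by
    rw [frobNorm_sq, hH.trace_eq_sum_eigenvalues, mul_pow, Real.sq_sqrt (by positivity)]
    have hcard := hH.rank_eq_card_non_zero_eigs
    rw [Matrix.rank_transpose_mul_self, Fintype.card_subtype] at hcard
    calc ∑ i, (hH.eigenvalues i : ℝ) = ∑ i ∈ Finset.univ.filter (fun i => hH.eigenvalues i ≠ 0),
          hH.eigenvalues i := by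
          rw [Finset.sum_filter_ne_zero]
      _ ≤ ∑ i ∈ Finset.univ.filter (fun i => hH.eigenvalues i ≠ 0), c ^ 2 :=
          Finset.sum_le_sum fun i _ => hev i
      _ = A.rank * c ^ 2 := by rw [Finset.sum_const, nsmul_eq_mul, ← hcard]
      _ ≤ r * c ^ 2 := by
          have : (A.rank : ℝ) ≤ r := by exact_mod_cast hr
          gcongr
  exact le_of_abs_le (abs_le_of_sq_le_sq hsq (by positivity))

end Norms

section SmallestSingularValue

variable {d₁ d₂ k : ℕ}

lemma finrank_range_act (M : Matrix (Fin d₁) (Fin d₂) ℝ) :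
    Module.finrank ℝ (LinearMap.range (act M)) = M.rank := by
  rw [act, Matrix.toEuclideanLin_eq_toLin_orthonormal, ← Matrix.rank_eq_finrank_range_toLin]

lemma sigmaMin_pos {M : Matrix (Fin d₁) (Fin d₂) ℝ} (hk : 1 ≤ k) (hr : M.rank = k) :
    0 < sigmaMin M := by
  rw [sigmaMin, LinearMap.singularValues_pos_iff_lt_finrank_range, finrank_range_act]
  omega

lemma sigmaMin_le {M : Matrix (Fin d₁) (Fin d₂) ℝ} (hr : M.rank = k)
    {X : Matrix (Fin d₁) (Fin k) ℝ} {s : Fin k → ℝ} {Y : Matrix (Fin d₂) (Fin k) ℝ}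
    (hX : Xᵀ * X = 1) (hY : Yᵀ * Y = 1) (hs : ∀ i, 0 < s i)
    (hM : M = X * Matrix.diagonal s * Yᵀ) (l : Fin k) : sigmaMin M ≤ s l := by
  set T := act M with hT
  set y := act Y (EuclideanSpace.single l 1) with hy
  have hyn : ‖y‖ = 1 := by rw [hy, norm_act_of_orthonormal hY]; simp
  have hMM : Mᵀ * M * Y = Y * Matrix.diagonal (fun i => s i ^ 2) := by
    rw [hM, Matrix.transpose_mul, Matrix.transpose_mul, Matrix.transpose_transpose,
      Matrix.diagonal_transpose]
    calc _ = Y * Matrix.diagonal s * (Xᵀ * X) * Matrix.diagonal s * (Yᵀ * Y) := by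
          simp only [Matrix.mul_assoc]
      _ = _ := by
          rw [hX, hY, Matrix.mul_one, Matrix.mul_one, Matrix.mul_assoc, Matrix.diagonal_mul_diagonal]
          simp only [sq]
  have hTy : ∀ z, inner ℝ (act (Mᵀ * M) y) z = s l ^ 2 * inner ℝ y z := fun z => by
    rw [hy, ← act_mul, hMM, act_mul]
    have : act (Matrix.diagonal fun i => s i ^ 2) (EuclideanSpace.single l 1) =
        s l ^ 2 • EuclideanSpace.single l (1 : ℝ) := by
      ext i
      rw [act_single]
      by_cases h : i = l <;> simp [h]
    rw [this, map_smul, inner_smul_left]; simp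
  set b := T.isSymmetric_adjoint_comp_self.eigenvectorBasis rfl with hb
  have hex : ∃ j, inner ℝ y (b j) ≠ (0 : ℝ) := by
    by_contra! h
    have := b.sum_sq_norm_inner_left y
    simp [h, hyn] at this
  obtain ⟨j, hj⟩ := hex
  have hadj : ∀ x z, inner ℝ ((LinearMap.adjoint T ∘ₗ T) x) z = (inner ℝ (act (Mᵀ * M) x) z : ℝ) :=
    fun x z => by
      rw [LinearMap.comp_apply, LinearMap.adjoint_inner_left, act_mul, inner_act Mᵀ,
        Matrix.transpose_transpose]
  have hlam : T.isSymmetric_adjoint_comp_self.eigenvalues rfl j = s l ^ 2 := by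
    have h1 := T.isSymmetric_adjoint_comp_self y (b j)
    rw [hadj, hTy, hb, LinearMap.IsSymmetric.apply_eigenvectorBasis, inner_smul_right] at h1
    exact (mul_right_cancel₀ hj h1).symm
  have hsj : T.singularValues j = s l := by
    rw [LinearMap.singularValues_fin T rfl, hlam, Real.sqrt_sq (hs l).le]
  have hjr : (j : ℕ) < M.rank := by
    rw [← finrank_range_act, ← LinearMap.singularValues_pos_iff_lt_finrank_range, ← hT, hsj]
    exact hs l
  rw [← hsj]
  exact T.singularValues_antitone (by omega)

lemma svd_le_specNorm {M : Matrix (Fin d₁) (Fin d₂) ℝ}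
    {X : Matrix (Fin d₁) (Fin k) ℝ} {s : Fin k → ℝ} {Y : Matrix (Fin d₂) (Fin k) ℝ}
    (hX : Xᵀ * X = 1) (hY : Yᵀ * Y = 1) (hs : ∀ i, 0 < s i)
    (hM : M = X * Matrix.diagonal s * Yᵀ) (l : Fin k) : s l ≤ specNorm M := by
  have h := norm_act_le_specNorm M (act Y (EuclideanSpace.single l 1))
  rw [norm_act_of_orthonormal hY, hM, ← act_mul, Matrix.mul_assoc, hY, Matrix.mul_one, act_mul,
    norm_act_of_orthonormal hX] at h
  have h2 := le_norm_act_diagonal (s := s) (c := s l) (EuclideanSpace.single l 1)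
    (fun i hi => by
      have : i = l := by
        by_contra hne; simp [hne] at hi
      rw [this]; exact le_abs_self _) (hs l).le
  rw [← hM] at h
  simp only [PiLp.norm_single, norm_one, mul_one] at h h2
  linarith

lemma coherence_rowNorm_sq_le {d k : ℕ} (hk : 1 ≤ k) {W : Matrix (Fin d) (Fin k) ℝ} {μ : ℝ}
    (h : coherence W ≤ μ) (i : Fin d) : rowNorm W i ^ 2 ≤ μ * k / d := by
  have hd : 0 < d := i.pos
  have hk' : (0 : ℝ) < k := by exact_mod_cast hk
  have hd' : (0 : ℝ) < d := by exact_mod_cast hd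
  have h1 : rowNorm W i ^ 2 ≤ ⨆ i, rowNorm W i ^ 2 :=
    le_ciSup (f := fun i => rowNorm W i ^ 2) (Set.finite_range _).bddAbove i
  rw [coherence, div_mul_eq_mul_div, div_le_iff₀ hk'] at h
  rw [le_div_iff₀ hd']
  nlinarith

lemma one_le_of_coherence_le {d k : ℕ} (hk : 1 ≤ k) {W : Matrix (Fin d) (Fin k) ℝ}
    (hW : Wᵀ * W = 1) {μ : ℝ} (h : coherence W ≤ μ) : 1 ≤ μ := by
  have hk' : (0 : ℝ) < k := by exact_mod_cast hk
  have hsum : ∑ i, rowNorm W i ^ 2 = k := by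
    have : (Wᵀ * W).trace = k := by rw [hW]; simp
    rw [← this]
    simp only [rowNorm_sq, Matrix.trace, Matrix.diag, Matrix.mul_apply, Matrix.transpose_apply]
    rw [Finset.sum_comm]
    simp [sq]
  have hd : 0 < d := by
    rcases Nat.eq_zero_or_pos d with rfl | h
    · rw [Finset.univ_eq_empty, Finset.sum_empty] at hsum; linarith
    · exact h
  have hd' : (0 : ℝ) < d := by exact_mod_cast hd
  have h2 : ∑ i, rowNorm W i ^ 2 ≤ ∑ _i : Fin d, μ * k / d :=
    Finset.sum_le_sum fun i _ => coherence_rowNorm_sq_le hk h i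
  rw [hsum, Finset.sum_const, Finset.card_univ, Fintype.card_fin, nsmul_eq_mul,
    mul_div_cancel₀ _ hd'.ne'] at h2
  nlinarith

end SmallestSingularValue

section SingularValuePerturbation

variable {d₁ d₂ k n : ℕ}

/-- Lower bound for the singular values of a perturbation of a matrix of rank `k`. -/
lemma sub_le_of_svd_perturbation {M T : Matrix (Fin d₁) (Fin d₂) ℝ}
    {XM : Matrix (Fin d₁) (Fin k) ℝ} {sM : Fin k → ℝ} {YM : Matrix (Fin d₂) (Fin k) ℝ}
    (hXM : XMᵀ * XM = 1) (hYM : YMᵀ * YM = 1) (hM : M = XM * Matrix.diagonal sM * YMᵀ)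
    {X : Matrix (Fin d₁) (Fin n) ℝ} {s : Fin n → ℝ} {Y : Matrix (Fin d₂) (Fin n) ℝ}
    (hX : Xᵀ * X = 1) (hY : Yᵀ * Y = 1) (hs : ∀ i, 0 ≤ s i) (hT : T = X * Matrix.diagonal s * Yᵀ)
    {σ δ B : ℝ} (hσ : 0 < σ) (hsM : ∀ i, σ ≤ sM i)
    (hTM : ∀ x, ‖act T x - act M x‖ ≤ δ * ‖x‖) {j : ℕ} (hj : j < k) (hB0 : 0 ≤ B)
    (hB : ∀ l : Fin n, j ≤ l → s l ≤ B) : σ - δ ≤ B := by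
  let f : EuclideanSpace ℝ (Fin k) →ₗ[ℝ] (Fin j → ℝ) :=
    { toFun := fun c i => if h : (i : ℕ) < n then act (Yᵀ * YM) c ⟨i, h⟩ else 0
      map_add' := fun x y => by
        ext i; simp only [Pi.add_apply]; split_ifs <;> simp
      map_smul' := fun c x => by
        ext i; simp only [Pi.smul_apply]; split_ifs <;> simp }
  have hker := LinearMap.ker_ne_bot_of_finrank_lt (f := f) (by simpa using hj)
  obtain ⟨c, hc, hc0⟩ := (Submodule.ne_bot_iff _).1 hker
  have hw : ∀ i : Fin n, (i : ℕ) < j → act (Yᵀ * YM) c i = 0 := fun i hi => by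
    have := congrFun (LinearMap.mem_ker.1 hc) ⟨i, hi⟩
    simpa [f] using this
  have hcn : 0 < ‖c‖ := norm_pos_iff.2 hc0
  have h1 : ‖act T (act YM c)‖ ≤ B * ‖c‖ := by
    rw [hT, act_mul, act_mul, norm_act_of_orthonormal hX, ← act_mul Yᵀ]
    calc _ ≤ B * ‖act (Yᵀ * YM) c‖ := norm_act_diagonal_le _ (fun i hi => by
            rw [abs_of_nonneg (hs i)]
            refine hB i ?_
            by_contra! hlt
            exact hi (hw i hlt)) hB0
      _ ≤ B * ‖c‖ := by
          gcongr
          rw [act_mul]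
          exact (norm_act_transpose_of_orthonormal_le hY _).trans_eq (norm_act_of_orthonormal hYM c)
  have h2 : σ * ‖c‖ ≤ ‖act M (act YM c)‖ := by
    rw [hM, ← act_mul, Matrix.mul_assoc, hYM, Matrix.mul_one, act_mul, norm_act_of_orthonormal hXM]
    exact le_norm_act_diagonal _ (fun i _ => (hsM i).trans (le_abs_self _)) hσ.le
  have h3 := hTM (act YM c)
  rw [norm_act_of_orthonormal hYM] at h3
  have h4 := norm_sub_norm_le (act M (act YM c)) (act T (act YM c))
  rw [norm_sub_rev] at h4
  refine le_of_mul_le_mul_right ?_ hcn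
  linarith

/-- Upper bound for the small singular values of a perturbation of a matrix of rank `k`. -/
lemma le_of_svd_perturbation {M T : Matrix (Fin d₁) (Fin d₂) ℝ}
    {XM : Matrix (Fin d₁) (Fin k) ℝ} {sM : Fin k → ℝ} {YM : Matrix (Fin d₂) (Fin k) ℝ}
    (hM : M = XM * Matrix.diagonal sM * YMᵀ)
    {X : Matrix (Fin d₁) (Fin n) ℝ} {s : Fin n → ℝ} {Y : Matrix (Fin d₂) (Fin n) ℝ}
    (hX : Xᵀ * X = 1) (hY : Yᵀ * Y = 1) (hs : ∀ i, 0 ≤ s i) (hanti : Antitone s)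
    (hT : T = X * Matrix.diagonal s * Yᵀ) {δ : ℝ}
    (hTM : ∀ x, ‖act T x - act M x‖ ≤ δ * ‖x‖) (l : Fin n) (hl : k ≤ l) : s l ≤ δ := by
  have hln : (l : ℕ) + 1 ≤ n := l.2
  set J : Matrix (Fin n) (Fin (l + 1)) ℝ :=
    (1 : Matrix (Fin n) (Fin n) ℝ).submatrix id (Fin.castLE hln) with hJ
  have hJJ : Jᵀ * J = 1 := by
    ext a b
    simp only [hJ, Matrix.mul_apply, Matrix.transpose_apply, Matrix.submatrix_apply, id,
      Matrix.one_apply, ite_mul, one_mul, zero_mul]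
    simp
  have hker := LinearMap.ker_ne_bot_of_finrank_lt (f := act (YMᵀ * (Y * J))) (by simp; omega)
  obtain ⟨c, hc, hc0⟩ := (Submodule.ne_bot_iff _).1 hker
  have hcn : 0 < ‖c‖ := norm_pos_iff.2 hc0
  rw [LinearMap.mem_ker, act_mul] at hc
  have h1 : act M (act (Y * J) c) = 0 := by
    rw [hM, act_mul, hc, map_zero]
  have h3 := hTM (act (Y * J) c)
  rw [h1, sub_zero, act_mul, norm_act_of_orthonormal hY, norm_act_of_orthonormal hJJ, hT, ← act_mul,
    Matrix.mul_assoc, hY, Matrix.mul_one, act_mul, norm_act_of_orthonormal hX] at h3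
  have h2 : s l * ‖act J c‖ ≤ ‖act (Matrix.diagonal s) (act J c)‖ :=
    le_norm_act_diagonal _ (fun i hi => by
      refine le_trans ?_ (le_abs_self _)
      refine hanti ?_
      by_contra! hlt
      refine hi ?_
      rw [act_apply]
      refine Finset.sum_eq_zero fun a _ => ?_
      have : i ≠ Fin.castLE hln a := fun h => by
        have h5 := congrArg Fin.val h
        have h6 : (l : ℕ) < i := hlt
        have := a.2
        simp at h5; omega
      simp [hJ, this]) (hs l)
  rw [norm_act_of_orthonormal hJJ] at h2
  exact le_of_mul_le_mul_right (h2.trans h3) hcn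

/-- Projections `PX` and `PY` that split the singular values of `T` into those at least `b` and
those at most `t`. -/
structure SVDGap (T : Matrix (Fin d₁) (Fin d₂) ℝ) (PX : Matrix (Fin d₁) (Fin d₁) ℝ)
    (PY : Matrix (Fin d₂) (Fin d₂) ℝ) (b t : ℝ) : Prop where
  symmX : PXᵀ = PX
  symmY : PYᵀ = PY
  idemX : PX * PX = PX
  idemY : PY * PY = PY
  comm : T * PY = PX * T
  lowerY : ∀ x, b * ‖act PY x‖ ≤ ‖act T (act PY x)‖
  lowerX : ∀ x, b * ‖act PX x‖ ≤ ‖act Tᵀ (act PX x)‖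
  upperY : ∀ x, ‖act T (x - act PY x)‖ ≤ t * ‖x - act PY x‖
  upperX : ∀ x, ‖act Tᵀ (x - act PX x)‖ ≤ t * ‖x - act PX x‖

/-- The indicator of the first `k` indices. -/
def firstInd (n k : ℕ) : Fin n → ℝ := fun i => if (i : ℕ) < k then 1 else 0

lemma diagonal_firstInd_mul_self :
    Matrix.diagonal (firstInd n k) * Matrix.diagonal (firstInd n k) =
      Matrix.diagonal (firstInd n k) := by
  rw [Matrix.diagonal_mul_diagonal]
  congr 1; ext i; simp [firstInd]

lemma diagonal_mul_firstInd (s : Fin n → ℝ) :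
    Matrix.diagonal s * Matrix.diagonal (firstInd n k) =
      Matrix.diagonal (fun i : Fin n => if (i : ℕ) < k then s i else 0) := by
  rw [Matrix.diagonal_mul_diagonal]
  congr 1; ext i; simp [firstInd]

lemma firstInd_mul_diagonal (s : Fin n → ℝ) :
    Matrix.diagonal (firstInd n k) * Matrix.diagonal s =
      Matrix.diagonal (fun i : Fin n => if (i : ℕ) < k then s i else 0) := by
  rw [Matrix.diagonal_mul_diagonal]
  congr 1; ext i; simp [firstInd]

lemma firstProj_mul_self {X : Matrix (Fin d₁) (Fin n) ℝ} (hX : Xᵀ * X = 1) :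
    (X * Matrix.diagonal (firstInd n k) * Xᵀ) * (X * Matrix.diagonal (firstInd n k) * Xᵀ) =
      X * Matrix.diagonal (firstInd n k) * Xᵀ := by
  calc _ = X * (Matrix.diagonal (firstInd n k) * (Xᵀ * X) * Matrix.diagonal (firstInd n k)) * Xᵀ := by
        simp only [Matrix.mul_assoc]
    _ = _ := by rw [hX, Matrix.mul_one, diagonal_firstInd_mul_self]

lemma firstProj_transpose (X : Matrix (Fin d₁) (Fin n) ℝ) :
    (X * Matrix.diagonal (firstInd n k) * Xᵀ)ᵀ = X * Matrix.diagonal (firstInd n k) * Xᵀ := by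
  rw [Matrix.transpose_mul, Matrix.transpose_mul, Matrix.transpose_transpose,
    Matrix.diagonal_transpose, Matrix.mul_assoc]

lemma svd_mul_firstProj (X : Matrix (Fin d₁) (Fin n) ℝ) (s : Fin n → ℝ)
    {Y : Matrix (Fin d₂) (Fin n) ℝ} (hY : Yᵀ * Y = 1) :
    X * Matrix.diagonal s * Yᵀ * (Y * Matrix.diagonal (firstInd n k) * Yᵀ) =
      X * Matrix.diagonal (fun i : Fin n => if (i : ℕ) < k then s i else 0) * Yᵀ := by
  calc _ = X * (Matrix.diagonal s * (Yᵀ * Y) * Matrix.diagonal (firstInd n k)) * Yᵀ := by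
        simp only [Matrix.mul_assoc]
    _ = _ := by rw [hY, Matrix.mul_one, diagonal_mul_firstInd]

lemma firstProj_mul_svd {X : Matrix (Fin d₁) (Fin n) ℝ} (hX : Xᵀ * X = 1) (s : Fin n → ℝ)
    (Y : Matrix (Fin d₂) (Fin n) ℝ) :
    X * Matrix.diagonal (firstInd n k) * Xᵀ * (X * Matrix.diagonal s * Yᵀ) =
      X * Matrix.diagonal (fun i : Fin n => if (i : ℕ) < k then s i else 0) * Yᵀ := by
  calc _ = X * (Matrix.diagonal (firstInd n k) * (Xᵀ * X) * Matrix.diagonal s) * Yᵀ := by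
        simp only [Matrix.mul_assoc]
    _ = _ := by rw [hX, Matrix.mul_one, firstInd_mul_diagonal]

lemma svd_lower {X : Matrix (Fin d₁) (Fin n) ℝ} {s : Fin n → ℝ} {Y : Matrix (Fin d₂) (Fin n) ℝ}
    (hX : Xᵀ * X = 1) (hY : Yᵀ * Y = 1) {b : ℝ} (hb : 0 ≤ b)
    (hsb : ∀ i : Fin n, (i : ℕ) < k → b ≤ s i) (x : EuclideanSpace ℝ (Fin d₂)) :
    b * ‖act (Y * Matrix.diagonal (firstInd n k) * Yᵀ) x‖ ≤
      ‖act (X * Matrix.diagonal s * Yᵀ) (act (Y * Matrix.diagonal (firstInd n k) * Yᵀ) x)‖ := by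
  rw [← act_mul (X * _ * _), svd_mul_firstProj X s hY, ← diagonal_mul_firstInd]
  rw [Matrix.mul_assoc X, Matrix.mul_assoc Y, act_mul X, act_mul Y, norm_act_of_orthonormal hX,
    norm_act_of_orthonormal hY, Matrix.mul_assoc, act_mul (Matrix.diagonal s)]
  refine le_norm_act_diagonal _ (fun i hi => ?_) hb
  by_cases h : (i : ℕ) < k
  · exact (hsb i h).trans (le_abs_self _)
  · exfalso; apply hi
    rw [act_mul, act_apply]
    refine Finset.sum_eq_zero fun j _ => ?_
    by_cases hij : i = j
    · subst hij; simp [firstInd, h]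
    · simp [hij]

lemma svd_upper {X : Matrix (Fin d₁) (Fin n) ℝ} {s : Fin n → ℝ} {Y : Matrix (Fin d₂) (Fin n) ℝ}
    (hX : Xᵀ * X = 1) (hY : Yᵀ * Y = 1) (hs : ∀ i, 0 ≤ s i) {t : ℝ} (ht : 0 ≤ t)
    (hst : ∀ i : Fin n, k ≤ (i : ℕ) → s i ≤ t) (x : EuclideanSpace ℝ (Fin d₂)) :
    ‖act (X * Matrix.diagonal s * Yᵀ) (x - act (Y * Matrix.diagonal (firstInd n k) * Yᵀ) x)‖ ≤
      t * ‖x - act (Y * Matrix.diagonal (firstInd n k) * Yᵀ) x‖ := by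
  set z := x - act (Y * Matrix.diagonal (firstInd n k) * Yᵀ) x with hz
  have hYz : act Yᵀ z = act Yᵀ x - act (Matrix.diagonal (firstInd n k)) (act Yᵀ x) := by
    rw [hz, map_sub, ← act_mul Yᵀ, ← Matrix.mul_assoc, ← Matrix.mul_assoc, hY, Matrix.one_mul,
      act_mul]
  rw [act_mul, act_mul, norm_act_of_orthonormal hX]
  refine (norm_act_diagonal_le _ (fun i hi => ?_) ht).trans
    (mul_le_mul_of_nonneg_left (norm_act_transpose_of_orthonormal_le hY z) ht)
  rw [abs_of_nonneg (hs i)]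
  refine hst i ?_
  by_contra! hlt
  apply hi
  rw [hYz]
  simp only [PiLp.sub_apply]
  rw [act_apply (Matrix.diagonal _), Finset.sum_eq_single i]
  · simp [firstInd, hlt]
  · intro b _ hb; simp [hb.symm]
  · simp

lemma svdGap_of_svd {T : Matrix (Fin d₁) (Fin d₂) ℝ}
    {X : Matrix (Fin d₁) (Fin n) ℝ} {s : Fin n → ℝ} {Y : Matrix (Fin d₂) (Fin n) ℝ}
    (hX : Xᵀ * X = 1) (hY : Yᵀ * Y = 1) (hs : ∀ i, 0 ≤ s i) (hT : T = X * Matrix.diagonal s * Yᵀ)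
    {b t : ℝ} (hb : 0 ≤ b) (ht : 0 ≤ t)
    (hsb : ∀ i : Fin n, (i : ℕ) < k → b ≤ s i) (hst : ∀ i : Fin n, k ≤ (i : ℕ) → s i ≤ t) :
    SVDGap T (X * Matrix.diagonal (firstInd n k) * Xᵀ) (Y * Matrix.diagonal (firstInd n k) * Yᵀ)
      b t := by
  have hTt : Tᵀ = Y * Matrix.diagonal s * Xᵀ := by
    rw [hT, Matrix.transpose_mul, Matrix.transpose_mul, Matrix.transpose_transpose,
      Matrix.diagonal_transpose, Matrix.mul_assoc]
  refine ⟨firstProj_transpose X, firstProj_transpose Y, firstProj_mul_self hX,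
    firstProj_mul_self hY, ?_, fun x => ?_, fun x => ?_, fun x => ?_, fun x => ?_⟩
  · rw [hT, svd_mul_firstProj X s hY, firstProj_mul_svd hX]
  · rw [hT]; exact svd_lower hX hY hb hsb x
  · rw [hTt]; exact svd_lower hY hX hb hsb x
  · rw [hT]; exact svd_upper hX hY hs ht hst x
  · rw [hTt]; exact svd_upper hY hX hs ht hst x

lemma SVDGap.spectralGap {d : ℕ} {T P : Matrix (Fin d) (Fin d) ℝ} {b t : ℝ}
    (h : SVDGap T P P b t) : SpectralGap (act T) (act P) b t :=
  ⟨act_isSymmetric h.symmX, fun x => by rw [← act_mul, h.idemX],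
    fun x => by rw [← act_mul, h.comm, act_mul], h.lowerY, h.upperY⟩

/-- The left and right projections agree if the truncation is symmetric. -/
lemma firstProj_eq_of_symm {d : ℕ} {X Y : Matrix (Fin d) (Fin n) ℝ} {s : Fin n → ℝ}
    (hX : Xᵀ * X = 1) (hY : Yᵀ * Y = 1) (hs : ∀ i : Fin n, (i : ℕ) < k → 0 < s i)
    {B : Matrix (Fin d) (Fin d) ℝ} (hBs : Bᵀ = B)
    (hB : B = X * Matrix.diagonal (fun i : Fin n => if (i : ℕ) < k then s i else 0) * Yᵀ) :
    X * Matrix.diagonal (firstInd n k) * Xᵀ = Y * Matrix.diagonal (firstInd n k) * Yᵀ := by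
  set D := Matrix.diagonal (fun i : Fin n => if (i : ℕ) < k then s i else 0) with hD
  set I := Matrix.diagonal (firstInd n k) with hI
  set D' := Matrix.diagonal (fun i : Fin n => if (i : ℕ) < k then (s i)⁻¹ else 0) with hD'
  have hDD : D * D' = I := by
    rw [hD, hD', hI, Matrix.diagonal_mul_diagonal]
    congr 1; ext i
    by_cases h : (i : ℕ) < k
    · simp [h, firstInd, (hs i h).ne']
    · simp [h, firstInd]
  have hID : I * D = D := by
    rw [hD, hI, firstInd_mul_diagonal]; congr 1; ext i; split_ifs <;> rfl
  have hB' : B = Y * D * Xᵀ := by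
    rw [← hBs, hB, Matrix.transpose_mul, Matrix.transpose_mul, Matrix.transpose_transpose, hD,
      Matrix.diagonal_transpose, Matrix.mul_assoc]
  have key : ∀ U W : Matrix (Fin d) (Fin n) ℝ, Uᵀ * U = 1 → Wᵀ * W = 1 → B = U * D * Wᵀ →
      B = W * D * Uᵀ → U * I * Uᵀ * (W * I * Wᵀ) = W * I * Wᵀ := fun U W hU hW h1 h2 => by
    have e1 : U * I * Uᵀ * B = B := by
      calc U * I * Uᵀ * B = U * (I * (Uᵀ * U) * D) * Wᵀ := by rw [h1]; simp only [Matrix.mul_assoc]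
        _ = B := by rw [hU, Matrix.mul_one, hID, ← h1]
    have e2 : B * (U * D' * Wᵀ) = W * I * Wᵀ := by
      calc B * (U * D' * Wᵀ) = W * (D * (Uᵀ * U) * D') * Wᵀ := by
            rw [h2]; simp only [Matrix.mul_assoc]
        _ = _ := by rw [hU, Matrix.mul_one, hDD]
    rw [← e2, ← Matrix.mul_assoc, e1]
  have k1 := key X Y hX hY hB hB'
  have k2 := key Y X hY hX hB' hB
  have k3 := congrArg Matrix.transpose k2
  rw [Matrix.transpose_mul, firstProj_transpose, firstProj_transpose, k1] at k3
  exact k3.symm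

end SingularValuePerturbation

section Dilation

variable {d₁ d₂ : ℕ}

/-- The symmetric dilation of a matrix. -/
def dilation (A : Matrix (Fin d₁) (Fin d₂) ℝ) : Matrix (Fin d₁ ⊕ Fin d₂) (Fin d₁ ⊕ Fin d₂) ℝ :=
  Matrix.fromBlocks 0 A Aᵀ 0

/-- The first component of a vector of the dilated space. -/
def leftPart (z : EuclideanSpace ℝ (Fin d₁ ⊕ Fin d₂)) : EuclideanSpace ℝ (Fin d₁) :=
  WithLp.toLp 2 fun i => z (Sum.inl i)

/-- The second component of a vector of the dilated space. -/
def rightPart (z : EuclideanSpace ℝ (Fin d₁ ⊕ Fin d₂)) : EuclideanSpace ℝ (Fin d₂) :=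
  WithLp.toLp 2 fun i => z (Sum.inr i)

lemma norm_sq_parts (z : EuclideanSpace ℝ (Fin d₁ ⊕ Fin d₂)) :
    ‖z‖ ^ 2 = ‖leftPart z‖ ^ 2 + ‖rightPart z‖ ^ 2 := by
  simp [EuclideanSpace.norm_sq_eq, leftPart, rightPart]

lemma ext_parts {z w : EuclideanSpace ℝ (Fin d₁ ⊕ Fin d₂)} (h1 : leftPart z = leftPart w)
    (h2 : rightPart z = rightPart w) : z = w := by
  ext i
  cases i with
  | inl i => exact congrArg (fun x : EuclideanSpace ℝ (Fin d₁) => x i) h1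
  | inr i => exact congrArg (fun x : EuclideanSpace ℝ (Fin d₂) => x i) h2

lemma leftPart_sub (z w : EuclideanSpace ℝ (Fin d₁ ⊕ Fin d₂)) :
    leftPart (z - w) = leftPart z - leftPart w := rfl

lemma rightPart_sub (z w : EuclideanSpace ℝ (Fin d₁ ⊕ Fin d₂)) :
    rightPart (z - w) = rightPart z - rightPart w := rfl

lemma leftPart_dilation (A : Matrix (Fin d₁) (Fin d₂) ℝ) (z : EuclideanSpace ℝ (Fin d₁ ⊕ Fin d₂)) :
    leftPart (act (dilation A) z) = act A (rightPart z) := by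
  ext i
  simp [leftPart, rightPart, act_apply, dilation]
  rfl

lemma rightPart_dilation (A : Matrix (Fin d₁) (Fin d₂) ℝ)
    (z : EuclideanSpace ℝ (Fin d₁ ⊕ Fin d₂)) :
    rightPart (act (dilation A) z) = act Aᵀ (leftPart z) := by
  ext i
  simp [leftPart, rightPart, act_apply, dilation]
  rfl

lemma leftPart_blockDiag (P : Matrix (Fin d₁) (Fin d₁) ℝ) (Q : Matrix (Fin d₂) (Fin d₂) ℝ)
    (z : EuclideanSpace ℝ (Fin d₁ ⊕ Fin d₂)) :
    leftPart (act (Matrix.fromBlocks P 0 0 Q) z) = act P (leftPart z) := by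
  ext i
  simp [leftPart, act_apply]
  rfl

lemma rightPart_blockDiag (P : Matrix (Fin d₁) (Fin d₁) ℝ) (Q : Matrix (Fin d₂) (Fin d₂) ℝ)
    (z : EuclideanSpace ℝ (Fin d₁ ⊕ Fin d₂)) :
    rightPart (act (Matrix.fromBlocks P 0 0 Q) z) = act Q (rightPart z) := by
  ext i
  simp [rightPart, act_apply]
  rfl

lemma SVDGap.dilation_spectralGap {T : Matrix (Fin d₁) (Fin d₂) ℝ}
    {PX : Matrix (Fin d₁) (Fin d₁) ℝ} {PY : Matrix (Fin d₂) (Fin d₂) ℝ} {b t : ℝ} (hb : 0 ≤ b)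
    (ht : 0 ≤ t) (h : SVDGap T PX PY b t) :
    SpectralGap (act (dilation T)) (act (Matrix.fromBlocks PX 0 0 PY)) b t := by
  have hct : Tᵀ * PX = PY * Tᵀ := by
    have := congrArg Matrix.transpose h.comm
    rw [Matrix.transpose_mul, Matrix.transpose_mul, h.symmX, h.symmY] at this
    exact this.symm
  refine ⟨act_isSymmetric ?_, fun x => ?_, fun x => ?_, fun x => ?_, fun x => ?_⟩
  · rw [Matrix.fromBlocks_transpose, h.symmX, h.symmY]; simp
  · rw [← act_mul, Matrix.fromBlocks_multiply]; simp [h.idemX, h.idemY]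
  · refine ext_parts ?_ ?_
    · rw [leftPart_dilation, leftPart_blockDiag, rightPart_blockDiag, leftPart_dilation, ← act_mul,
        h.comm, act_mul]
    · rw [rightPart_dilation, rightPart_blockDiag, leftPart_blockDiag, rightPart_dilation,
        ← act_mul, hct, act_mul]
  · refine le_of_abs_le (abs_le_of_sq_le_sq ?_ (norm_nonneg _))
    rw [mul_pow, norm_sq_parts, norm_sq_parts (act (dilation T) _), leftPart_dilation,
      rightPart_dilation, leftPart_blockDiag, rightPart_blockDiag]
    have h1 : (b * ‖act PY (rightPart x)‖) ^ 2 ≤ ‖act T (act PY (rightPart x))‖ ^ 2 := by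
      have := h.lowerY (rightPart x); gcongr
    have h2 : (b * ‖act PX (leftPart x)‖) ^ 2 ≤ ‖act Tᵀ (act PX (leftPart x))‖ ^ 2 := by
      have := h.lowerX (leftPart x); gcongr
    nlinarith
  · refine le_of_abs_le (abs_le_of_sq_le_sq ?_ (by positivity))
    rw [mul_pow, norm_sq_parts (act (dilation T) _), norm_sq_parts (x - _), leftPart_dilation,
      rightPart_dilation, leftPart_sub, rightPart_sub, leftPart_blockDiag, rightPart_blockDiag]
    have h1 : ‖act T (rightPart x - act PY (rightPart x))‖ ^ 2 ≤
        (t * ‖rightPart x - act PY (rightPart x)‖) ^ 2 := by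
      have := h.upperY (rightPart x); gcongr
    have h2 : ‖act Tᵀ (leftPart x - act PX (leftPart x))‖ ^ 2 ≤
        (t * ‖leftPart x - act PX (leftPart x)‖) ^ 2 := by
      have := h.upperX (leftPart x); gcongr
    nlinarith

end Dilation

section IncoherentSVD

variable {d₁ d₂ k : ℕ}

/-- A compact singular value decomposition of an incoherent matrix of rank `k`. -/
structure IncoherentSVD (M : Matrix (Fin d₁) (Fin d₂) ℝ) (k : ℕ) (μ : ℝ)
    (X : Matrix (Fin d₁) (Fin k) ℝ) (s : Fin k → ℝ) (Y : Matrix (Fin d₂) (Fin k) ℝ) : Prop where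
  rank : M.rank = k
  hX : Xᵀ * X = 1
  hY : Yᵀ * Y = 1
  eq : M = X * Matrix.diagonal s * Yᵀ
  pos : 0 < sigmaMin M
  le : ∀ l, sigmaMin M ≤ s l
  ge : ∀ l, s l ≤ specNorm M
  sigma_le : sigmaMin M ≤ specNorm M
  one_le : 1 ≤ μ
  rowX : ∀ i, rowNorm X i ≤ √(μ * k / d₁)
  rowY : ∀ j, rowNorm Y j ≤ √(μ * k / d₂)

lemma IsIncoherent.exists_svd {M : Matrix (Fin d₁) (Fin d₂) ℝ} {μ : ℝ} (h : IsIncoherent M k μ)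
    (hk : 1 ≤ k) (hr : M.rank = k) : ∃ X s Y, IncoherentSVD M k μ X s Y := by
  obtain ⟨X, s, Y, hX, hY, hs, hM, hμ⟩ := h
  have hle := sigmaMin_le hr hX hY hs hM
  have hge := svd_le_specNorm hX hY hs hM
  exact ⟨X, s, Y, hr, hX, hY, hM, sigmaMin_pos hk hr, hle, hge,
    (hle ⟨0, hk⟩).trans (hge ⟨0, hk⟩), one_le_of_coherence_le hk hX ((le_max_left _ _).trans hμ),
    fun i => Real.le_sqrt_of_sq_le (coherence_rowNorm_sq_le hk ((le_max_left _ _).trans hμ) i),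
    fun j => Real.le_sqrt_of_sq_le (coherence_rowNorm_sq_le hk ((le_max_right _ _).trans hμ) j)⟩

lemma rowNorm_nonneg (A : Matrix (Fin d₁) (Fin d₂) ℝ) (i : Fin d₁) : 0 ≤ rowNorm A i :=
  norm_nonneg _

namespace IncoherentSVD

variable {M : Matrix (Fin d₁) (Fin d₂) ℝ} {μ : ℝ} {X : Matrix (Fin d₁) (Fin k) ℝ} {s : Fin k → ℝ}
  {Y : Matrix (Fin d₂) (Fin k) ℝ}

lemma transpose (h : IncoherentSVD M k μ X s Y) : Mᵀ = Y * Matrix.diagonal s * Xᵀ := by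
  rw [h.eq, Matrix.transpose_mul, Matrix.transpose_mul, Matrix.transpose_transpose,
    Matrix.diagonal_transpose, Matrix.mul_assoc]

lemma norm_diagonal_le (h : IncoherentSVD M k μ X s Y) (x : EuclideanSpace ℝ (Fin k)) :
    ‖act (Matrix.diagonal s) x‖ ≤ specNorm M * ‖x‖ :=
  norm_act_diagonal_le x (fun i _ => by
    rw [abs_of_nonneg (h.pos.le.trans (h.le i))]; exact h.ge i) (specNorm_nonneg M)

lemma norm_col_le (h : IncoherentSVD M k μ X s Y) (j : Fin d₂) :
    ‖act M (EuclideanSpace.single j 1)‖ ≤ √(μ * k / d₂) * specNorm M := by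
  rw [h.eq, act_mul, act_mul, norm_act_of_orthonormal h.hX, ← h.eq, mul_comm]
  refine (h.norm_diagonal_le _).trans ?_
  rw [← rowNorm_eq]
  exact mul_le_mul_of_nonneg_left (h.rowY j) (specNorm_nonneg M)

lemma norm_row_le (h : IncoherentSVD M k μ X s Y) (i : Fin d₁) :
    ‖act Mᵀ (EuclideanSpace.single i 1)‖ ≤ √(μ * k / d₁) * specNorm M := by
  rw [h.transpose, act_mul, act_mul, norm_act_of_orthonormal h.hY, mul_comm]
  refine (h.norm_diagonal_le _).trans ?_
  rw [← rowNorm_eq]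
  exact mul_le_mul_of_nonneg_left (h.rowX i) (specNorm_nonneg M)

lemma abs_entry_le (h : IncoherentSVD M k μ X s Y) (i : Fin d₁) (j : Fin d₂) :
    |M i j| ≤ √(μ * k / d₁) * √(μ * k / d₂) * specNorm M := by
  have h1 : M i j = inner ℝ (act Xᵀ (EuclideanSpace.single i 1))
      (act (Matrix.diagonal s) (act Yᵀ (EuclideanSpace.single j 1))) := by
    rw [inner_act, Matrix.transpose_transpose, ← act_mul (Matrix.diagonal s), ← act_mul X,
      ← Matrix.mul_assoc, ← h.eq, EuclideanSpace.inner_single_left, act_single]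
    simp
  rw [h1]
  refine (abs_real_inner_le_norm _ _).trans ?_
  have h2 := h.norm_diagonal_le (act Yᵀ (EuclideanSpace.single j 1))
  rw [← rowNorm_eq] at h2 ⊢
  calc _ ≤ √(μ * k / d₁) * (specNorm M * √(μ * k / d₂)) := by
        refine mul_le_mul (h.rowX i) (h2.trans ?_) (norm_nonneg _) (Real.sqrt_nonneg _)
        exact mul_le_mul_of_nonneg_left (h.rowY j) (specNorm_nonneg M)
    _ = _ := by ring

lemma svdGap (h : IncoherentSVD M k μ X s Y) :
    SVDGap M (X * Matrix.diagonal (firstInd k k) * Xᵀ) (Y * Matrix.diagonal (firstInd k k) * Yᵀ)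
      (sigmaMin M) 0 :=
  svdGap_of_svd h.hX h.hY (fun i => h.pos.le.trans (h.le i)) h.eq h.pos.le le_rfl
    (fun i _ => h.le i) (fun i hi => absurd i.2 (by omega))

end IncoherentSVD

lemma SVDGap.mono {T : Matrix (Fin d₁) (Fin d₂) ℝ} {PX : Matrix (Fin d₁) (Fin d₁) ℝ}
    {PY : Matrix (Fin d₂) (Fin d₂) ℝ} {b t b' t' : ℝ} (h : SVDGap T PX PY b t) (hb : b' ≤ b)
    (ht : t ≤ t') : SVDGap T PX PY b' t' where
  symmX := h.symmX
  symmY := h.symmY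
  idemX := h.idemX
  idemY := h.idemY
  comm := h.comm
  lowerY x := le_trans (by gcongr) (h.lowerY x)
  lowerX x := le_trans (by gcongr) (h.lowerX x)
  upperY x := (h.upperY x).trans (by gcongr)
  upperX x := (h.upperX x).trans (by gcongr)

lemma norm_sub_act_proj_le {d : ℕ} {P : Matrix (Fin d) (Fin d) ℝ} (hs : Pᵀ = P) (hi : P * P = P)
    (x : EuclideanSpace ℝ (Fin d)) : ‖x - act P x‖ ≤ ‖x‖ := by
  refine le_of_abs_le (abs_le_of_sq_le_sq ?_ (norm_nonneg _))
  have h1 : inner ℝ (act P x) (act P x) = inner ℝ x (act P x) := by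
    rw [inner_act, hs, ← act_mul, hi]
  rw [norm_sub_sq_real, ← h1, real_inner_self_eq_norm_sq]
  nlinarith [sq_nonneg ‖act P x‖]

/-- The projections that belong to a truncated singular value decomposition `B` of a perturbation
of a matrix of rank `k`. -/
lemma IncoherentSVD.exists_svdGap {M T B : Matrix (Fin d₁) (Fin d₂) ℝ} {μ : ℝ}
    {X : Matrix (Fin d₁) (Fin k) ℝ} {s : Fin k → ℝ} {Y : Matrix (Fin d₂) (Fin k) ℝ}
    (h : IncoherentSVD M k μ X s Y) {δ : ℝ} (hδ0 : 0 ≤ δ) (hδ : δ ≤ sigmaMin M)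
    (hTM : ∀ x, ‖act T x - act M x‖ ≤ δ * ‖x‖) (hB : IsTopSVD k T B) :
    ∃ PX PY, SVDGap T PX PY (sigmaMin M - δ) δ ∧ B = T * PY ∧ B = PX * T ∧
      ∃ n, ∃ X' Y' : Matrix _ (Fin n) ℝ, ∃ s' : Fin n → ℝ, X'ᵀ * X' = 1 ∧ Y'ᵀ * Y' = 1 ∧
        (∀ i : Fin n, (i : ℕ) < k → sigmaMin M - δ ≤ s' i) ∧
        B = X' * Matrix.diagonal (fun i : Fin n => if (i : ℕ) < k then s' i else 0) * Y'ᵀ ∧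
        PX = X' * Matrix.diagonal (firstInd n k) * X'ᵀ ∧
        PY = Y' * Matrix.diagonal (firstInd n k) * Y'ᵀ := by
  obtain ⟨n, X', s', Y', hX', hY', hanti, hs', hT, hB⟩ := hB
  have hlow : ∀ i : Fin n, (i : ℕ) < k → sigmaMin M - δ ≤ s' i := fun i hi =>
    sub_le_of_svd_perturbation h.hX h.hY h.eq hX' hY' hs' hT h.pos h.le hTM hi (hs' i)
      (fun l hl => hanti hl)
  refine ⟨_, _, svdGap_of_svd hX' hY' hs' hT (sub_nonneg.2 hδ) hδ0 hlow
    (fun l hl => le_of_svd_perturbation h.eq hX' hY' hs' hanti hT hTM l hl), ?_, ?_,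
    n, X', Y', s', hX', hY', hlow, hB, rfl, rfl⟩
  · rw [hT, svd_mul_firstProj X' s' hY', hB]
  · rw [hT, firstProj_mul_svd hX', hB]

lemma frobNorm_sub_le {M T : Matrix (Fin d₁) (Fin d₂) ℝ} {PX : Matrix (Fin d₁) (Fin d₁) ℝ}
    {PY : Matrix (Fin d₂) (Fin d₂) ℝ} {b δ : ℝ} (hδ0 : 0 ≤ δ) (hr : M.rank = k)
    (hTM : ∀ x, ‖act T x - act M x‖ ≤ δ * ‖x‖) (hgap : SVDGap T PX PY b δ)
    {U : Matrix (Fin d₁) (Fin k) ℝ} {V : Matrix (Fin d₂) (Fin k) ℝ} (hB : U * Vᵀ = T * PY) :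
    frobNorm (M - U * Vᵀ) ≤ √(2 * k) * (2 * δ) := by
  have h1 : (M - U * Vᵀ).rank ≤ 2 * k := by
    have h2 : (U * Vᵀ).rank ≤ k :=
      (Matrix.rank_mul_le_left _ _).trans ((Matrix.rank_le_width U))
    rw [← finrank_range_act] at h2 hr ⊢
    have h3 : LinearMap.range (act (M - U * Vᵀ)) ≤
        LinearMap.range (act M) ⊔ LinearMap.range (act (U * Vᵀ)) := by
      rintro _ ⟨x, rfl⟩
      rw [act_sub]
      exact Submodule.sub_mem _ (Submodule.mem_sup_left ⟨x, rfl⟩) (Submodule.mem_sup_right ⟨x, rfl⟩)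
    have h4 := Submodule.finrank_mono h3
    have h5 := Submodule.finrank_add_le_finrank_add_finrank (LinearMap.range (act M))
      (LinearMap.range (act (U * Vᵀ)))
    omega
  have h5 := frobNorm_le_of_rank h1 (c := 2 * δ) (by positivity) (fun x => by
    rw [act_sub, hB, act_mul]
    have e1 := hTM x
    have e2 := hgap.upperY x
    have e3 := norm_sub_act_proj_le hgap.symmY hgap.idemY x
    have e4 : act M x - act T (act PY x) = (act M x - act T x) + act T (x - act PY x) := by
      rw [map_sub]; abel
    rw [e4]
    refine (norm_add_le _ _).trans ?_
    rw [norm_sub_rev]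
    nlinarith)
  exact_mod_cast h5

/-- The rows of a balanced factor. -/
lemma mul_rowNorm_sq_le_of_balanced {U : Matrix (Fin d₁) (Fin k) ℝ} {V : Matrix (Fin d₂) (Fin k) ℝ}
    (hUV : Uᵀ * U = Vᵀ * V) {PY : Matrix (Fin d₂) (Fin d₂) ℝ} (hs : PYᵀ = PY)
    (hBP : U * Vᵀ * PY = U * Vᵀ) {c : ℝ}
    (hc : ∀ x, c * ‖act PY x‖ ≤ ‖act (U * Vᵀ) x‖) (j : Fin d₁) :
    c * rowNorm U j ^ 2 ≤ rowNorm (U * Vᵀ) j ^ 2 := by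
  set G := Uᵀ * U with hG
  have hH : G.IsHermitian := by
    rw [Matrix.IsHermitian, Matrix.conjTranspose_eq_transpose_of_trivial, hG, Matrix.transpose_mul,
      Matrix.transpose_transpose]
  set w := hH.eigenvectorBasis with hw
  set g := hH.eigenvalues with hg
  have hGw : ∀ l, act G (w l) = g l • w l := fun l => by
    ext j
    have := congrFun (hH.mulVec_eigenvectorBasis l) j
    simpa [Matrix.toLpLin_apply] using this
  have hn : ∀ l, ‖w l‖ = 1 := fun l => w.orthonormal.1 l
  have hUw : ∀ l, ‖act U (w l)‖ ^ 2 = g l := fun l => by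
    rw [← real_inner_self_eq_norm_sq, inner_act, ← act_mul, ← hG, hGw, inner_smul_right,
      real_inner_self_eq_norm_sq, hn]; ring
  have hVw : ∀ l, ‖act V (w l)‖ ^ 2 = g l := fun l => by
    rw [← real_inner_self_eq_norm_sq, inner_act, ← act_mul, ← hUV, hGw, inner_smul_right,
      real_inner_self_eq_norm_sq, hn]; ring
  have hBV : ∀ l, act (U * Vᵀ) (act V (w l)) = g l • act U (w l) := fun l => by
    rw [act_mul, ← act_mul Vᵀ, ← hUV, hGw, map_smul]
  have hBU : ∀ l, act (V * Uᵀ) (act U (w l)) = g l • act V (w l) := fun l => by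
    rw [act_mul, ← act_mul Uᵀ, ← hG, hGw, map_smul]
  have hPB : PY * (V * Uᵀ) = V * Uᵀ := by
    have := congrArg Matrix.transpose hBP
    simpa [Matrix.transpose_mul, hs] using this
  have hgl : ∀ l, g l ≠ 0 → c ≤ g l := fun l hl => by
    have h0 : 0 ≤ g l := (hUw l) ▸ sq_nonneg _
    have hpos : 0 < g l := lt_of_le_of_ne h0 hl.symm
    have hP : act PY (act V (w l)) = act V (w l) := by
      have h1 : act PY (g l • act V (w l)) = g l • act V (w l) := by
        rw [← hBU, ← act_mul, hPB]
      rw [map_smul] at h1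
      exact smul_right_injective _ hl h1
    have h1 := hc (act V (w l))
    rw [hP, hBV, norm_smul, Real.norm_eq_abs, abs_of_nonneg h0] at h1
    have h2 : ‖act U (w l)‖ = ‖act V (w l)‖ :=
      (sq_eq_sq₀ (norm_nonneg _) (norm_nonneg _)).1 ((hUw l).trans (hVw l).symm)
    have h3 : 0 < ‖act V (w l)‖ := by
      refine lt_of_le_of_ne (norm_nonneg _) fun h => ?_
      have := hVw l
      rw [← h] at this; simp at this; exact hl this.symm
    rw [h2] at h1
    exact le_of_mul_le_mul_right h1 h3
  set x := act Uᵀ (EuclideanSpace.single j (1 : ℝ)) with hx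
  have hB : rowNorm (U * Vᵀ) j ^ 2 = inner ℝ x (act G x) := by
    rw [rowNorm_eq, Matrix.transpose_mul, Matrix.transpose_transpose, act_mul, ← hx,
      ← real_inner_self_eq_norm_sq, inner_act, ← act_mul, ← hUV]
  have hU : rowNorm U j ^ 2 = inner ℝ x x := by
    rw [rowNorm_eq, ← hx, real_inner_self_eq_norm_sq]
  rw [hB, hU, ← w.sum_inner_mul_inner x x, ← w.sum_inner_mul_inner x (act G x), Finset.mul_sum]
  refine Finset.sum_le_sum fun l _ => ?_
  have h1 : inner ℝ (w l) (act G x) = g l * inner ℝ (w l) x := by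
    have : Gᵀ = G := by rw [hG, Matrix.transpose_mul, Matrix.transpose_transpose]
    rw [← this, ← inner_act, hGw, inner_smul_left]; simp
  rw [h1, real_inner_comm (w l) x]
  by_cases h : g l = 0
  · have : (inner ℝ (w l) x : ℝ) = 0 := by
      rw [hx, ← inner_act]
      have h5 : act U (w l) = 0 := by
        have := hUw l; rw [h] at this
        simpa using this
      rw [h5, inner_zero_left]
    rw [this]; simp
  · have := hgl l h
    nlinarith [mul_self_nonneg (inner ℝ (w l) x : ℝ)]

lemma SVDGap.le_norm_truncation {T : Matrix (Fin d₁) (Fin d₂) ℝ} {PX : Matrix (Fin d₁) (Fin d₁) ℝ}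
    {PY : Matrix (Fin d₂) (Fin d₂) ℝ} {b δ : ℝ} (hgap : SVDGap T PX PY b δ)
    {U : Matrix (Fin d₁) (Fin k) ℝ} {V : Matrix (Fin d₂) (Fin k) ℝ} (hUV : Uᵀ * U = Vᵀ * V)
    (hB : U * Vᵀ = T * PY) :
    (∀ i, b * rowNorm U i ^ 2 ≤ rowNorm (U * Vᵀ) i ^ 2) ∧
      ∀ i, b * rowNorm V i ^ 2 ≤ rowNorm (V * Uᵀ) i ^ 2 := by
  refine ⟨mul_rowNorm_sq_le_of_balanced hUV hgap.symmY ?_ fun x => ?_,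
    mul_rowNorm_sq_le_of_balanced hUV.symm hgap.symmX ?_ fun x => ?_⟩
  · rw [hB, Matrix.mul_assoc, hgap.idemY]
  · rw [hB, act_mul]; exact hgap.lowerY x
  · have h1 : V * Uᵀ = Tᵀ * PX := by
      have := congrArg Matrix.transpose (hB.trans hgap.comm)
      simpa [Matrix.transpose_mul, hgap.symmX] using this
    rw [h1, Matrix.mul_assoc, hgap.idemX]
  · have h1 : V * Uᵀ = Tᵀ * PX := by
      have := congrArg Matrix.transpose (hB.trans hgap.comm)
      simpa [Matrix.transpose_mul, hgap.symmX] using this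
    rw [h1, act_mul]; exact hgap.lowerX x

end IncoherentSVD

section SymmetricTruncation

variable {d k : ℕ}

lemma castLE_mul_transpose (hkd : k ≤ d) :
    (1 : Matrix (Fin d) (Fin d) ℝ).submatrix id (Fin.castLE hkd) *
      ((1 : Matrix (Fin d) (Fin d) ℝ).submatrix id (Fin.castLE hkd))ᵀ =
      Matrix.diagonal (firstInd d k) := by
  ext i j
  simp only [Matrix.mul_apply, Matrix.transpose_apply, Matrix.submatrix_apply, id,
    Matrix.one_apply, Matrix.diagonal_apply, firstInd, mul_ite, mul_one, mul_zero]
  by_cases hi : (i : ℕ) < k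
  · rw [Finset.sum_eq_single (⟨i, hi⟩ : Fin k)]
    · by_cases hij : i = j
      · subst hij; simp [hi]
      · simp [hij, Ne.symm hij]
    · intro a _ ha
      have : i ≠ Fin.castLE hkd a := fun h => ha (by ext; simp [h])
      simp [this]
    · simp
  · rw [Finset.sum_eq_zero]
    · simp [hi]
    · intro a _
      have : i ≠ Fin.castLE hkd a := fun h => hi (by rw [h]; exact a.2)
      simp [this]

/-- A symmetric perturbation of a positive semidefinite matrix of rank `k` has a positive
semidefinite truncated singular value decomposition. -/
lemma exists_isTopSVD_mul_transpose {M T : Matrix (Fin d) (Fin d) ℝ} {μ : ℝ}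
    {X : Matrix (Fin d) (Fin k) ℝ} {s : Fin k → ℝ} {Y : Matrix (Fin d) (Fin k) ℝ}
    (h : IncoherentSVD M k μ X s Y) (hpsd : M.PosSemidef) (hT : Tᵀ = T) {δ : ℝ}
    (hδ : 2 * δ < sigmaMin M) (hTM : ∀ x, ‖act T x - act M x‖ ≤ δ * ‖x‖) :
    ∃ U : Matrix (Fin d) (Fin k) ℝ, IsTopSVD k T (U * Uᵀ) := by
  have hkd : k ≤ d := by
    have := Matrix.rank_le_width M
    rw [h.rank] at this; exact this
  have hH : T.IsHermitian := by
    rw [Matrix.IsHermitian, Matrix.conjTranspose_eq_transpose_of_trivial, hT]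
  set w := hH.eigenvectorBasis with hw
  set g := hH.eigenvalues with hg
  have hTw : ∀ l, act T (w l) = g l • w l := fun l => by
    ext j
    have := congrFun (hH.mulVec_eigenvectorBasis l) j
    simpa [Matrix.toLpLin_apply] using this
  set π : Equiv.Perm (Fin d) := Tuple.sort (fun i => -|g i|) with hπ
  set t : Fin d → ℝ := fun i => |g (π i)| with ht
  have hanti : Antitone t := fun a b hab => by
    have := Tuple.monotone_sort (fun i => -|g i|) hab
    simp only [Function.comp] at this
    simp only [ht]; linarith
  set W : Matrix (Fin d) (Fin d) ℝ := Matrix.of fun i l => w (π l) i with hW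
  have hWW : Wᵀ * W = 1 := by
    ext a b
    have h1 : (Wᵀ * W) a b = inner ℝ (w (π b)) (w (π a)) := by
      simp [Matrix.mul_apply, hW, PiLp.inner_apply]
    rw [h1, orthonormal_iff_ite.1 w.orthonormal, Matrix.one_apply]
    by_cases hab : a = b
    · simp [hab]
    · simp [hab, Ne.symm hab]
  have hWW' : W * Wᵀ = 1 := mul_eq_one_comm.1 hWW
  have hTW : T * W = W * Matrix.diagonal (fun i => g (π i)) := by
    ext i l
    rw [Matrix.mul_diagonal]
    have h1 := congrArg (fun v : EuclideanSpace ℝ (Fin d) => v i) (hTw (π l))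
    simp only [act_apply, PiLp.smul_apply, smul_eq_mul] at h1
    rw [Matrix.mul_apply, hW]
    simp only [Matrix.of_apply]
    rw [h1, mul_comm]
  set e : Fin d → ℝ := fun i => if 0 ≤ g (π i) then 1 else -1 with he
  have hee : Matrix.diagonal e * Matrix.diagonal e = (1 : Matrix (Fin d) (Fin d) ℝ) := by
    rw [Matrix.diagonal_mul_diagonal, ← Matrix.diagonal_one]
    congr 1; ext i; simp only [he]; split_ifs <;> norm_num
  have hte : ∀ i, t i * e i = g (π i) := fun i => by
    simp only [ht, he]; split_ifs with h1
    · rw [abs_of_nonneg h1, mul_one]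
    · rw [abs_of_neg (not_le.1 h1)]; ring
  have hYt : (W * Matrix.diagonal e)ᵀ = Matrix.diagonal e * Wᵀ := by
    rw [Matrix.transpose_mul, Matrix.diagonal_transpose]
  have hYY : (W * Matrix.diagonal e)ᵀ * (W * Matrix.diagonal e) = 1 := by
    rw [hYt]
    calc _ = Matrix.diagonal e * (Wᵀ * W) * Matrix.diagonal e := by simp only [Matrix.mul_assoc]
      _ = 1 := by rw [hWW, Matrix.mul_one, hee]
  have hTsvd : T = W * Matrix.diagonal t * (W * Matrix.diagonal e)ᵀ := by
    rw [hYt]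
    calc T = T * W * Wᵀ := by rw [Matrix.mul_assoc, hWW', Matrix.mul_one]
      _ = W * (Matrix.diagonal t * Matrix.diagonal e) * Wᵀ := by
          rw [hTW, Matrix.diagonal_mul_diagonal]; simp only [hte]
      _ = _ := by simp only [Matrix.mul_assoc]
  have hpos : ∀ i : Fin d, (i : ℕ) < k → e i = 1 := fun i hi => by
    have h1 : sigmaMin M - δ ≤ t i :=
      sub_le_of_svd_perturbation h.hX h.hY h.eq hWW hYY (fun _ => abs_nonneg _) hTsvd h.pos h.le
        hTM hi (abs_nonneg _) (fun l hl => hanti hl)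
    by_contra hne
    have hneg : g (π i) < 0 := by
      by_contra h2
      exact hne (by simp only [he]; rw [if_pos (not_lt.1 h2)])
    simp only [ht, abs_of_neg hneg] at h1
    have hn : ‖w (π i)‖ = 1 := w.orthonormal.1 _
    have h2 : inner ℝ (w (π i)) (act T (w (π i))) = g (π i) := by
      rw [hTw, inner_smul_right, real_inner_self_eq_norm_sq, hn]; simp
    have h3 : 0 ≤ inner ℝ (w (π i)) (act M (w (π i))) := by
      have := hpsd.dotProduct_mulVec_nonneg (fun a => w (π i) a)
      simp only [PiLp.inner_apply, act_apply, RCLike.inner_apply, conj_trivial]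
      simp only [dotProduct, Matrix.mulVec, Pi.star_apply, star_trivial] at this
      simpa only [mul_comm] using this
    have h4 := real_inner_le_norm (w (π i)) (act M (w (π i)) - act T (w (π i)))
    rw [inner_sub_right, h2, norm_sub_rev, hn, one_mul] at h4
    have h5 := hTM (w (π i))
    rw [hn] at h5
    linarith
  set J := (1 : Matrix (Fin d) (Fin d) ℝ).submatrix id (Fin.castLE hkd) with hJ
  set r : Fin d → ℝ := fun i => √(t i) with hr
  refine ⟨W * Matrix.diagonal r * J, d, W, t, W * Matrix.diagonal e, hWW, hYY, hanti,
    fun _ => abs_nonneg _, hTsvd, ?_⟩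
  rw [hYt]
  have h6 : W * Matrix.diagonal r * J * (W * Matrix.diagonal r * J)ᵀ =
      W * (Matrix.diagonal r * (J * Jᵀ) * Matrix.diagonal r) * Wᵀ := by
    simp only [Matrix.transpose_mul, Matrix.diagonal_transpose, Matrix.mul_assoc]
  rw [h6, hJ, castLE_mul_transpose, ← Matrix.mul_assoc _ (Matrix.diagonal e),
    Matrix.mul_assoc W _ (Matrix.diagonal e), Matrix.diagonal_mul_diagonal,
    Matrix.diagonal_mul_diagonal, Matrix.diagonal_mul_diagonal]
  congr 3
  ext i
  by_cases hi : (i : ℕ) < k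
  · simp [hi, firstInd, hr, hpos i hi, ht]
  · simp [hi, firstInd]

end SymmetricTruncation

section Rectangular

variable {d₁ d₂ k : ℕ}

/-- Sums of edge matrices of the complete bipartite graph are dilations. -/
lemma sum_bipartite_edgeMat (c : Fin d₁ × Fin d₂ → ℝ) (a : Fin d₁ × Fin d₂ → ℝ) :
    ∑ e, c e • edgeMat (fun e : Fin d₁ × Fin d₂ => (Sum.inl e.1 : Fin d₁ ⊕ Fin d₂))
      (fun e => Sum.inr e.2) a e = dilation (Matrix.of fun i j => c (i, j) * a (i, j)) := by
  ext x y
  rw [Matrix.sum_apply]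
  simp only [edgeMat, Matrix.smul_apply, Matrix.add_apply, Matrix.single_apply, smul_eq_mul]
  rcases x with i | i <;> rcases y with j | j
  · simp [dilation]
  · rw [Finset.sum_eq_single (i, j)]
    · simp [dilation]
    · rintro ⟨i', j'⟩ _ hne
      have : ¬ (i' = i ∧ j' = j) := fun h => hne (by rw [h.1, h.2])
      simp [this]
    · simp
  · rw [Finset.sum_eq_single (j, i)]
    · simp [dilation]
    · rintro ⟨i', j'⟩ _ hne
      have : ¬ (j' = i ∧ i' = j) := fun h => hne (by rw [h.1, h.2])
      simp [this]
    · simp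
  · simp [dilation]

lemma dilation_add (A B : Matrix (Fin d₁) (Fin d₂) ℝ) :
    dilation A + dilation B = dilation (A + B) := by
  simp [dilation, Matrix.fromBlocks_add, Matrix.transpose_add]

lemma dilation_transpose (A : Matrix (Fin d₁) (Fin d₂) ℝ) : (dilation A)ᵀ = dilation A := by
  simp [dilation, Matrix.fromBlocks_transpose]

/-- The vector of the dilated space with the given second component. -/
def inRight (y : EuclideanSpace ℝ (Fin d₂)) : EuclideanSpace ℝ (Fin d₁ ⊕ Fin d₂) :=
  WithLp.toLp 2 (Sum.elim 0 y)

lemma leftPart_inRight (y : EuclideanSpace ℝ (Fin d₂)) :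
    leftPart (inRight (d₁ := d₁) y) = 0 := by ext i; simp [leftPart, inRight]

lemma rightPart_inRight (y : EuclideanSpace ℝ (Fin d₂)) :
    rightPart (inRight (d₁ := d₁) y) = y := by ext i; simp [rightPart, inRight]

lemma norm_inRight (y : EuclideanSpace ℝ (Fin d₂)) : ‖inRight (d₁ := d₁) y‖ = ‖y‖ := by
  have := norm_sq_parts (inRight (d₁ := d₁) y)
  rw [leftPart_inRight, rightPart_inRight] at this
  simpa using this

lemma norm_leftPart_le (z : EuclideanSpace ℝ (Fin d₁ ⊕ Fin d₂)) : ‖leftPart z‖ ≤ ‖z‖ := by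
  refine le_of_abs_le (abs_le_of_sq_le_sq ?_ (norm_nonneg _))
  rw [norm_sq_parts z]; nlinarith [sq_nonneg ‖rightPart z‖]

lemma norm_rightPart_le (z : EuclideanSpace ℝ (Fin d₁ ⊕ Fin d₂)) : ‖rightPart z‖ ≤ ‖z‖ := by
  refine le_of_abs_le (abs_le_of_sq_le_sq ?_ (norm_nonneg _))
  rw [norm_sq_parts z]; nlinarith [sq_nonneg ‖leftPart z‖]

lemma leftPart_single_inr (j : Fin d₂) :
    leftPart (EuclideanSpace.single (Sum.inr j : Fin d₁ ⊕ Fin d₂) (1 : ℝ)) = 0 := by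
  ext i; simp [leftPart]

lemma rightPart_single_inl (i : Fin d₁) :
    rightPart (EuclideanSpace.single (Sum.inl i : Fin d₁ ⊕ Fin d₂) (1 : ℝ)) = 0 := by
  ext j; simp [rightPart]

lemma rightPart_single_inr (j : Fin d₂) :
    rightPart (EuclideanSpace.single (Sum.inr j : Fin d₁ ⊕ Fin d₂) (1 : ℝ)) =
      EuclideanSpace.single j 1 := by
  ext i; simp [rightPart]

lemma leftPart_single_inl (i : Fin d₁) :
    leftPart (EuclideanSpace.single (Sum.inl i : Fin d₁ ⊕ Fin d₂) (1 : ℝ)) =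
      EuclideanSpace.single i 1 := by
  ext j; simp [leftPart]

/-- `T` is close to `M`, and its spectral truncations have incoherent rows and columns. -/
def GoodTruncation (M T : Matrix (Fin d₁) (Fin d₂) ℝ) (r : ℕ) (ρ₁ ρ₂ : ℝ) : Prop :=
  (∀ x, ‖act T x - act M x‖ ≤ sigmaMin M / (100 * √r) * ‖x‖) ∧
    ∀ PX PY, SVDGap T PX PY (3 / 4 * sigmaMin M) (1 / 4 * sigmaMin M) →
      (∀ i, rowNorm (T * PY) i ≤ 13 / 10 * (ρ₁ * specNorm M)) ∧
      ∀ j, rowNorm (T * PY)ᵀ j ≤ 13 / 10 * (ρ₂ * specNorm M)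

/-- The dilation of `M` with centred noise on the complete bipartite graph. -/
def noisyDilation (M : Matrix (Fin d₁) (Fin d₂) ℝ) (m : ℕ) (ω : Fin d₁ × Fin d₂ → Bool) :
    Matrix (Fin d₁ ⊕ Fin d₂) (Fin d₁ ⊕ Fin d₂) ℝ :=
  dilation M + bernSum ((m : ℝ) / ((d₁ : ℝ) * d₂))
    (edgeMat (fun e => Sum.inl e.1) (fun e => Sum.inr e.2) (fun e => M e.1 e.2)) ω

/-- The dilation is well approximated by `T`, and spectral truncations of `T` have small rows. -/
def GoodDilation (M : Matrix (Fin d₁) (Fin d₂) ℝ) (T : Matrix (Fin d₁ ⊕ Fin d₂) (Fin d₁ ⊕ Fin d₂) ℝ)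
    (r : ℕ) (R : Fin d₁ ⊕ Fin d₂ → ℝ) : Prop :=
  (∀ x, ‖act T x - act (dilation M) x‖ ≤ sigmaMin M / (100 * √r) * ‖x‖) ∧
    ∀ P, SpectralGap (act T) P (3 / 4 * sigmaMin M) (1 / 4 * sigmaMin M) →
      ∀ i, ‖act T (P (EuclideanSpace.single i 1))‖ ≤ 13 / 10 * (R i * specNorm M)

lemma goodTruncation_of_dilation {M T : Matrix (Fin d₁) (Fin d₂) ℝ} {r : ℕ} {R : Fin d₁ ⊕ Fin d₂ → ℝ}
    {ρ₁ ρ₂ : ℝ} (hσ : 0 < sigmaMin M) (h1 : ∀ i, R (Sum.inl i) = ρ₁) (h2 : ∀ i, R (Sum.inr i) = ρ₂)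
    (h : GoodDilation M (dilation T) r R) :
    GoodTruncation M T r ρ₁ ρ₂ := by
  refine ⟨fun y => ?_, fun PX PY hgap => ?_⟩
  · have := (norm_leftPart_le _).trans (h.1 (inRight y))
    rwa [leftPart_sub, leftPart_dilation, leftPart_dilation, rightPart_inRight, norm_inRight] at this
  have hP := h.2 _ (hgap.dilation_spectralGap (by positivity) (by positivity))
  refine ⟨fun i => ?_, fun j => ?_⟩
  · have := (norm_rightPart_le _).trans (hP (Sum.inl i))
    rw [rightPart_dilation, leftPart_blockDiag, leftPart_single_inl, h1, ← act_mul] at this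
    rwa [rowNorm_eq, hgap.comm, Matrix.transpose_mul, hgap.symmX]
  · have := (norm_leftPart_le _).trans (hP (Sum.inr j))
    rw [leftPart_dilation, rightPart_blockDiag, rightPart_single_inr, h2, ← act_mul] at this
    rwa [rowNorm_eq, Matrix.transpose_transpose]

/-- The indicator function of a set. -/
def pattern {ι : Type*} (Ω : Set ι) : ι → Bool := by
  classical exact fun e => decide (e ∈ Ω)

lemma pattern_eq_true {ι : Type*} (Ω : Set ι) (e : ι) : pattern Ω e = true ↔ e ∈ Ω := by
  simp [pattern]

lemma successes_pattern {ι : Type*} [Fintype ι] (Ω : Set ι) : successes (pattern Ω) = Ω.ncard := by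
  classical
  rw [successes, Set.ncard_eq_toFinset_card']
  congr 1
  ext e
  simp [pattern_eq_true]

/-- The matrix `M` observed at the successes and rescaled is `M` plus centred noise. -/
lemma noisyDilation_pattern (M : Matrix (Fin d₁) (Fin d₂) ℝ) (Ω : Set (Fin d₁ × Fin d₂)) :
    noisyDilation M Ω.ncard (pattern Ω) = dilation (rescaledObs Ω M) := by
  rw [noisyDilation, bernSum, sum_bipartite_edgeMat, dilation_add]
  congr 1
  ext i j
  by_cases h : (i, j) ∈ Ω
  · have h2 : pattern Ω (i, j) = true := (pattern_eq_true _ _).2 h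
    simp [rescaledObs, proj, h, bernXi, h2]; ring
  · have h2 : pattern Ω (i, j) = false := by
      rw [← Bool.not_eq_true, pattern_eq_true]; exact h
    simp [rescaledObs, proj, h, bernXi, h2]

lemma two_le_of_one_le_max_of_ne_one {d : ℝ} (hd : d = max (d₁ : ℝ) (d₂ : ℝ)) (h : d ≠ 1) (h1 : 1 ≤ d) :
    2 ≤ d := by
  have : d = ((max d₁ d₂ : ℕ) : ℝ) := by rw [hd]; simp
  rw [this] at h h1 ⊢
  have h1' : 1 ≤ max d₁ d₂ := by exact_mod_cast h1
  have h' : max d₁ d₂ ≠ 1 := by exact_mod_cast h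
  exact_mod_cast (show 2 ≤ max d₁ d₂ by omega)

lemma one_le_twenty_log {d : ℝ} (hd : 2 ≤ d) : 1 ≤ 20 * Real.log d := by
  have := Real.log_le_log (by norm_num) hd
  have := Real.log_two_gt_d9
  linarith

lemma exp_neg_twenty_log {d : ℝ} (hd : 0 < d) : Real.exp (-(20 * Real.log d)) = 1 / d ^ 20 := by
  rw [show -(20 * Real.log d) = -Real.log (d ^ 20) by rw [Real.log_pow]; norm_num, Real.exp_neg,
    Real.exp_log (by positivity), one_div]

lemma failure_le {d N V : ℝ} (hd : 2 ≤ d) (hN : N ≤ d ^ 2) (hV0 : 0 ≤ V) (hV : V ≤ 2 * d) :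
    (N + 1) * (3 * V ^ 2 * Real.exp (-(20 * Real.log d))) ≤ 1 / d ^ 10 := by
  have hd0 : 0 < d := by linarith
  rw [exp_neg_twenty_log hd0]
  have h6 : (24 : ℝ) ≤ d ^ 6 := by
    calc (24 : ℝ) ≤ 2 ^ 6 := by norm_num
      _ ≤ d ^ 6 := by gcongr
  have h1 : N + 1 ≤ 2 * d ^ 2 := by nlinarith
  calc (N + 1) * (3 * V ^ 2 * (1 / d ^ 20)) ≤ 2 * d ^ 2 * (3 * (2 * d) ^ 2 * (1 / d ^ 20)) := by
        gcongr
    _ = 24 / d ^ 16 := by field_simp; ring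
    _ ≤ d ^ 6 / d ^ 16 := by gcongr
    _ = 1 / d ^ 10 := by field_simp

lemma IncoherentSVD.act_eq_zero {M : Matrix (Fin d₁) (Fin d₂) ℝ} {μ : ℝ}
    {X : Matrix (Fin d₁) (Fin k) ℝ} {s : Fin k → ℝ} {Y : Matrix (Fin d₂) (Fin k) ℝ}
    (h : IncoherentSVD M k μ X s Y) {x : EuclideanSpace ℝ (Fin d₂)} (hx : act Yᵀ x = 0) :
    act M x = 0 := by
  rw [h.eq, act_mul, hx, map_zero]

lemma IncoherentSVD.act_transpose_eq_zero {M : Matrix (Fin d₁) (Fin d₂) ℝ} {μ : ℝ}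
    {X : Matrix (Fin d₁) (Fin k) ℝ} {s : Fin k → ℝ} {Y : Matrix (Fin d₂) (Fin k) ℝ}
    (h : IncoherentSVD M k μ X s Y) {x : EuclideanSpace ℝ (Fin d₁)} (hx : act Xᵀ x = 0) :
    act Mᵀ x = 0 := by
  rw [h.transpose, act_mul, hx, map_zero]

/-- The coordinates of a vector of the dilated space in the singular subspaces. -/
def dilationCoord (X : Matrix (Fin d₁) (Fin k) ℝ) (Y : Matrix (Fin d₂) (Fin k) ℝ) :
    EuclideanSpace ℝ (Fin d₁ ⊕ Fin d₂) →ₗ[ℝ] (Fin k ⊕ Fin k → ℝ) where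
  toFun z := Sum.elim (act Xᵀ (leftPart z)) (act Yᵀ (rightPart z))
  map_add' z w := by
    have h1 : leftPart (z + w) = leftPart z + leftPart w := rfl
    have h2 : rightPart (z + w) = rightPart z + rightPart w := rfl
    ext i; rcases i with i | i <;> simp only [h1, h2, map_add] <;> simp
  map_smul' c z := by
    have h1 : leftPart (c • z) = c • leftPart z := rfl
    have h2 : rightPart (c • z) = c • rightPart z := rfl
    ext i; rcases i with i | i <;> simp only [h1, h2, map_smul] <;> simp

/-- The number of observations that suffices. -/
def sampleThreshold (M : Matrix (Fin d₁) (Fin d₂) ℝ) (k : ℕ) (μ d : ℝ) : ℝ :=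
  10 ^ 10 * μ * d * k ^ 2 * condNum M ^ 2 * Real.log d

lemma IncoherentSVD.dim_pos {M : Matrix (Fin d₁) (Fin d₂) ℝ} {μ : ℝ}
    {X : Matrix (Fin d₁) (Fin k) ℝ} {s : Fin k → ℝ} {Y : Matrix (Fin d₂) (Fin k) ℝ}
    (h : IncoherentSVD M k μ X s Y) (hk : 1 ≤ k) : 0 < d₁ ∧ 0 < d₂ := by
  have h1 := Matrix.rank_le_height M
  have h2 := Matrix.rank_le_width M
  have := h.rank
  constructor <;> omega

lemma IncoherentSVD.one_le_condNum {M : Matrix (Fin d₁) (Fin d₂) ℝ} {μ : ℝ}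
    {X : Matrix (Fin d₁) (Fin k) ℝ} {s : Fin k → ℝ} {Y : Matrix (Fin d₂) (Fin k) ℝ}
    (h : IncoherentSVD M k μ X s Y) : 1 ≤ condNum M := by
  rw [condNum, le_div_iff₀ h.pos, one_mul]; exact h.sigma_le

lemma IncoherentSVD.specNorm_eq {M : Matrix (Fin d₁) (Fin d₂) ℝ} {μ : ℝ}
    {X : Matrix (Fin d₁) (Fin k) ℝ} {s : Fin k → ℝ} {Y : Matrix (Fin d₂) (Fin k) ℝ}
    (h : IncoherentSVD M k μ X s Y) : specNorm M = condNum M * sigmaMin M := by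
  rw [condNum, div_mul_cancel₀ _ h.pos.ne']

lemma IncoherentSVD.bernP_not_good_le {M : Matrix (Fin d₁) (Fin d₂) ℝ} {μ : ℝ}
    {X : Matrix (Fin d₁) (Fin k) ℝ} {s : Fin k → ℝ} {Y : Matrix (Fin d₂) (Fin k) ℝ}
    (h : IncoherentSVD M k μ X s Y) (hk : 1 ≤ k) {d : ℝ} (hd : d = max (d₁ : ℝ) (d₂ : ℝ))
    (hd2 : 2 ≤ d) {m : ℕ} (hm : m ≤ d₁ * d₂) (hmt : sampleThreshold M k μ d ≤ m) :
    bernP ((m : ℝ) / ((d₁ : ℝ) * d₂)) (fun ω => ¬ GoodDilation M (noisyDilation M m ω) (2 * k)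
      (Sum.elim (fun _ => √(μ * k / d₁)) (fun _ => √(μ * k / d₂)))) ≤
      3 * ((d₁ + d₂ : ℕ) : ℝ) ^ 2 * Real.exp (-(20 * Real.log d)) := by
  obtain ⟨hd₁, hd₂⟩ := h.dim_pos hk
  have hd₁' : (0 : ℝ) < d₁ := by exact_mod_cast hd₁
  have hd₂' : (0 : ℝ) < d₂ := by exact_mod_cast hd₂
  have hk' : (1 : ℝ) ≤ k := by exact_mod_cast hk
  have hκ := h.one_le_condNum
  have hμ := h.one_le
  have hσ := h.pos
  have hS := h.specNorm_eq
  have hL := one_le_twenty_log hd2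
  have hlog : 0 < Real.log d := by linarith
  have hthr : 0 < sampleThreshold M k μ d := by rw [sampleThreshold]; positivity
  have hm0 : (0 : ℝ) < m := hthr.trans_le hmt
  have hN : (0 : ℝ) < (d₁ : ℝ) * d₂ := by positivity
  have hp : 0 < (m : ℝ) / ((d₁ : ℝ) * d₂) := by positivity
  have hp1 : (m : ℝ) / ((d₁ : ℝ) * d₂) ≤ 1 := by
    rw [div_le_one hN]; exact_mod_cast hm
  have hd1d : (d₁ : ℝ) ≤ d := hd ▸ le_max_left _ _
  have hd2d : (d₂ : ℝ) ≤ d := hd ▸ le_max_right _ _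
  have hg : SpectralGap (act (dilation M)) _ (sigmaMin M) 0 :=
    h.svdGap.dilation_spectralGap hσ.le le_rfl
  have key : ∀ a b : ℝ, 0 < a → 0 < b → b ≤ d → a * b = (d₁ : ℝ) * d₂ →
      √(μ * k / a) ^ 2 * (20 * Real.log d) * ((2 * k : ℕ) : ℝ) * specNorm M ^ 2 ≤
        1 / 10 ^ 7 * sigmaMin M ^ 2 * ((m : ℝ) / ((d₁ : ℝ) * d₂)) := by
    intro a b ha hb hbd hab
    rw [Real.sq_sqrt (by positivity), hS, ← hab]
    push_cast
    calc _ = sigmaMin M ^ 2 / (a * b) * (40 * μ * b * k ^ 2 * condNum M ^ 2 * Real.log d) := by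
          field_simp; ring
      _ ≤ sigmaMin M ^ 2 / (a * b) * (1 / 10 ^ 7 * m) := by
          refine mul_le_mul_of_nonneg_left ?_ (by positivity)
          calc _ ≤ 40 * μ * d * k ^ 2 * condNum M ^ 2 * Real.log d := by gcongr
            _ ≤ 1 / 10 ^ 7 * sampleThreshold M k μ d := by
                rw [sampleThreshold]
                have : 0 ≤ μ * d * k ^ 2 * condNum M ^ 2 * Real.log d := by positivity
                nlinarith
            _ ≤ _ := by gcongr
      _ = _ := by field_simp
  have := bernP_not_incoherent_truncation_le (V := Fin d₁ ⊕ Fin d₂) (β := Fin d₁ × Fin d₂)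
    (u := fun e => Sum.inl e.1) (v := fun e => Sum.inr e.2) (a := fun e => M e.1 e.2) hp hp1
    (fun _ => Sum.inl_ne_inr) hL (r := 2 * k) (by omega)
    (R := Sum.elim (fun _ => √(μ * k / d₁)) (fun _ => √(μ * k / d₂)))
    (by rintro (i | i) <;> simp only [Sum.elim_inl, Sum.elim_inr] <;> positivity)
    hσ h.sigma_le ?_ ?_ ?_ (dilation_transpose M) hg (κ := Fin k ⊕ Fin k) (by simp; omega)
    (dilationCoord X Y) ?_ (fun x => by rw [sub_self, norm_zero]; positivity)
    (b := fun i => act (dilation M) (EuclideanSpace.single i 1)) (c := fun _ => 0)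
    (fun i => by simp) ?_ (fun i => by rw [abs_zero]; positivity)
  · refine this.trans_eq ?_
    simp
  · rintro (i | i)
    · have h1 : (∑ e : Fin d₁ × Fin d₂, if (Sum.inl e.1 : Fin d₁ ⊕ Fin d₂) = Sum.inl i ∨
          (Sum.inr e.2 : Fin d₁ ⊕ Fin d₂) = Sum.inl i then M e.1 e.2 ^ 2 else 0) =
          rowNorm M i ^ 2 := by
        rw [rowNorm_sq, Fintype.sum_prod_type, Finset.sum_eq_single i]
        · simp
        · intro b _ hb; simp [hb]
        · simp
      have h2 := h.norm_row_le i
      rw [← rowNorm_eq] at h2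
      have h3 : rowNorm M i ^ 2 ≤ (√(μ * k / d₁) * specNorm M) ^ 2 := by
        have := rowNorm_nonneg M i
        gcongr
      refine h1.trans_le ?_
      simp only [Sum.elim_inl]
      nlinarith [sq_nonneg (√(μ * k / d₁) * specNorm M)]
    · have h1 : (∑ e : Fin d₁ × Fin d₂, if (Sum.inl e.1 : Fin d₁ ⊕ Fin d₂) = Sum.inr i ∨
          (Sum.inr e.2 : Fin d₁ ⊕ Fin d₂) = Sum.inr i then M e.1 e.2 ^ 2 else 0) =
          rowNorm Mᵀ i ^ 2 := by
        rw [rowNorm_sq, Fintype.sum_prod_type]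
        refine Finset.sum_congr rfl fun a _ => ?_
        rw [Finset.sum_eq_single i]
        · simp
        · intro b _ hb; simp [hb]
        · simp
      have h2 := h.norm_col_le i
      have h2' : rowNorm Mᵀ i ≤ √(μ * k / d₂) * specNorm M := by
        rwa [rowNorm_eq, Matrix.transpose_transpose]
      have h3 : rowNorm Mᵀ i ^ 2 ≤ (√(μ * k / d₂) * specNorm M) ^ 2 := by
        have := rowNorm_nonneg Mᵀ i
        gcongr
      refine h1.trans_le ?_
      simp only [Sum.elim_inr]
      nlinarith [sq_nonneg (√(μ * k / d₂) * specNorm M)]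
  · intro e
    have h1 := h.abs_entry_le e.1 e.2
    have h2 : M e.1 e.2 ^ 2 ≤ (√(μ * k / d₁) * √(μ * k / d₂) * specNorm M) ^ 2 := by
      rw [← sq_abs (M e.1 e.2)]; gcongr
    simp only [Sum.elim_inl, Sum.elim_inr]
    nlinarith [sq_nonneg (√(μ * k / d₁) * √(μ * k / d₂) * specNorm M)]
  · rintro (i | i)
    · exact key d₁ d₂ hd₁' hd₂' hd2d rfl
    · exact key d₂ d₁ hd₂' hd₁' hd1d (mul_comm _ _)
  · intro x hx
    have hx1 : act Xᵀ (leftPart x) = 0 := by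
      ext i; exact congrFun hx (Sum.inl i)
    have hx2 : act Yᵀ (rightPart x) = 0 := by
      ext i; exact congrFun hx (Sum.inr i)
    refine ext_parts ?_ ?_
    · rw [leftPart_dilation, h.act_eq_zero hx2]; rfl
    · rw [rightPart_dilation, h.act_transpose_eq_zero hx1]; rfl
  · have hn : ∀ t : ℝ, 0 ≤ t → t ≤ 101 / 100 * t := fun t ht => by linarith
    rintro (i | i)
    · refine le_trans ?_ (hn _ (by simp only [Sum.elim_inl]; have := specNorm_nonneg M; positivity))
      simp only [Sum.elim_inl]
      refine le_trans (le_of_abs_le (abs_le_of_sq_le_sq ?_ (norm_nonneg _))) (h.norm_row_le i)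
      rw [norm_sq_parts, leftPart_dilation, rightPart_dilation, rightPart_single_inl,
        leftPart_single_inl]
      simp
    · refine le_trans ?_ (hn _ (by simp only [Sum.elim_inr]; have := specNorm_nonneg M; positivity))
      simp only [Sum.elim_inr]
      refine le_trans (le_of_abs_le (abs_le_of_sq_le_sq ?_ (norm_nonneg _))) (h.norm_col_le i)
      rw [norm_sq_parts, leftPart_dilation, rightPart_dilation, rightPart_single_inr,
        leftPart_single_inr]
      simp

lemma bernP_eq_zero_of_forall_not {β : Type*} [Fintype β] [DecidableEq β] {p : ℝ}
    {A : (β → Bool) → Prop} (h : ∀ ω, ¬ A ω) : bernP p A = 0 := by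
  simp [bernP, bernE, h]

/-- The rescaled observations satisfy the strong form of the conclusion with high probability. -/
theorem IncoherentSVD.le_real_goodTruncation {M : Matrix (Fin d₁) (Fin d₂) ℝ} {μ : ℝ}
    {X : Matrix (Fin d₁) (Fin k) ℝ} {s : Fin k → ℝ} {Y : Matrix (Fin d₂) (Fin k) ℝ}
    (h : IncoherentSVD M k μ X s Y) (hk : 1 ≤ k) {d : ℝ} (hd : d = max (d₁ : ℝ) (d₂ : ℝ))
    {P : Measure (Set (Fin d₁ × Fin d₂))} (hP : IsUniformSampling P) :
    1 - 1 / d ^ 10 ≤ P.real {Ω | sampleThreshold M k μ d ≤ (Ω.ncard : ℝ) →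
      GoodTruncation M (rescaledObs Ω M) (2 * k) √(μ * k / d₁) √(μ * k / d₂)} := by
  obtain ⟨hd₁, hd₂⟩ := h.dim_pos hk
  have hd1 : (1 : ℝ) ≤ d := by
    rw [hd]; exact le_max_of_le_left (by exact_mod_cast hd₁)
  by_cases hdne : d = 1
  · rw [hdne]; simp
  have hd2 := two_le_of_one_le_max_of_ne_one hd hdne hd1
  have : Nonempty (Fin d₁ × Fin d₂) := ⟨(⟨0, hd₁⟩, ⟨0, hd₂⟩)⟩
  have hcard : Fintype.card (Fin d₁ × Fin d₂) = d₁ * d₂ := by simp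
  have hd1d : (d₁ : ℝ) ≤ d := hd ▸ le_max_left _ _
  have hd2d : (d₂ : ℝ) ≤ d := hd ▸ le_max_right _ _
  set core : ℕ → (Fin d₁ × Fin d₂ → Bool) → Prop := fun m ω =>
    GoodDilation M (noisyDilation M m ω) (2 * k)
      (Sum.elim (fun _ => √(μ * k / d₁)) (fun _ => √(μ * k / d₂))) with hcore
  set Bad : Unit → (Fin d₁ × Fin d₂ → Bool) → Prop := fun _ ω =>
    sampleThreshold M k μ d ≤ successes ω ∧ ¬ core (successes ω) ω with hBad
  refine le_trans ?_ (hP.le_real_of_bernP (fun _ => ()) (fun Ω => pattern Ω) ?_ ?_ Bad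
    (ε := 3 * ((d₁ + d₂ : ℕ) : ℝ) ^ 2 * Real.exp (-(20 * Real.log d))) ?_ _ ?_)
  · rw [hcard]
    have := failure_le (d := d) (N := ((d₁ * d₂ : ℕ) : ℝ)) (V := ((d₁ + d₂ : ℕ) : ℝ)) hd2
      (by push_cast; nlinarith) (by positivity) (by push_cast; linarith)
    linarith
  · refine fun τ => ⟨τ, fun Ω => ⟨rfl, fun e => ?_⟩⟩
    rw [Bool.eq_iff_iff, pattern_eq_true, pattern_eq_true]
    exact τ.injective.mem_set_image
  · rw [hcard]; positivity
  · intro _ m hm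
    rw [hcard] at hm ⊢
    rw [Nat.cast_mul]
    by_cases hmt : sampleThreshold M k μ d ≤ m
    · refine le_trans (bernP_mono (by positivity) ?_ ?_) (h.bernP_not_good_le hk hd hd2 hm hmt)
      · rw [div_le_one (by positivity)]; exact_mod_cast hm
      · rintro ω ⟨rfl, hω⟩
        exact hω.2
    · rw [bernP_eq_zero_of_forall_not]
      · positivity
      · rintro ω ⟨rfl, hω⟩
        exact hmt hω.1
  · intro Ω hΩ hthr
    rw [← successes_pattern] at hthr
    have h1 : core (successes (pattern Ω)) (pattern Ω) := by
      by_contra hne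
      exact hΩ ⟨hthr, hne⟩
    rw [successes_pattern, hcore] at h1
    simp only [noisyDilation_pattern] at h1
    exact goodTruncation_of_dilation h.pos (fun _ => rfl) (fun _ => rfl) h1

end Rectangular

section Consequences

variable {d₁ d₂ k : ℕ}

/-- A truncated singular value decomposition of a matrix close to `M` is close to `M`. -/
lemma IncoherentSVD.truncation_spec {M T : Matrix (Fin d₁) (Fin d₂) ℝ} {μ : ℝ}
    {X : Matrix (Fin d₁) (Fin k) ℝ} {s : Fin k → ℝ} {Y : Matrix (Fin d₂) (Fin k) ℝ}
    (h : IncoherentSVD M k μ X s Y) (hk : 1 ≤ k) {r : ℕ} (hr : k ≤ r)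
    (hTM : ∀ x, ‖act T x - act M x‖ ≤ sigmaMin M / (100 * √r) * ‖x‖)
    {U : Matrix (Fin d₁) (Fin k) ℝ} {V : Matrix (Fin d₂) (Fin k) ℝ}
    (hB : IsTopSVD k T (U * Vᵀ)) :
    frobNorm (M - U * Vᵀ) ≤ 1 / 20 * sigmaMin M ∧
      ∃ PX PY, SVDGap T PX PY (99 / 100 * sigmaMin M) (1 / 4 * sigmaMin M) ∧ U * Vᵀ = T * PY ∧
        ∃ n, ∃ X' Y' : Matrix _ (Fin n) ℝ, ∃ s' : Fin n → ℝ, X'ᵀ * X' = 1 ∧ Y'ᵀ * Y' = 1 ∧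
        (∀ i : Fin n, (i : ℕ) < k → 0 < s' i) ∧
        U * Vᵀ = X' * Matrix.diagonal (fun i : Fin n => if (i : ℕ) < k then s' i else 0) * Y'ᵀ ∧
        PX = X' * Matrix.diagonal (firstInd n k) * X'ᵀ ∧
        PY = Y' * Matrix.diagonal (firstInd n k) * Y'ᵀ := by
  have hσ := h.pos
  have hr1 : (1 : ℝ) ≤ r := by exact_mod_cast hk.trans hr
  have hsr : 1 ≤ √(r : ℝ) := by rw [Real.one_le_sqrt]; exact hr1
  have hkr : (k : ℝ) ≤ r := by exact_mod_cast hr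
  set δ := sigmaMin M / (100 * √r) with hδ
  have hδ0 : 0 ≤ δ := by positivity
  have hδ1 : δ ≤ 1 / 100 * sigmaMin M := by
    rw [hδ, div_le_iff₀ (by positivity)]; nlinarith
  obtain ⟨PX, PY, hgap, hB1, -, n, X', Y', s', hX', hY', hs', hB2, hPX, hPY⟩ :=
    h.exists_svdGap hδ0 (by linarith) hTM hB
  refine ⟨?_, PX, PY, hgap.mono (by linarith) (by linarith), hB1, n, X', Y', s', hX', hY',
    fun i hi => lt_of_lt_of_le (by linarith) (hs' i hi), hB2, hPX, hPY⟩
  refine (frobNorm_sub_le hδ0 h.rank hTM hgap hB1).trans ?_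
  have h1 : √(2 * k : ℝ) ≤ 5 / 2 * √r := by
    rw [show (5 / 2 : ℝ) = √((5 / 2) ^ 2) by rw [Real.sqrt_sq (by norm_num)],
      ← Real.sqrt_mul (by positivity)]
    exact Real.sqrt_le_sqrt (by linarith)
  calc √(2 * k : ℝ) * (2 * δ) ≤ 5 / 2 * √r * (2 * δ) := by gcongr
    _ = 1 / 20 * sigmaMin M := by rw [hδ]; field_simp; norm_num

/-- The approximation error and the row bounds for a truncated singular value decomposition. -/
lemma IncoherentSVD.truncation_bounds {M T : Matrix (Fin d₁) (Fin d₂) ℝ} {μ : ℝ}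
    {X : Matrix (Fin d₁) (Fin k) ℝ} {s : Fin k → ℝ} {Y : Matrix (Fin d₂) (Fin k) ℝ}
    (h : IncoherentSVD M k μ X s Y) (hk : 1 ≤ k)
    (hT : GoodTruncation M T (2 * k) √(μ * k / d₁) √(μ * k / d₂))
    {U : Matrix (Fin d₁) (Fin k) ℝ} {V : Matrix (Fin d₂) (Fin k) ℝ}
    (hB : IsTopSVD k T (U * Vᵀ)) :
    frobNorm (M - U * Vᵀ) ≤ 1 / 20 * sigmaMin M ∧
      (∀ i, rowNorm (U * Vᵀ) i ^ 2 ≤ 169 / 100 * (μ * k / d₁) * specNorm M ^ 2) ∧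
      (∀ j, rowNorm (V * Uᵀ) j ^ 2 ≤ 169 / 100 * (μ * k / d₂) * specNorm M ^ 2) ∧
      (Uᵀ * U = Vᵀ * V →
        (∀ i, 99 / 100 * sigmaMin M * rowNorm U i ^ 2 ≤ rowNorm (U * Vᵀ) i ^ 2) ∧
        ∀ i, 99 / 100 * sigmaMin M * rowNorm V i ^ 2 ≤ rowNorm (V * Uᵀ) i ^ 2) := by
  have hμ := h.one_le
  have hσ := h.pos
  obtain ⟨hF, PX, PY, hgap, hUV, -⟩ := h.truncation_spec hk (r := 2 * k) (by omega) hT.1 hB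
  obtain ⟨h1, h2⟩ := hT.2 PX PY (hgap.mono (by linarith) le_rfl)
  have h3 : (T * PY)ᵀ = V * Uᵀ := by
    rw [← hUV, Matrix.transpose_mul, Matrix.transpose_transpose]
  have sq : ∀ {x ρ : ℝ}, 0 ≤ x → 0 ≤ ρ → x ≤ 13 / 10 * (√ρ * specNorm M) →
      x ^ 2 ≤ 169 / 100 * ρ * specNorm M ^ 2 := by
    intro x ρ hx hρ hxρ
    calc x ^ 2 ≤ (13 / 10 * (√ρ * specNorm M)) ^ 2 := by gcongr
      _ = 169 / 100 * √ρ ^ 2 * specNorm M ^ 2 := by ring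
      _ = _ := by rw [Real.sq_sqrt hρ]
  refine ⟨hF, fun i => sq (rowNorm_nonneg _ _) (by positivity) ?_,
    fun j => sq (rowNorm_nonneg _ _) (by positivity) ?_, fun hb => hgap.le_norm_truncation hb hUV⟩
  · rw [hUV]; exact h1 i
  · rw [← h3]; exact h2 j

lemma balanced_row_le {σ S x ρ : ℝ} (hσ : 0 < σ) (hρ : 0 ≤ ρ)
    (h : 99 / 100 * σ * x ≤ 169 / 100 * ρ * S ^ 2) : x ≤ 10 * ρ * (S / σ) * S := by
  have h1 : 0 ≤ ρ * S ^ 2 := by positivity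
  have h2 : 10 * ρ * (S / σ) * S = 10 * (ρ * S ^ 2) / σ := by ring
  rw [h2, le_div_iff₀ hσ]
  nlinarith

theorem le_real_topSVD (hk : 1 ≤ k) {M : Matrix (Fin d₁) (Fin d₂) ℝ} {μ d : ℝ} (hr : M.rank = k)
    (hM : IsIncoherent M k μ) (hd : d = max (d₁ : ℝ) (d₂ : ℝ))
    {P : Measure (Set (Fin d₁ × Fin d₂))} (hP : IsUniformSampling P) :
    1 - 1 / d ^ 10 ≤
      P.real {Ω | 10 ^ 10 * μ * d * k ^ 2 * condNum M ^ 2 * Real.log d ≤ (Ω.ncard : ℝ) →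
        ∀ (U₀ : Matrix (Fin d₁) (Fin k) ℝ) (V₀ : Matrix (Fin d₂) (Fin k) ℝ),
          IsTopSVD k (rescaledObs Ω M) (U₀ * V₀ᵀ) →
            frobNorm (M - U₀ * V₀ᵀ) ≤ 1 / 20 * sigmaMin M ∧
            (∀ i, rowNorm (U₀ * V₀ᵀ) i ^ 2 ≤ 10 * μ * k / d₁ * specNorm M ^ 2) ∧
            (∀ j, rowNorm (V₀ * U₀ᵀ) j ^ 2 ≤ 10 * μ * k / d₂ * specNorm M ^ 2)} := by
  obtain ⟨X, s, Y, h⟩ := hM.exists_svd hk hr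
  obtain ⟨hd₁, hd₂⟩ := h.dim_pos hk
  have : Nonempty (Fin d₁ × Fin d₂) := ⟨(⟨0, hd₁⟩, ⟨0, hd₂⟩)⟩
  have := hP.isProbabilityMeasure
  refine (h.le_real_goodTruncation hk hd hP).trans (measureReal_mono fun Ω hΩ hthr U V hB => ?_)
  obtain ⟨h1, h2, h3, -⟩ := h.truncation_bounds hk (hΩ hthr) hB
  have hμ := h.one_le
  have e : ∀ D : ℕ, 169 / 100 * (μ * k / D) * specNorm M ^ 2 ≤
      10 * μ * k / D * specNorm M ^ 2 := fun D => by
    rw [show 10 * μ * k / (D : ℝ) = 10 * (μ * k / D) by ring]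
    gcongr
    norm_num
  exact ⟨h1, fun i => (h2 i).trans (e _), fun j => (h3 j).trans (e _)⟩

theorem le_real_balanced_topSVD {d : ℕ} (hk : 1 ≤ k) {M : Matrix (Fin d) (Fin d) ℝ} {μ : ℝ}
    (hr : M.rank = k) (hM : IsIncoherent M k μ)
    {P : Measure (Set (Fin d × Fin d))} (hP : IsUniformSampling P) :
    1 - 1 / (d : ℝ) ^ 10 ≤
      P.real {Ω | 10 ^ 10 * μ * d * k ^ 2 * condNum M ^ 2 * Real.log d ≤ (Ω.ncard : ℝ) →
        ∀ U₀ V₀ : Matrix (Fin d) (Fin k) ℝ, U₀ᵀ * U₀ = V₀ᵀ * V₀ →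
          IsTopSVD k (rescaledObs Ω M) (U₀ * V₀ᵀ) →
            frobNorm (M - U₀ * V₀ᵀ) ≤ 1 / 20 * sigmaMin M ∧
            ∀ j, rowNorm U₀ j ^ 2 ≤ 10 * μ * k * condNum M / d * specNorm M ∧
              rowNorm V₀ j ^ 2 ≤ 10 * μ * k * condNum M / d * specNorm M} := by
  obtain ⟨X, s, Y, h⟩ := hM.exists_svd hk hr
  obtain ⟨hd₁, hd₂⟩ := h.dim_pos hk
  have : Nonempty (Fin d × Fin d) := ⟨(⟨0, hd₁⟩, ⟨0, hd₂⟩)⟩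
  have := hP.isProbabilityMeasure
  refine (h.le_real_goodTruncation hk (d := d) (by simp) hP).trans
    (measureReal_mono fun Ω hΩ hthr U V hbal hB => ?_)
  obtain ⟨h1, h2, h3, h4⟩ := h.truncation_bounds hk (hΩ hthr) hB
  have hμ := h.one_le
  have e : ∀ x, x ≤ 10 * (μ * k / d) * (specNorm M / sigmaMin M) * specNorm M →
      x ≤ 10 * μ * k * condNum M / d * specNorm M := fun x hx => hx.trans_eq (by
    rw [condNum]; ring)
  exact ⟨h1, fun j => ⟨e _ (balanced_row_le h.pos (by positivity) (((h4 hbal).1 j).trans (h2 j))),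
    e _ (balanced_row_le h.pos (by positivity) (((h4 hbal).2 j).trans (h3 j)))⟩⟩

end Consequences

section UpperPositions

variable {d : ℕ}

/-- The positions above the diagonal. -/
abbrev Upper (d : ℕ) : Type := {x : Fin d × Fin d // x.1 < x.2}

lemma sum_upper {α : Type*} [AddCommMonoid α] (F : Fin d × Fin d → α) :
    ∑ e : Upper d, F e.1 = ∑ x, if x.1 < x.2 then F x else 0 := by
  rw [← Finset.sum_filter]
  exact (Finset.sum_subtype _ (by simp) F).symm

/-- The extension of a map of the positions above the diagonal that commutes with transposition and
fixes the diagonal. -/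
def symmExt (f : Upper d → Upper d) (x : Fin d × Fin d) : Fin d × Fin d :=
  if h : x.1 < x.2 then (f ⟨x, h⟩).1
  else if h' : x.2 < x.1 then (f ⟨x.swap, h'⟩).1.swap else x

lemma symmExt_upper (f : Upper d → Upper d) (e : Upper d) : symmExt f e.1 = (f e).1 := by
  rw [symmExt, dif_pos e.2]

lemma symmExt_diag (f : Upper d → Upper d) (i : Fin d) : symmExt f (i, i) = (i, i) := by
  simp [symmExt]

lemma symmExt_swap_upper (f : Upper d → Upper d) (e : Upper d) :
    symmExt f e.1.swap = (f e).1.swap := by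
  have h1 : ¬ e.1.swap.1 < e.1.swap.2 := not_lt.2 e.2.le
  have h2 : e.1.swap.2 < e.1.swap.1 := e.2
  rw [symmExt, dif_neg h1, dif_pos h2]
  rfl

lemma position_cases (x : Fin d × Fin d) :
    (∃ e : Upper d, x = e.1) ∨ (∃ e : Upper d, x = e.1.swap) ∨ ∃ i, x = (i, i) := by
  rcases lt_trichotomy x.1 x.2 with h | h | h
  · exact Or.inl ⟨⟨x, h⟩, rfl⟩
  · exact Or.inr (Or.inr ⟨x.1, Prod.ext rfl h.symm⟩)
  · exact Or.inr (Or.inl ⟨⟨x.swap, h⟩, (Prod.swap_swap x).symm⟩)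

lemma symmExt_symmExt {f g : Upper d → Upper d} (h : ∀ e, f (g e) = e) (x : Fin d × Fin d) :
    symmExt f (symmExt g x) = x := by
  rcases position_cases x with ⟨e, rfl⟩ | ⟨e, rfl⟩ | ⟨i, rfl⟩
  · rw [symmExt_upper, symmExt_upper, h]
  · rw [symmExt_swap_upper, symmExt_swap_upper, h]
  · rw [symmExt_diag, symmExt_diag]

lemma symmExt_swap (f : Upper d → Upper d) (x : Fin d × Fin d) :
    symmExt f x.swap = (symmExt f x).swap := by
  rcases position_cases x with ⟨e, rfl⟩ | ⟨e, rfl⟩ | ⟨i, rfl⟩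
  · rw [symmExt_upper, symmExt_swap_upper]
  · rw [symmExt_swap_upper, Prod.swap_swap, Prod.swap_swap, symmExt_upper]
  · rw [Prod.swap_prod_mk, symmExt_diag, Prod.swap_prod_mk]

/-- The extension of a permutation of the positions above the diagonal. -/
def symmExtPerm (τ : Equiv.Perm (Upper d)) : Equiv.Perm (Fin d × Fin d) where
  toFun := symmExt τ
  invFun := symmExt τ.symm
  left_inv := symmExt_symmExt τ.symm_apply_apply
  right_inv := symmExt_symmExt τ.apply_symm_apply

lemma mem_symmClosure_image (τ : Equiv.Perm (Upper d)) (Ω : Set (Fin d × Fin d))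
    (x : Fin d × Fin d) :
    symmExtPerm τ x ∈ symmClosure (symmExtPerm τ '' Ω) ↔ x ∈ symmClosure Ω := by
  have h : (symmExtPerm τ x).swap = symmExtPerm τ x.swap := (symmExt_swap τ x).symm
  simp only [symmClosure, Set.mem_ofPred_eq]
  rw [h, (symmExtPerm τ).injective.mem_set_image, (symmExtPerm τ).injective.mem_set_image]

/-- The observed diagonal positions. -/
def diagPattern (S : Set (Fin d × Fin d)) (i : Fin d) : Bool := pattern S (i, i)

/-- The observed positions above the diagonal. -/
def upperPattern (S : Set (Fin d × Fin d)) (e : Upper d) : Bool := pattern S e.1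

lemma exists_perm_pattern (τ : Equiv.Perm (Upper d)) : ∃ s : Equiv.Perm (Fin d × Fin d),
    ∀ Ω : Set (Fin d × Fin d),
      diagPattern (symmClosure (s '' Ω)) = diagPattern (symmClosure Ω) ∧
      ∀ e, upperPattern (symmClosure (s '' Ω)) (τ e) = upperPattern (symmClosure Ω) e := by
  refine ⟨symmExtPerm τ, fun Ω => ⟨?_, fun e => ?_⟩⟩
  · ext i
    have h := mem_symmClosure_image τ Ω (i, i)
    have h1 : symmExtPerm τ (i, i) = (i, i) := symmExt_diag τ i
    rw [h1] at h
    rw [diagPattern, diagPattern, Bool.eq_iff_iff, pattern_eq_true, pattern_eq_true, h]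
  · have h := mem_symmClosure_image τ Ω e.1
    have h1 : symmExtPerm τ e.1 = (τ e).1 := symmExt_upper τ e
    rw [h1] at h
    rw [upperPattern, upperPattern, Bool.eq_iff_iff, pattern_eq_true, pattern_eq_true, h]

lemma swap_mem_symmClosure {Ω : Set (Fin d × Fin d)} (x : Fin d × Fin d) :
    x.swap ∈ symmClosure Ω ↔ x ∈ symmClosure Ω := by
  simp [symmClosure, or_comm]

lemma ncard_eq_of_swap_mem {S : Set (Fin d × Fin d)} (hS : ∀ x, x.swap ∈ S ↔ x ∈ S) :
    S.ncard = successes (diagPattern S) + 2 * successes (upperPattern S) := by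
  have h1 := sum_upper (fun x : Fin d × Fin d => if pattern S x = true then 1 else 0)
  have h2 : ∑ x : Fin d × Fin d, (if x.2 < x.1 then (if pattern S x = true then 1 else 0) else 0) =
      ∑ x : Fin d × Fin d, (if x.1 < x.2 then (if pattern S x = true then 1 else 0) else 0) := by
    refine Fintype.sum_equiv (Equiv.prodComm _ _) _ _ fun x => ?_
    have h : pattern S x.swap = pattern S x := by
      rw [Bool.eq_iff_iff, pattern_eq_true, pattern_eq_true, hS]
    simp only [Equiv.prodComm_apply, h, Prod.fst_swap, Prod.snd_swap]
  have h3 : ∑ x : Fin d × Fin d, (if x.1 = x.2 then (if pattern S x = true then 1 else 0) else 0) =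
      ∑ i, if pattern S (i, i) = true then 1 else 0 := by
    rw [Fintype.sum_prod_type]
    refine Finset.sum_congr rfl fun i _ => ?_
    rw [Finset.sum_ite_eq]
    simp
  have hu : successes (upperPattern S) = _ := (Finset.card_filter _ _).trans h1
  have hd : successes (diagPattern S) = _ := (Finset.card_filter _ _).trans h3.symm
  rw [← successes_pattern, hu, hd, two_mul]
  nth_rw 2 [← h2]
  rw [successes, Finset.card_filter, ← Finset.sum_add_distrib, ← Finset.sum_add_distrib]
  refine Finset.sum_congr rfl fun x _ => ?_
  rcases lt_trichotomy x.1 x.2 with h | h | h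
  · simp [h, h.ne, h.not_gt]
  · simp [h]
  · simp [h, h.ne', h.not_gt]

lemma two_mul_card_upper_add : 2 * Fintype.card (Upper d) + d = d * d := by
  have h := ncard_eq_of_swap_mem (S := (Set.univ : Set (Fin d × Fin d))) (by simp)
  have h1 : ∀ {ι : Type} [Fintype ι] (f : ι → Bool), (∀ i, f i = true) →
      successes f = Fintype.card ι := fun f hf => by simp [successes, hf]
  rw [h1 (diagPattern _) (fun i => (pattern_eq_true _ _).2 (Set.mem_univ _)),
    h1 (upperPattern _) (fun i => (pattern_eq_true _ _).2 (Set.mem_univ _)), Set.ncard_univ, Nat.card_eq_fintype_card] at h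
  simp only [Fintype.card_prod, Fintype.card_fin] at h
  omega

lemma sum_upper_edgeMat_apply (c a : Fin d × Fin d → ℝ) (i j : Fin d) :
    (∑ e : Upper d, c e.1 • edgeMat (fun e : Upper d => e.1.1) (fun e => e.1.2)
      (fun e => a e.1) e) i j =
      (if i < j then c (i, j) * a (i, j) else 0) + if j < i then c (j, i) * a (j, i) else 0 := by
  rw [Matrix.sum_apply]
  simp only [edgeMat, Matrix.smul_apply, Matrix.add_apply, Matrix.single_apply, smul_eq_mul]
  rw [sum_upper (fun x : Fin d × Fin d => c x * (a x * ((if x.1 = i ∧ x.2 = j then 1 else 0) +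
    if x.2 = i ∧ x.1 = j then 1 else 0)))]
  have h : ∀ x : Fin d × Fin d, (if x.1 < x.2 then c x * (a x *
      ((if x.1 = i ∧ x.2 = j then 1 else 0) + if x.2 = i ∧ x.1 = j then 1 else 0)) else 0) =
      (if x = (i, j) then (if x.1 < x.2 then c x * a x else 0) else 0) +
      (if x = (j, i) then (if x.1 < x.2 then c x * a x else 0) else 0) := by
    rintro ⟨x, y⟩
    simp only [Prod.mk.injEq, and_comm (a := y = i)]
    split_ifs <;> ring
  rw [Finset.sum_congr rfl fun x _ => h x, Finset.sum_add_distrib, Finset.sum_ite_eq',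
    Finset.sum_ite_eq']
  simp

lemma sum_upper_incident_le {M : Matrix (Fin d) (Fin d) ℝ} (hM : Mᵀ = M) (i : Fin d) :
    (∑ e : Upper d, if e.1.1 = i ∨ e.1.2 = i then M e.1.1 e.1.2 ^ 2 else 0) ≤ rowNorm M i ^ 2 := by
  have hs : ∀ a b, M a b = M b a := fun a b => by
    conv_lhs => rw [← hM]
    rfl
  rw [sum_upper (fun x : Fin d × Fin d => if x.1 = i ∨ x.2 = i then M x.1 x.2 ^ 2 else 0)]
  calc _ ≤ ∑ x : Fin d × Fin d, ((if x.1 = i then (if i < x.2 then M i x.2 ^ 2 else 0) else 0) +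
        if x.2 = i then (if x.1 < i then M i x.1 ^ 2 else 0) else 0) := by
        refine Finset.sum_le_sum fun x _ => ?_
        rcases x with ⟨a, b⟩
        by_cases ha : a = i
        · subst ha
          by_cases hb : b = a
          · subst hb; simp
          · by_cases hab : a < b <;> simp [hab, hb]
        · by_cases hb : b = i
          · subst hb
            by_cases hab : a < b <;> simp [hab, ha, hs a b]
          · simp [ha, hb]
    _ = (∑ b, if i < b then M i b ^ 2 else 0) + ∑ a, if a < i then M i a ^ 2 else 0 := by
        rw [Finset.sum_add_distrib, Fintype.sum_prod_type, Fintype.sum_prod_type_right]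
        simp
    _ ≤ rowNorm M i ^ 2 := by
        rw [rowNorm_sq, ← Finset.sum_add_distrib]
        refine Finset.sum_le_sum fun a _ => ?_
        rcases lt_trichotomy i a with h | h | h
        · simp [h, h.not_gt]
        · subst h; simp [sq_nonneg]
        · simp [h, h.not_gt]

end UpperPositions

section SymmetricSampling

variable {d k : ℕ}

/-- The ratio between the conditional mean of the rescaled observations of the entries off the
diagonal and these entries, if `q` positions on the diagonal and `b` positions above the diagonal
are observed. -/
def offDiagRatio (d q b : ℕ) : ℝ :=
  (d : ℝ) * d / ((q + 2 * b : ℕ) : ℝ) * ((b : ℝ) / Fintype.card (Upper d))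

/-- The difference between the rescaled observations and their conditional mean, on the diagonal. -/
def diagCorrection (M : Matrix (Fin d) (Fin d) ℝ) (D : Fin d → Bool) (b : ℕ) (i : Fin d) : ℝ :=
  ((if D i then (d : ℝ) * d / ((successes D + 2 * b : ℕ) : ℝ) else 0) -
    offDiagRatio d (successes D) b) * M i i

/-- The conditional mean of the rescaled observations. -/
def symmMean (M : Matrix (Fin d) (Fin d) ℝ) (D : Fin d → Bool) (b : ℕ) : Matrix (Fin d) (Fin d) ℝ :=
  offDiagRatio d (successes D) b • M + Matrix.diagonal (diagCorrection M D b)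

/-- The conditional mean of the rescaled observations with centred noise. -/
def noisySymm (M : Matrix (Fin d) (Fin d) ℝ) (D : Fin d → Bool) (b : ℕ) (ω : Upper d → Bool) :
    Matrix (Fin d) (Fin d) ℝ :=
  symmMean M D b + bernSum ((b : ℝ) / Fintype.card (Upper d)) (edgeMat (fun e => e.1.1)
    (fun e => e.1.2) (fun e => offDiagRatio d (successes D) b * M e.1.1 e.1.2)) ω

lemma rescaledObs_transpose {M : Matrix (Fin d) (Fin d) ℝ} (hM : Mᵀ = M) {S : Set (Fin d × Fin d)}
    (hS : ∀ x, x.swap ∈ S ↔ x ∈ S) : (rescaledObs S M)ᵀ = rescaledObs S M := by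
  ext i j
  have h1 : M j i = M i j := congrFun (congrFun hM i) j
  have h3 : (j, i) ∈ S ↔ (i, j) ∈ S := hS (i, j)
  by_cases h : (i, j) ∈ S
  · simp [rescaledObs, proj, h, h3.2 h, h1]
  · simp [rescaledObs, proj, h, mt h3.1 h]

lemma noisySymm_pattern {M : Matrix (Fin d) (Fin d) ℝ} (hM : Mᵀ = M) {S : Set (Fin d × Fin d)}
    (hS : ∀ x, x.swap ∈ S ↔ x ∈ S) (hb : 0 < successes (upperPattern S)) :
    noisySymm M (diagPattern S) (successes (upperPattern S)) (upperPattern S) =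
      rescaledObs S M := by
  have hs : ∀ a b, M a b = M b a := fun a b => by
    conv_lhs => rw [← hM]
    rfl
  have hN : 0 < Fintype.card (Upper d) := hb.trans_le (successes_le _)
  set b := successes (upperPattern S) with hbdef
  set p := (b : ℝ) / Fintype.card (Upper d) with hp
  have hp0 : p ≠ 0 := by
    have h1 : (0 : ℝ) < b := by exact_mod_cast hb
    have h2 : (0 : ℝ) < Fintype.card (Upper d) := by exact_mod_cast hN
    rw [hp]; positivity
  set θ := offDiagRatio d (successes (diagPattern S)) b with hθ
  have hcard : S.ncard = successes (diagPattern S) + 2 * b := ncard_eq_of_swap_mem hS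
  have hθp : θ = (d : ℝ) * d / (S.ncard : ℝ) * p := by rw [hθ, offDiagRatio, hcard]
  have hentry : ∀ x : Fin d × Fin d, θ * M x.1 x.2 + bernXi p (pattern S x) * (θ * M x.1 x.2) =
      rescaledObs S M x.1 x.2 := fun x => by
    by_cases h : x ∈ S
    · have h2 : pattern S x = true := (pattern_eq_true _ _).2 h
      simp only [rescaledObs, proj, Matrix.smul_apply, Matrix.of_apply, h, if_true, bernXi, h2,
        smul_eq_mul]
      rw [hθp]
      field_simp
      ring
    · have h2 : pattern S x = false := by
        rw [← Bool.not_eq_true, pattern_eq_true]; exact h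
      simp [rescaledObs, proj, h, bernXi, h2]
  have hsum : ∀ i j, bernSum p (edgeMat (fun e : Upper d => e.1.1)
      (fun e => e.1.2) (fun e => θ * M e.1.1 e.1.2)) (upperPattern S) i j =
      (if i < j then bernXi p (pattern S (i, j)) * (θ * M i j) else 0) +
        if j < i then bernXi p (pattern S (j, i)) * (θ * M j i) else 0 :=
    sum_upper_edgeMat_apply (fun x => bernXi p (pattern S x)) (fun x => θ * M x.1 x.2)
  ext i j
  rw [noisySymm, symmMean, ← hθ, ← hp, Matrix.add_apply, hsum, Matrix.add_apply,
    Matrix.smul_apply, smul_eq_mul]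
  rcases lt_trichotomy i j with h | h | h
  · rw [Matrix.diagonal_apply_ne _ h.ne, if_pos h, if_neg h.not_gt, add_zero, add_zero]
    exact hentry (i, j)
  · subst h
    rw [Matrix.diagonal_apply_eq, if_neg (lt_irrefl i), add_zero, add_zero, diagCorrection, ← hθ,
      ← hcard, diagPattern]
    by_cases h : (i, i) ∈ S
    · have h2 : pattern S (i, i) = true := (pattern_eq_true _ _).2 h
      simp only [rescaledObs, proj, Matrix.smul_apply, Matrix.of_apply, h, if_true, h2,
        smul_eq_mul]
      ring
    · have h2 : pattern S (i, i) = false := by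
        rw [← Bool.not_eq_true, pattern_eq_true]; exact h
      simp [rescaledObs, proj, h, h2]
  · rw [Matrix.diagonal_apply_ne _ h.ne', if_neg h.not_gt, if_pos h, add_zero, zero_add]
    have h1 := hentry (j, i)
    simp only at h1
    rw [hs i j, h1]
    exact congrFun (congrFun (rescaledObs_transpose hM hS) i) j

lemma abs_offDiagRatio_sub_one_le {q b : ℕ} (hd : 2 ≤ d) (hq : q ≤ d)
    (hb : b ≤ Fintype.card (Upper d)) {x : ℝ} (hx : 0 < x) (hxm : x * d ≤ ((q + 2 * b : ℕ) : ℝ)) :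
    |offDiagRatio d q b - 1| ≤ 2 / x := by
  have hN := two_mul_card_upper_add (d := d)
  rw [offDiagRatio]
  set N := Fintype.card (Upper d)
  have hN' : 2 * (N : ℝ) + d = d * d := by exact_mod_cast hN
  have hd' : (2 : ℝ) ≤ d := by exact_mod_cast hd
  have hq' : (q : ℝ) ≤ d := by exact_mod_cast hq
  have hb' : (b : ℝ) ≤ N := by exact_mod_cast hb
  push_cast at hxm ⊢
  set m : ℝ := q + 2 * b with hm
  have hq0 : (0 : ℝ) ≤ q := by positivity
  have hb0 : (0 : ℝ) ≤ b := by positivity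
  have hm0 : 0 < m := lt_of_lt_of_le (by positivity) hxm
  have hNe : (N : ℝ) = d * (d - 1) / 2 := by linarith
  have hd1 : (0 : ℝ) < d - 1 := by linarith
  have hxd : x ≤ d := by nlinarith
  have e : (d : ℝ) * d / m * (b / N) - 1 = (2 * b) / (m * (d - 1)) - q / m := by
    rw [hNe]
    field_simp
    rw [hm]; ring
  have h1 : (2 * b : ℝ) / (m * (d - 1)) ≤ 2 / x := by
    rw [div_le_div_iff₀ (by positivity) hx]
    have h2 : x ≤ 2 * (d - 1) := by linarith
    have h3 : 2 * (b : ℝ) ≤ m := by linarith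
    calc 2 * (b : ℝ) * x ≤ m * (2 * (d - 1)) := by gcongr
      _ = _ := by ring
  have h2 : (q : ℝ) / m ≤ 2 / x := by
    rw [div_le_div_iff₀ hm0 hx]
    nlinarith
  have h3 : (0 : ℝ) ≤ (2 * b : ℝ) / (m * (d - 1)) := by positivity
  have h4 : (0 : ℝ) ≤ (q : ℝ) / m := by positivity
  rw [e, abs_le]
  constructor <;> linarith

lemma sampleThreshold_eq (M : Matrix (Fin d) (Fin d) ℝ) (k : ℕ) (μ : ℝ) :
    sampleThreshold M k μ d =
      (10 ^ 10 * (μ * k ^ 2 * condNum M ^ 2 * Real.log d)) * d := by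
  rw [sampleThreshold]; ring

/-- The mean of the rescaled observations is close to the matrix. -/
lemma IncoherentSVD.symmMean_estimates {M : Matrix (Fin d) (Fin d) ℝ} {μ : ℝ}
    {X : Matrix (Fin d) (Fin k) ℝ} {s : Fin k → ℝ} {Y : Matrix (Fin d) (Fin k) ℝ}
    (h : IncoherentSVD M k μ X s Y) (hk : 1 ≤ k) (hd : 2 ≤ d) (D : Fin d → Bool) {b : ℕ}
    (hb : b ≤ Fintype.card (Upper d))
    (hm : sampleThreshold M k μ d ≤ ((successes D + 2 * b : ℕ) : ℝ)) :
    0 < b ∧ |offDiagRatio d (successes D) b - 1| ≤ 1 / 1000 ∧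
      |offDiagRatio d (successes D) b - 1| * specNorm M ≤ sigmaMin M / (10 ^ 9 * k) ∧
      ∀ i, |diagCorrection M D b i| ≤ sigmaMin M / (10 ^ 9 * k) := by
  have hk' : (1 : ℝ) ≤ k := by exact_mod_cast hk
  have hκ := h.one_le_condNum
  have hμ := h.one_le
  have hσ := h.pos
  have hS := h.specNorm_eq
  have hd' : (2 : ℝ) ≤ d := by exact_mod_cast hd
  have hlog : 1 / 2 ≤ Real.log d := by
    have := Real.log_le_log (by norm_num) hd'
    have := Real.log_two_gt_d9
    linarith
  rw [sampleThreshold_eq] at hm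
  set x : ℝ := 10 ^ 10 * (μ * k ^ 2 * condNum M ^ 2 * Real.log d) with hx
  have hxy : 5 * 10 ^ 9 * (μ * k ^ 2 * condNum M ^ 2) ≤ x := by
    have : 0 ≤ μ * k ^ 2 * condNum M ^ 2 := by positivity
    rw [hx]; nlinarith
  have hkκ : 1 ≤ k * condNum M := one_le_mul_of_one_le_of_one_le hk' hκ
  have hz : 5 * 10 ^ 9 * (μ * k * (k * condNum M)) ≤ x := by
    refine le_trans ?_ hxy
    have : μ * k ^ 2 * condNum M ^ 2 = (μ * k * (k * condNum M)) * condNum M := by ring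
    rw [this]
    have : 0 ≤ μ * k * (k * condNum M) := by positivity
    nlinarith
  have hμk : 1 ≤ μ * k := one_le_mul_of_one_le_of_one_le hμ hk'
  have hz2 : 5 * 10 ^ 9 * (k * condNum M) ≤ x := by nlinarith
  have hx9 : 5 * 10 ^ 9 ≤ x := by nlinarith
  have hx0 : 0 < x := by linarith
  have hq : successes D ≤ d := by simpa using successes_le D
  have hθ := abs_offDiagRatio_sub_one_le hd hq hb hx0 hm
  have hN := two_mul_card_upper_add (d := d)
  set θ := offDiagRatio d (successes D) b with hθdef
  set m := successes D + 2 * b with hmdef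
  have hmd : (m : ℝ) ≤ d * d := by
    have : m ≤ d * d := by omega
    exact_mod_cast this
  have hm0 : (0 : ℝ) < m := lt_of_lt_of_le (by positivity) hm
  have hxd : x ≤ d := by nlinarith
  have h2x : 2 / x ≤ 1 / 1000 := by
    rw [div_le_div_iff₀ hx0 (by norm_num)]; linarith
  refine ⟨?_, hθ.trans h2x, ?_, fun i => ?_⟩
  · by_contra hb0
    have hb0' : b = 0 := by omega
    have h1 : (m : ℝ) ≤ d := by rw [hmdef, hb0']; exact_mod_cast (by omega)
    nlinarith
  · rw [hS]
    calc _ ≤ 2 / x * (condNum M * sigmaMin M) := by gcongr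
      _ ≤ sigmaMin M / (10 ^ 9 * k) := by
        rw [div_mul_eq_mul_div, div_le_div_iff₀ hx0 (by positivity)]
        calc 2 * (condNum M * sigmaMin M) * (10 ^ 9 * k) =
              sigmaMin M * (2 * 10 ^ 9 * (k * condNum M)) := by ring
          _ ≤ sigmaMin M * x := by
              refine mul_le_mul_of_nonneg_left ?_ hσ.le
              linarith
  · have h1 := h.abs_entry_le i i
    rw [Real.mul_self_sqrt (by positivity)] at h1
    set ν : ℝ := (d : ℝ) * d / (m : ℝ) with hν
    have hν0 : 0 ≤ ν := by positivity
    have h2 : |(if D i then ν else 0) - θ| ≤ ν + 2 := by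
      have := abs_le.1 (hθ.trans h2x)
      rw [abs_le]
      split_ifs <;> constructor <;> linarith
    have h3 : (ν + 2) * (μ * k / d) ≤ 3 * (μ * k) / x := by
      have e1 : ν * (μ * k / d) ≤ μ * k / x := by
        have : ν * (μ * k / d) = μ * k * d / m := by
          rw [hν]; field_simp
        rw [this, div_le_div_iff₀ hm0 hx0]
        nlinarith
      have e2 : μ * k / d ≤ μ * k / x := by gcongr
      have e3 : 3 * (μ * k) / x = μ * k / x + 2 * (μ * k / x) := by ring
      rw [e3]; linarith
    rw [diagCorrection, abs_mul]
    calc _ ≤ (ν + 2) * (μ * k / d * specNorm M) := by gcongr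
      _ = (ν + 2) * (μ * k / d) * (condNum M * sigmaMin M) := by rw [hS]; ring
      _ ≤ 3 * (μ * k) / x * (condNum M * sigmaMin M) := by gcongr
      _ ≤ sigmaMin M / (10 ^ 9 * k) := by
        rw [div_mul_eq_mul_div, div_le_div_iff₀ hx0 (by positivity)]
        calc 3 * (μ * k) * (condNum M * sigmaMin M) * (10 ^ 9 * k) =
              sigmaMin M * (3 * 10 ^ 9 * (μ * k * (k * condNum M))) := by ring
          _ ≤ sigmaMin M * x := by
              refine mul_le_mul_of_nonneg_left ?_ hσ.le
              have : 0 ≤ μ * k * (k * condNum M) := by positivity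
              linarith

/-- `T` is close to `M`, and its spectral truncations have small rows. -/
def GoodSymm (M T : Matrix (Fin d) (Fin d) ℝ) (k : ℕ) (ρ : ℝ) : Prop :=
  (∀ x, ‖act T x - act M x‖ ≤ sigmaMin M / (100 * √k) * ‖x‖) ∧
    ∀ P, SpectralGap (act T) P (3 / 4 * sigmaMin M) (1 / 4 * sigmaMin M) →
      ∀ i, ‖act T (P (EuclideanSpace.single i 1))‖ ≤ 13 / 10 * (ρ * specNorm M)

lemma IncoherentSVD.exists_spectralGap {M : Matrix (Fin d) (Fin d) ℝ} {μ : ℝ}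
    {X : Matrix (Fin d) (Fin k) ℝ} {s : Fin k → ℝ} {Y : Matrix (Fin d) (Fin k) ℝ}
    (h : IncoherentSVD M k μ X s Y) (hM : Mᵀ = M) :
    ∃ P, SpectralGap (act M) P (sigmaMin M) 0 := by
  have h1 := firstProj_eq_of_symm (k := k) h.hX h.hY (fun i _ => h.pos.trans_le (h.le i)) hM
    (by simpa using h.eq)
  have h2 := h.svdGap
  rw [h1] at h2
  exact ⟨_, h2.spectralGap⟩

lemma IncoherentSVD.bernP_not_goodSymm_le {M : Matrix (Fin d) (Fin d) ℝ} {μ : ℝ}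
    {X : Matrix (Fin d) (Fin k) ℝ} {s : Fin k → ℝ} {Y : Matrix (Fin d) (Fin k) ℝ}
    (h : IncoherentSVD M k μ X s Y) (hM : Mᵀ = M) (hk : 1 ≤ k) (hd : 2 ≤ d) (D : Fin d → Bool)
    {b : ℕ} (hb : b ≤ Fintype.card (Upper d))
    (hm : sampleThreshold M k μ d ≤ ((successes D + 2 * b : ℕ) : ℝ)) :
    bernP ((b : ℝ) / Fintype.card (Upper d))
      (fun ω => ¬ GoodSymm M (noisySymm M D b ω) k √(μ * k / d)) ≤
      3 * (d : ℝ) ^ 2 * Real.exp (-(20 * Real.log d)) := by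
  obtain ⟨hb0, hθ1, hθS, hc⟩ := h.symmMean_estimates hk hd D hb hm
  have hk' : (1 : ℝ) ≤ k := by exact_mod_cast hk
  have hsk : √(k : ℝ) ≤ k := by
    rw [Real.sqrt_le_left (by positivity)]; nlinarith
  have hsk0 : 0 < √(k : ℝ) := by positivity
  have hκ := h.one_le_condNum
  have hμ := h.one_le
  have hσ := h.pos
  have hS := h.specNorm_eq
  have hS0 := specNorm_nonneg M
  have hd' : (2 : ℝ) ≤ d := by exact_mod_cast hd
  have hL := one_le_twenty_log hd'
  have hlog : 0 < Real.log d := by linarith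
  have hN0 : (0 : ℝ) < Fintype.card (Upper d) := by exact_mod_cast hb0.trans_le hb
  have hb0' : (0 : ℝ) < b := by exact_mod_cast hb0
  have hp : 0 < (b : ℝ) / Fintype.card (Upper d) := by positivity
  have hp1 : (b : ℝ) / Fintype.card (Upper d) ≤ 1 := by
    rw [div_le_one hN0]; exact_mod_cast hb
  obtain ⟨Pr, hg⟩ := h.exists_spectralGap hM
  set R := √(μ * k / d) with hR
  have hR0 : 0 < R := by positivity
  set θ := offDiagRatio d (successes D) b with hθ
  have hθb := abs_le.1 hθ1
  have hθ2 : θ ^ 2 ≤ 2 := by nlinarith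
  have hmc : (0 : ℝ) < ((successes D + 2 * b : ℕ) : ℝ) := by
    exact_mod_cast (by omega : 0 < successes D + 2 * b)
  have hMt : ∀ i, rowNorm M i = ‖act M (EuclideanSpace.single i 1)‖ := fun i => by
    rw [rowNorm_eq, hM]
  have := bernP_not_incoherent_truncation_le (V := Fin d) (β := Upper d)
    (u := fun e => e.1.1) (v := fun e => e.1.2) (a := fun e => θ * M e.1.1 e.1.2) hp hp1
    (fun e => e.2.ne) hL (r := k) hk (R := fun _ => R) (fun _ => hR0) hσ h.sigma_le ?_ ?_ ?_
    (M₀ := symmMean M D b) ?_ hg (κ := Fin k) (by simp)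
    ((WithLp.linearEquiv 2 ℝ (Fin k → ℝ)).toLinearMap ∘ₗ act Yᵀ) ?_ ?_
    (b := fun i => θ • act M (EuclideanSpace.single i 1)) (c := diagCorrection M D b)
    (fun i => ?_) ?_ (fun i => (hc i).trans ?_)
  · refine this.trans_eq ?_
    simp
  · intro i
    have h1 := sum_upper_incident_le hM i
    have h2 := h.norm_col_le i
    rw [← hMt] at h2
    have h3 : rowNorm M i ^ 2 ≤ (R * specNorm M) ^ 2 := by
      have := rowNorm_nonneg M i
      gcongr
    calc _ = θ ^ 2 * ∑ e : Upper d, if e.1.1 = i ∨ e.1.2 = i then M e.1.1 e.1.2 ^ 2 else 0 := by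
          rw [Finset.mul_sum]
          refine Finset.sum_congr rfl fun e _ => ?_
          split_ifs
          · ring
          · ring
      _ ≤ θ ^ 2 * rowNorm M i ^ 2 := by gcongr
      _ ≤ 2 * (R * specNorm M) ^ 2 := by gcongr
  · intro e
    have h1 := h.abs_entry_le e.1.1 e.1.2
    have h2 : M e.1.1 e.1.2 ^ 2 ≤ (R * R * specNorm M) ^ 2 := by
      rw [← sq_abs (M e.1.1 e.1.2)]; gcongr
    calc (θ * M e.1.1 e.1.2) ^ 2 = θ ^ 2 * M e.1.1 e.1.2 ^ 2 := by ring
      _ ≤ _ := by gcongr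
  · intro i
    have hθm : θ * ((successes D + 2 * b : ℕ) : ℝ) =
        d * d * ((b : ℝ) / Fintype.card (Upper d)) := by
      rw [hθ, offDiagRatio]; field_simp
    have hpm : sampleThreshold M k μ d ≤ 2 * (d * d * ((b : ℝ) / Fintype.card (Upper d))) := by
      rw [← hθm]; nlinarith
    rw [sampleThreshold] at hpm
    rw [hR, Real.sq_sqrt (by positivity), hS]
    set p := (b : ℝ) / Fintype.card (Upper d)
    calc _ = sigmaMin M ^ 2 / (d * d) * (20 * (μ * d * k ^ 2 * condNum M ^ 2 * Real.log d)) := by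
          field_simp
      _ ≤ sigmaMin M ^ 2 / (d * d) * (1 / 10 ^ 7 * (d * d * p)) := by
          refine mul_le_mul_of_nonneg_left ?_ (by positivity)
          have : 0 ≤ μ * d * k ^ 2 * condNum M ^ 2 * Real.log d := by positivity
          nlinarith
      _ = _ := by field_simp
  · rw [symmMean, Matrix.transpose_add, Matrix.transpose_smul, hM, Matrix.diagonal_transpose]
  · intro x hx
    refine h.act_eq_zero ?_
    ext i
    exact congrFun hx i
  · intro x
    have e1 : act (symmMean M D b) x - act M x =
        (θ - 1) • act M x + act (Matrix.diagonal (diagCorrection M D b)) x := by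
      rw [symmMean, act_add, act_smul, sub_smul, one_smul]; abel
    have e2 := norm_act_diagonal_le x (fun i _ => hc i)
      (by positivity : 0 ≤ sigmaMin M / (10 ^ 9 * k))
    have e3 := norm_act_le_specNorm M x
    have e4 : sigmaMin M / (10 ^ 9 * k) ≤ sigmaMin M / (200 * √k) / 2 := by
      rw [div_div]
      refine div_le_div_of_nonneg_left hσ.le (by positivity) ?_
      nlinarith
    rw [e1]
    refine (norm_add_le _ _).trans ?_
    rw [norm_smul, Real.norm_eq_abs]
    calc _ ≤ |θ - 1| * (specNorm M * ‖x‖) + sigmaMin M / (10 ^ 9 * k) * ‖x‖ := by gcongr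
      _ = (|θ - 1| * specNorm M + sigmaMin M / (10 ^ 9 * k)) * ‖x‖ := by ring
      _ ≤ _ := by
        refine mul_le_mul_of_nonneg_right ?_ (norm_nonneg x)
        linarith
  · rw [symmMean, act_add, act_smul]
    congr 1
    ext j
    rw [act_single]
    by_cases hj : j = i
    · subst hj; simp
    · simp [hj]
  · intro i
    rw [norm_smul, Real.norm_eq_abs, abs_of_nonneg (by linarith)]
    have := h.norm_col_le i
    refine mul_le_mul (by linarith) this (norm_nonneg _) (by norm_num)
  · rw [div_le_iff₀ (by positivity)]
    nlinarith

theorem IncoherentSVD.le_real_goodSymm {M : Matrix (Fin d) (Fin d) ℝ} {μ : ℝ}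
    {X : Matrix (Fin d) (Fin k) ℝ} {s : Fin k → ℝ} {Y : Matrix (Fin d) (Fin k) ℝ}
    (h : IncoherentSVD M k μ X s Y) (hM : Mᵀ = M) (hk : 1 ≤ k)
    {P : Measure (Set (Fin d × Fin d))} (hP : IsUniformSampling P) :
    1 - 1 / (d : ℝ) ^ 10 ≤ P.real {Ω | sampleThreshold M k μ d ≤ ((symmClosure Ω).ncard : ℝ) →
      GoodSymm M (rescaledObs (symmClosure Ω) M) k √(μ * k / d)} := by
  have hd0 := (h.dim_pos hk).1
  by_cases hd1 : d = 1
  · subst hd1; simp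
  have hd : 2 ≤ d := by omega
  have hd' : (2 : ℝ) ≤ d := by exact_mod_cast hd
  have : Nonempty (Fin d × Fin d) := ⟨(⟨0, hd0⟩, ⟨0, hd0⟩)⟩
  have hN := two_mul_card_upper_add (d := d)
  have hN0 : 0 < Fintype.card (Upper d) := by nlinarith
  set Bad : (Fin d → Bool) → (Upper d → Bool) → Prop := fun D ω =>
    sampleThreshold M k μ d ≤ ((successes D + 2 * successes ω : ℕ) : ℝ) ∧
      ¬ GoodSymm M (noisySymm M D (successes ω) ω) k √(μ * k / d) with hBad
  refine le_trans ?_ (hP.le_real_of_bernP (fun Ω => diagPattern (symmClosure Ω))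
    (fun Ω => upperPattern (symmClosure Ω)) exists_perm_pattern hN0 Bad
    (ε := 3 * (d : ℝ) ^ 2 * Real.exp (-(20 * Real.log d))) ?_ _ ?_)
  · have h1 : (Fintype.card (Upper d) : ℝ) ≤ (d : ℝ) ^ 2 := by
      have : Fintype.card (Upper d) ≤ d ^ 2 := by nlinarith
      exact_mod_cast this
    have := failure_le (d := d) (V := (d : ℝ)) hd' h1 (by positivity) (by linarith)
    linarith
  · intro D b hb
    by_cases hbt : sampleThreshold M k μ d ≤ ((successes D + 2 * b : ℕ) : ℝ)
    · refine le_trans (bernP_mono (by positivity) ?_ ?_) (h.bernP_not_goodSymm_le hM hk hd D hb hbt)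
      · exact div_le_one_of_le₀ (by exact_mod_cast hb) (by positivity)
      · rintro ω ⟨rfl, hω⟩
        exact hω.2
    · rw [bernP_eq_zero_of_forall_not]
      · positivity
      · rintro ω ⟨rfl, hω⟩
        exact hbt hω.1
  · intro Ω hΩ hthr
    rw [ncard_eq_of_swap_mem swap_mem_symmClosure] at hthr
    have h1 : GoodSymm M (noisySymm M (diagPattern (symmClosure Ω))
        (successes (upperPattern (symmClosure Ω))) (upperPattern (symmClosure Ω))) k
        √(μ * k / d) := by
      by_contra hne
      exact hΩ ⟨hthr, hne⟩
    rwa [noisySymm_pattern hM swap_mem_symmClosure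
      (h.symmMean_estimates hk hd _ (successes_le _) hthr).1] at h1

theorem le_real_symmetric_topSVD (hk : 1 ≤ k) {M : Matrix (Fin d) (Fin d) ℝ} {μ : ℝ}
    (hr : M.rank = k) (hpsd : M.PosSemidef) (hinc : IsIncoherent M k μ)
    {P : Measure (Set (Fin d × Fin d))} (hP : IsUniformSampling P) :
    1 - 1 / (d : ℝ) ^ 10 ≤
      P.real {Ω | 10 ^ 10 * μ * d * k ^ 2 * condNum M ^ 2 * Real.log d ≤
          ((symmClosure Ω).ncard : ℝ) →
        (∃ U₀ : Matrix (Fin d) (Fin k) ℝ,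
          IsTopSVD k (rescaledObs (symmClosure Ω) M) (U₀ * U₀ᵀ)) ∧
        ∀ U₀ : Matrix (Fin d) (Fin k) ℝ,
          IsTopSVD k (rescaledObs (symmClosure Ω) M) (U₀ * U₀ᵀ) →
            frobNorm (M - U₀ * U₀ᵀ) ≤ 1 / 20 * sigmaMin M ∧
            ∀ j, rowNorm U₀ j ^ 2 ≤ 10 * μ * k * condNum M / d * specNorm M} := by
  obtain ⟨X, s, Y, h⟩ := hinc.exists_svd hk hr
  have hM : Mᵀ = M := by
    have := hpsd.1
    rwa [Matrix.IsHermitian, Matrix.conjTranspose_eq_transpose_of_trivial] at this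
  obtain ⟨hd₁, hd₂⟩ := h.dim_pos hk
  have : Nonempty (Fin d × Fin d) := ⟨(⟨0, hd₁⟩, ⟨0, hd₂⟩)⟩
  have := hP.isProbabilityMeasure
  have hσ := h.pos
  have hμ := h.one_le
  have hk1 : 1 ≤ √(k : ℝ) := by rw [Real.one_le_sqrt]; exact_mod_cast hk
  refine (h.le_real_goodSymm hM hk hP).trans (measureReal_mono fun Ω hΩ hthr => ?_)
  obtain ⟨hclose, hrows⟩ := hΩ hthr
  set T := rescaledObs (symmClosure Ω) M
  have hT : Tᵀ = T := rescaledObs_transpose hM swap_mem_symmClosure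
  refine ⟨exists_isTopSVD_mul_transpose h hpsd hT ?_ hclose, fun U hU => ?_⟩
  · have : sigmaMin M / (100 * √k) ≤ 1 / 100 * sigmaMin M := by
      rw [div_le_iff₀ (by positivity)]; nlinarith
    linarith
  obtain ⟨hF, PX, PY, hgap, hUV, n, X', Y', s', hX', hY', hs', hB, hPX, hPY⟩ :=
    h.truncation_spec hk le_rfl hclose hU
  refine ⟨hF, fun j => ?_⟩
  have hPP : PX = PY := by
    rw [hPX, hPY]
    exact firstProj_eq_of_symm hX' hY' hs'
      (by rw [Matrix.transpose_mul, Matrix.transpose_transpose]) hB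
  have h1 := (hgap.le_norm_truncation rfl hUV).1 j
  have h2 : rowNorm (U * Uᵀ) j ≤ 13 / 10 * (√(μ * k / d) * specNorm M) := by
    have hg := hgap.mono (b' := 3 / 4 * sigmaMin M) (by linarith) le_rfl
    rw [hPP] at hg
    have h3 := hrows _ hg.spectralGap j
    rw [rowNorm_eq, Matrix.transpose_mul, Matrix.transpose_transpose, hUV, act_mul]
    exact h3
  have h3 : rowNorm (U * Uᵀ) j ^ 2 ≤ 169 / 100 * (μ * k / d) * specNorm M ^ 2 := by
    have := rowNorm_nonneg (U * Uᵀ) j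
    calc _ ≤ (13 / 10 * (√(μ * k / d) * specNorm M)) ^ 2 := by gcongr
      _ = 169 / 100 * √(μ * k / d) ^ 2 * specNorm M ^ 2 := by ring
      _ = _ := by rw [Real.sq_sqrt (by positivity)]
  refine (balanced_row_le hσ (by positivity) (h1.trans h3)).trans_eq ?_
  rw [condNum]; ring

end SymmetricSampling

end MatrixCompletion

end

open MatrixCompletion in
theorem lemma4 :
    ∃ c₀ : ℝ, 0 < c₀ ∧
      -- the general case
      (∀ (d₁ d₂ k : ℕ) (M : Matrix (Fin d₁) (Fin d₂) ℝ) (μ d : ℝ),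
        1 ≤ k → M.rank = k → IsIncoherent M k μ → d = max (d₁ : ℝ) (d₂ : ℝ) →
        ∀ P : Measure (Set (Fin d₁ × Fin d₂)), IsUniformSampling P →
          1 - 1 / d ^ 10 ≤
            P.real {Ω | c₀ * μ * d * k ^ 2 * condNum M ^ 2 * Real.log d ≤ (Ω.ncard : ℝ) →
              ∀ (U₀ : Matrix (Fin d₁) (Fin k) ℝ) (V₀ : Matrix (Fin d₂) (Fin k) ℝ),
                IsTopSVD k (rescaledObs Ω M) (U₀ * V₀ᵀ) →
                  frobNorm (M - U₀ * V₀ᵀ) ≤ 1 / 20 * sigmaMin M ∧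
                  (∀ i, rowNorm (U₀ * V₀ᵀ) i ^ 2 ≤ 10 * μ * k / d₁ * specNorm M ^ 2) ∧
                  (∀ j, rowNorm (V₀ * U₀ᵀ) j ^ 2 ≤ 10 * μ * k / d₂ * specNorm M ^ 2)}) ∧
      -- the positive semidefinite case
      (∀ (d k : ℕ) (M : Matrix (Fin d) (Fin d) ℝ) (μ : ℝ),
        1 ≤ k → M.rank = k → M.PosSemidef → IsIncoherent M k μ →
        ∀ P : Measure (Set (Fin d × Fin d)), IsUniformSampling P →
          -- the sampled positions as they are; `U₀ = V₀` is allowed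
          1 - 1 / (d : ℝ) ^ 10 ≤
            P.real {Ω | c₀ * μ * d * k ^ 2 * condNum M ^ 2 * Real.log d ≤ (Ω.ncard : ℝ) →
              ∀ U₀ V₀ : Matrix (Fin d) (Fin k) ℝ, U₀ᵀ * U₀ = V₀ᵀ * V₀ →
                IsTopSVD k (rescaledObs Ω M) (U₀ * V₀ᵀ) →
                  frobNorm (M - U₀ * V₀ᵀ) ≤ 1 / 20 * sigmaMin M ∧
                  ∀ j, rowNorm U₀ j ^ 2 ≤ 10 * μ * k * condNum M / d * specNorm M ∧
                    rowNorm V₀ j ^ 2 ≤ 10 * μ * k * condNum M / d * specNorm M} ∧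
          -- the sampled positions and their transposes
          1 - 1 / (d : ℝ) ^ 10 ≤
            P.real {Ω | c₀ * μ * d * k ^ 2 * condNum M ^ 2 * Real.log d ≤
                ((symmClosure Ω).ncard : ℝ) →
              (∃ U₀ : Matrix (Fin d) (Fin k) ℝ,
                IsTopSVD k (rescaledObs (symmClosure Ω) M) (U₀ * U₀ᵀ)) ∧
              ∀ U₀ : Matrix (Fin d) (Fin k) ℝ,
                IsTopSVD k (rescaledObs (symmClosure Ω) M) (U₀ * U₀ᵀ) →
                  frobNorm (M - U₀ * U₀ᵀ) ≤ 1 / 20 * sigmaMin M ∧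
                  ∀ j, rowNorm U₀ j ^ 2 ≤ 10 * μ * k * condNum M / d * specNorm M}) := by
  refine ⟨10 ^ 10, by norm_num, ?_, ?_⟩
  · intro d₁ d₂ k M μ d hk hr hM hd P hP
    exact le_real_topSVD hk hr hM hd hP
  · intro d k M μ hk hr hpsd hM P hP
    exact ⟨le_real_balanced_topSVD hk hr hM hP, le_real_symmetric_topSVD hk hr hpsd hM hP⟩
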